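/- Let $\Gamma$ be a group with identity $e$ and let $R=\bigoplus_{\gamma\in\Gamma}R_\gamma$ be a $\Gamma$-graded ring (associative, with $1$). **Graded division rings.** A nonzero $\Gamma$-graded ring is a *$\Gamma$-graded division ring* if each of its nonzero homogeneous elements is invertible. A *$\Gamma$-graded epic $R$-division ring* is a pair $(K,\varphi)$ where $K$ is a $\Gamma$-graded division ring and $\varphi\colon R\to K$ is a degree-preserving ring homomorphism such that $K$ is the least subring of $K$ that contains $\varphi(R)$ and is closed under inverses of its nonzero homogeneous elements. **Homogeneous matrices.** For $\overline\alpha\in\Gamma^m$, $\overline\beta\in\Gamma^n$ let $M_{m\times n}(R)[\overline\alpha][\overline\beta]$ be the set of $m\times n$ matrices whose $(i,j)$-entry lies in $R_{\alpha_i\beta_j^{-1}}$. Let $\mathfrak M(R)$ be the union, over $n\ge 1$ and $\overline\alpha,\overline\beta\in\Gamma^n$, of the sets $M_{n\times n}(R)[\overline\alpha][\overline\beta]$. A matrix $A\in\mathfrak M(R)$ of size $n$ is *gr-full* if $r\ge n$ whenever $A=PQ$ with $P\in M_{n\times r}(R)[\overline\alpha][\overline\lambda]$ and $Q\in M_{r\times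 n}(R)[\overline\lambda][\overline\beta]$ for some $\overline\alpha,\overline\beta\in\Gamma^n$, $\overline\lambda\in\Gamma^r$, $r\ge 0$. Let $\mathcal N$ be the set of all $A\in\mathfrak M(R)$ that are not gr-full. Write $A\oplus B=\begin{pmatrix}A&0\\0&B\end{pmatrix}$. If $A,B\in M_{n\times n}(R)[\overline\alpha][\overline\beta]$ (same $\overline\alpha,\overline\beta$) differ at most in one column (or at most in one row), their *determinantal sum* $A\nabla B$ is obtained by adding these columns (rows) and keeping the others. **Gr-specializations.** Let $(K,\varphi)$, $(L,\psi)$ be $\Gamma$-graded epic $R$-division rings and let $\Sigma_L$ be the set of those $A\in\mathfrak M(R)$ whose image under $\psi$ is invertible over $L$. If all matrices in $\Sigma_L$ become invertible over $K$ under $\varphi$, the *core* $\mathfrak C_L(K)$ is the image in $K$ of the universal localization of $R$ at $\Sigma_L$, that is, the subring of $K$ generated by $\varphi(R)$ and the entries of the inverses of the images of the matrices in $\Sigma_L$; otherwise the core does not exist. A *gr-specialization* from $(K,\varphi)$ to $(L,\psi)$ is a degree-preserving ring homomorphism $f\colon\mathfrak C_L(K)\to L$, where the core exists, with $f\varphi=\psi$.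 A *universal $\Gamma$-graded epic $R$-division ring* is an initial object of the category of $\Gamma$-graded epic $R$-division rings and gr-specializations: a $(K,\varphi)$ from which there is exactly one gr-specialization to every $\Gamma$-graded epic $R$-division ring. **Matrix ideals.** A subset $\mathcal P\subseteq\mathfrak M(R)$ is a *gr-prime matrix ideal* if (1) $\mathcal N\subseteq\mathcal P$; (2) $A\nabla B\in\mathcal P$ whenever $A,B\in\mathcal P$ and $A\nabla B$ is defined; (3) $A\oplus B\in\mathcal P$ for all $A\in\mathcal P$, $B\in\mathfrak M(R)$; (4) if $A,B\in\mathfrak M(R)$ and $A\oplus B\in\mathcal P$, then $A\in\mathcal P$ or $B\in\mathcal P$; (5) the $1\times1$ matrix $(1)$ is not in $\mathcal P$; (6) $EAF\in\mathcal P$ for all $A\in\mathcal P$ and all permutation matrices $E,F$ of the size of $A$. Let $\mathcal A(\mathcal N)$ be the set of all matrices obtained from elements of $\mathcal N$ by finitely many (possibly no) determinantal sums, with any choice of parentheses. The *gr-matrix nilradical* of $R$ is $$\mathfrak N=\Big\{A\in\mathfrak M(R) : \text{there are } r,n\ge 1 \text{ with } (\underbrace{A\oplus\cdots\oplus A}_{r})\oplus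 I_n\in\mathcal A(\mathcal N)\Big\}.$$ **Theorem.** There exists a universal $\Gamma$-graded epic $R$-division ring if and only if the gr-matrix nilradical $\mathfrak N$ is a gr-prime matrix ideal. -/

import Mathlib

universe u v

namespace GradedDivision

/-! Throughout, the grading group `Γ` is an arbitrary (not necessarily commutative) group written
additively, as Mathlib's `GradedRing` requires: `α - β` stands for `α β⁻¹`. -/

/-! ### Graded division rings -/

/-- A graded ring is a graded division ring if it is nonzero and every nonzero homogeneous element
is invertible. -/
def IsGrDivisionRing {Γ : Type v} {K : Type u} [Ring K] (𝒦 : Γ → AddSubgroup K) : Prop :=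
  Nontrivial K ∧ ∀ x : K, SetLike.IsHomogeneousElem 𝒦 x → x ≠ 0 → IsUnit x

/-- The graded division closure of `φ : R → K`: the least subring of `K` that contains the image
of `φ` and is closed under inversion of those of its homogeneous elements that are invertible
in `K`. -/
def divisionClosure {Γ : Type v} {R K : Type u} [Ring R] [Ring K] (𝒦 : Γ → AddSubgroup K)
    (φ : R →+* K) : Subring K :=
  sInf {S : Subring K | (∀ r, φ r ∈ S) ∧
    ∀ x ∈ S, SetLike.IsHomogeneousElem 𝒦 x → ∀ y : K, x * y = 1 → y * x = 1 → y ∈ S}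

/-- A `Γ`-graded epic `R`-division ring `(K, φ)`: a `Γ`-graded division ring `K` with a
homomorphism of `Γ`-graded rings `φ : R → K` such that `K` is generated, as a graded division ring,
by the image of `φ`. (Such a `K` has cardinality at most `max (#R) ℵ₀`, so every one of them has an
isomorphic copy in the universe of `R`.) -/
structure GrEpicDivisionRing {Γ : Type v} [AddGroup Γ] [DecidableEq Γ] {R : Type u} [Ring R]
    (𝒜 : Γ → AddSubgroup R) where
  carrier : Type u
  [ring : Ring carrier]
  grading : Γ → AddSubgroup carrier
  [gradedRing : GradedRing grading]
  map : R →+* carrier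
  map_mem : ∀ (γ : Γ) (r : R), r ∈ 𝒜 γ → map r ∈ grading γ
  isGrDivisionRing : IsGrDivisionRing grading
  epic : divisionClosure grading map = ⊤

attribute [instance] GrEpicDivisionRing.ring GrEpicDivisionRing.gradedRing

/-! ### Homogeneous matrices -/

/-- `A ∈ M_{m × n}(R)[α][β]`: the `(i, j)` entry of `A` has degree `α i - β j`. -/
def HasDist {Γ : Type v} [AddGroup Γ] {R : Type u} [Ring R] (𝒜 : Γ → AddSubgroup R) {m n : ℕ}
    (α : Fin m → Γ) (β : Fin n → Γ) (A : Matrix (Fin m) (Fin n) R) : Prop :=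
  ∀ i j, A i j ∈ 𝒜 (α i - β j)

/-- Square matrices of arbitrary size. -/
abbrev SqMat (R : Type u) : Type u := Σ n : ℕ, Matrix (Fin n) (Fin n) R

/-- `𝔐(R)`: the set of all homogeneous square matrices (of size at least one). -/
def homMat {Γ : Type v} [AddGroup Γ] {R : Type u} [Ring R] (𝒜 : Γ → AddSubgroup R) :
    Set (SqMat R) :=
  {A | 0 < A.1 ∧ ∃ α β : Fin A.1 → Γ, HasDist 𝒜 α β A.2}

/-- An `n × n` matrix is gr-full if it is no product of homogeneous matrices of sizes `n × r` and
`r × n` with compatible distributions and `r < n` (here `r = 0` is allowed). -/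
def IsGrFull {Γ : Type v} [AddGroup Γ] {R : Type u} [Ring R] (𝒜 : Γ → AddSubgroup R)
    (A : SqMat R) : Prop :=
  ∀ (r : ℕ) (α β : Fin A.1 → Γ) (l : Fin r → Γ)
    (P : Matrix (Fin A.1) (Fin r) R) (Q : Matrix (Fin r) (Fin A.1) R),
    HasDist 𝒜 α l P → HasDist 𝒜 l β Q → A.2 = P * Q → A.1 ≤ r

/-- `𝒩`: the set of homogeneous square matrices that are not gr-full. -/
def nonFull {Γ : Type v} [AddGroup Γ] {R : Type u} [Ring R] (𝒜 : Γ → AddSubgroup R) :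
    Set (SqMat R) :=
  {A | A ∈ homMat 𝒜 ∧ ¬ IsGrFull 𝒜 A}

/-- The identity matrix of size `n`. -/
def idMat (R : Type u) [Ring R] (n : ℕ) : SqMat R := ⟨n, 1⟩

/-- The diagonal sum `A ⊕ B`. -/
def diagSum {R : Type u} [Ring R] (A B : SqMat R) : SqMat R :=
  ⟨A.1 + B.1,
    Matrix.reindex finSumFinEquiv finSumFinEquiv (Matrix.fromBlocks A.2 0 0 B.2)⟩

/-- The diagonal sum `A ⊕ ⋯ ⊕ A` of `k + 1` copies of `A`. -/
def diagPow {R : Type u} [Ring R] (A : SqMat R) : ℕ → SqMat R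
  | 0 => A
  | k + 1 => diagSum (diagPow A k) A

/-- `C` is a determinantal sum `A ∇ B`: the matrices `A` and `B` have a common distribution, they
differ at most in one column (or row), and `C` is obtained by adding these columns (rows). -/
def IsDetSum {Γ : Type v} [AddGroup Γ] {R : Type u} [Ring R] (𝒜 : Γ → AddSubgroup R) {n : ℕ}
    (A B C : Matrix (Fin n) (Fin n) R) : Prop :=
  (∃ α β : Fin n → Γ, HasDist 𝒜 α β A ∧ HasDist 𝒜 α β B) ∧
  ((∃ j, (∀ i k, k ≠ j → A i k = B i k) ∧ C = A.updateCol j (fun i => A i j + B i j)) ∨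
   (∃ i, (∀ k j, k ≠ i → A k j = B k j) ∧ C = A.updateRow i (fun j => A i j + B i j)))

/-- The set of all matrices that are determinantal sums `A₁ ∇ A₂ ∇ ⋯ ∇ A_m` (`m ≥ 1`, with some
choice of parentheses) of elements of `W`. -/
inductive DetSums {Γ : Type v} [AddGroup Γ] {R : Type u} [Ring R] (𝒜 : Γ → AddSubgroup R)
    (W : Set (SqMat R)) : SqMat R → Prop
  | of (A : SqMat R) : A ∈ W → DetSums 𝒜 W A
  | nabla (n : ℕ) (A B C : Matrix (Fin n) (Fin n) R) : DetSums 𝒜 W ⟨n, A⟩ →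
      DetSums 𝒜 W ⟨n, B⟩ → IsDetSum 𝒜 A B C → DetSums 𝒜 W ⟨n, C⟩

/-! ### Gr-prime matrix ideals and the gr-matrix nilradical -/

/-- Gr-prime matrix ideals. -/
structure IsGrPrimeMatrixIdeal {Γ : Type v} [AddGroup Γ] {R : Type u} [Ring R]
    (𝒜 : Γ → AddSubgroup R) (P : Set (SqMat R)) : Prop where
  subset_homMat : P ⊆ homMat 𝒜
  nonFull_subset : nonFull 𝒜 ⊆ P
  detSum_mem : ∀ (n : ℕ) (A B C : Matrix (Fin n) (Fin n) R),
    (⟨n, A⟩ : SqMat R) ∈ P → (⟨n, B⟩ : SqMat R) ∈ P → IsDetSum 𝒜 A B C → (⟨n, C⟩ : SqMat R) ∈ P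
  diagSum_mem : ∀ A ∈ P, ∀ B ∈ homMat 𝒜, diagSum A B ∈ P
  mem_or_mem : ∀ A ∈ homMat 𝒜, ∀ B ∈ homMat 𝒜, diagSum A B ∈ P → A ∈ P ∨ B ∈ P
  one_notMem : idMat R 1 ∉ P
  perm_mem : ∀ A ∈ P, ∀ σ τ : Equiv.Perm (Fin A.1),
    (⟨A.1, σ.permMatrix R * A.2 * τ.permMatrix R⟩ : SqMat R) ∈ P

/-- `𝒜(𝒩)/𝔍`, the least gr-matrix ideal: the homogeneous square matrices `A` such that `A ⊕ I_n`,
for some `n ≥ 1`, is a determinantal sum of homogeneous matrices that are not gr-full. -/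
def leastGrMatrixIdeal {Γ : Type v} [AddGroup Γ] {R : Type u} [Ring R] (𝒜 : Γ → AddSubgroup R) :
    Set (SqMat R) :=
  {A | A ∈ homMat 𝒜 ∧ ∃ n : ℕ, 1 ≤ n ∧ DetSums 𝒜 (nonFull 𝒜) (diagSum A (idMat R n))}

/-- The radical of a set of homogeneous matrices. -/
def matRadical {Γ : Type v} [AddGroup Γ] {R : Type u} [Ring R] (𝒜 : Γ → AddSubgroup R)
    (I : Set (SqMat R)) : Set (SqMat R) :=
  {A | A ∈ homMat 𝒜 ∧ ∃ k : ℕ, diagPow A k ∈ I}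

/-- The gr-matrix nilradical of `R`: the radical of the least gr-matrix ideal. -/
def grMatrixNilradical {Γ : Type v} [AddGroup Γ] {R : Type u} [Ring R] (𝒜 : Γ → AddSubgroup R) :
    Set (SqMat R) :=
  matRadical 𝒜 (leastGrMatrixIdeal 𝒜)

/-! ### Gr-specializations -/

variable {Γ : Type v} [AddGroup Γ] [DecidableEq Γ] {R : Type u} [Ring R] {𝒜 : Γ → AddSubgroup R}

/-- The set `Σ_L` of homogeneous square matrices over `R` that become invertible over `L`. -/
def GrEpicDivisionRing.inverted (L : GrEpicDivisionRing 𝒜) : Set (SqMat R) :=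
  {A | A ∈ homMat 𝒜 ∧ IsUnit (A.2.map L.map)}

/-- The core `ℭ_L(K)` of `L` in `K`: the subring of `K` generated by the image of `R` and by the
entries of the inverses over `K` of the matrices of `Σ_L`. When all the matrices of `Σ_L` are
invertible over `K`, this is the image of the canonical homomorphism to `K` from the universal
localization of `R` at `Σ_L`; otherwise there is no such homomorphism, and the core is not
used. -/
def GrEpicDivisionRing.core (K L : GrEpicDivisionRing 𝒜) : Subring K.carrier :=
  Subring.closure (Set.range K.map ∪
    {x | ∃ A ∈ L.inverted, ∃ B : Matrix (Fin A.1) (Fin A.1) K.carrier,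
      A.2.map K.map * B = 1 ∧ B * A.2.map K.map = 1 ∧ ∃ i j, x = B i j})

theorem GrEpicDivisionRing.map_mem_core (K L : GrEpicDivisionRing 𝒜) (r : R) :
    K.map r ∈ K.core L :=
  Subring.subset_closure (Or.inl ⟨r, rfl⟩)

/-- A gr-specialization from `K` to `L`: the core of `L` in `K` exists (that is, the matrices of
`Σ_L` are invertible over `K`), and `toRingHom` is a homomorphism of `Γ`-graded `R`-rings from that
core to `L`. -/
@[ext]
structure GrSpecialization (K L : GrEpicDivisionRing 𝒜) where
  inverted_subset : L.inverted ⊆ K.inverted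
  toRingHom : K.core L →+* L.carrier
  map_mem : ∀ (γ : Γ) (x : K.core L), (x : K.carrier) ∈ K.grading γ → toRingHom x ∈ L.grading γ
  comm : ∀ r : R, toRingHom ⟨K.map r, K.map_mem_core L r⟩ = L.map r

/-- `K` is a universal `Γ`-graded epic `R`-division ring: it is an initial object of the category
of `Γ`-graded epic `R`-division rings and gr-specializations. -/
def GrEpicDivisionRing.IsUniversal (K : GrEpicDivisionRing 𝒜) : Prop :=
  ∀ L : GrEpicDivisionRing 𝒜, Nonempty (Unique (GrSpecialization K L))

end GradedDivision

set_option linter.unusedSectionVars false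

namespace GradedDivision

open Matrix

/-! ### Matrices with arbitrary index types -/

section Distributions

variable {Γ : Type v} [AddGroup Γ] {R : Type u} [Ring R] {𝒜 : Γ → AddSubgroup R}

/-! The theorem is a comparison of two ordered sets. To a graded epic `R`-division ring `K` belongs
its singular kernel, the set of homogeneous matrices that stay singular over `K`. Three facts are
needed.

(a) Singular kernels are gr-prime matrix ideals (`isGrPrimeMatrixIdeal_singularKernel`), and every
gr-prime matrix ideal is one (`exists_singularKernel_eq`). (b) Between two such rings there is at
most one gr-specialization, and there is one from `K` to `L` exactly when the singular kernel of `K`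
lies in that of `L` (`nonempty_unique_grSpecialization`, `inverted_subset_iff`). (c) The nilradical
is the intersection of all gr-prime matrix ideals (`grMatrixNilradical_subset`, and by Zorn's lemma
`exists_isGrPrimeMatrixIdeal_notMem`).

Hence `K` is universal if and only if its singular kernel is the least gr-prime matrix ideal, and
such a least ideal exists if and only if the intersection of all of them is prime.

The hard part is to build a division ring from a gr-prime matrix ideal `P`. Membership in `P`
behaves like the vanishing of a determinant: block triangular matrices and products are singular
exactly when a factor is (`sing_fromBlocks_upper`, `sing_mul`). If `A` is not in `P`, the element `f
A⁻¹ x + r` of the ring to be found must vanish exactly when the bordered matrix `[A -x; f r]` is in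
`P`. This is taken as a definition: adjoin to a base point the unknowns of all regular systems `A u
= x`, form the free left `R`-module on them and divide by the combinations that vanish in this
sense. In the resulting graded module `M`, Cramer's rule holds (`sum_smul_add_eq_zero_iff`) and
every regular system with right-hand side `x m`, `m` homogeneous, has exactly one solution
(`exists_solution`, `solution_unique`). Thus an endomorphism of `M` is determined by the image of
the base point, and every element of `M` is such an image (`exists_end`). The opposite of the
endomorphism ring is therefore a ring structure on `M`, and solving bordered systems inverts its
nonzero homogeneous elements.

For (b), the specialization is constructed through its graph in `K × L`, which is spanned by pairs
of values of one rational expression `f A⁻¹ x + r` over both rings. Bordered matrices show again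
that such an expression cannot vanish over `K` without vanishing over `L`. -/

/-- The version of `HasDist` for arbitrary index types. -/
def HD (𝒜 : Γ → AddSubgroup R) {ι κ : Type*} (α : ι → Γ) (β : κ → Γ) (A : Matrix ι κ R) : Prop :=
  ∀ i j, A i j ∈ 𝒜 (α i - β j)

theorem HD.submatrix {ι κ ι' κ' : Type*} {α : ι → Γ} {β : κ → Γ} {A : Matrix ι κ R}
    (h : HD 𝒜 α β A) (e : ι' → ι) (e' : κ' → κ) :
    HD 𝒜 (α ∘ e) (β ∘ e') (A.submatrix e e') := fun i j => h (e i) (e' j)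

theorem HD.shift {ι κ : Type*} {α : ι → Γ} {β : κ → Γ} {A : Matrix ι κ R} (h : HD 𝒜 α β A) (c : Γ) :
    HD 𝒜 (fun i => α i + c) (fun j => β j + c) A := fun i j => by
  simpa using h i j

theorem HD.neg {ι κ : Type*} {α : ι → Γ} {β : κ → Γ} {A : Matrix ι κ R} (h : HD 𝒜 α β A) :
    HD 𝒜 α β (-A) := fun i j => neg_mem (h i j)

theorem HD.zero {ι κ : Type*} (α : ι → Γ) (β : κ → Γ) : HD 𝒜 α β (0 : Matrix ι κ R) :=
  fun _ _ => zero_mem _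

theorem HD.fromBlocks {ι κ ι' κ' : Type*} {α : ι → Γ} {β : κ → Γ} {α' : ι' → Γ} {β' : κ' → Γ}
    {A : Matrix ι κ R} {B : Matrix ι κ' R} {C : Matrix ι' κ R} {D : Matrix ι' κ' R}
    (hA : HD 𝒜 α β A) (hB : HD 𝒜 α β' B) (hC : HD 𝒜 α' β C) (hD : HD 𝒜 α' β' D) :
    HD 𝒜 (Sum.elim α α') (Sum.elim β β') (Matrix.fromBlocks A B C D) := by
  rintro (i | i) (j | j)
  · exact hA i j
  · exact hB i j
  · exact hC i j
  · exact hD i j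

variable [DecidableEq Γ] [GradedRing 𝒜]

theorem HD.one {ι : Type*} [DecidableEq ι] (α : ι → Γ) : HD 𝒜 α α (1 : Matrix ι ι R) := by
  intro i j
  rcases eq_or_ne i j with rfl | h
  · simpa using SetLike.GradedOne.one_mem (A := 𝒜)
  · simp [Matrix.one_apply_ne h]

theorem mul_mem_sub {a b c : Γ} {x y : R} (hx : x ∈ 𝒜 (a - b)) (hy : y ∈ 𝒜 (b - c)) :
    x * y ∈ 𝒜 (a - c) := by
  have := SetLike.GradedMul.mul_mem hx hy
  rwa [sub_add_sub_cancel] at this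

theorem HD.mul {ι κ μ : Type*} [Fintype κ] {α : ι → Γ} {β : κ → Γ} {γ : μ → Γ}
    {A : Matrix ι κ R} {B : Matrix κ μ R} (hA : HD 𝒜 α β A) (hB : HD 𝒜 β γ B) :
    HD 𝒜 α γ (A * B) := fun i k =>
  sum_mem fun j _ => mul_mem_sub (hA i j) (hB j k)

end Distributions

section Sing

variable {R : Type u} [Ring R]

/-- Membership in a set of square matrices, for matrices with arbitrary index types. -/
def Sing (P : Set (SqMat R)) {ι κ : Type*} (A : Matrix ι κ R) : Prop :=
  ∃ (n : ℕ) (e : Fin n ≃ ι) (e' : Fin n ≃ κ), (⟨n, A.submatrix e e'⟩ : SqMat R) ∈ P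

/-- Invariance under permutations of the rows and of the columns. -/
def PermInv (P : Set (SqMat R)) : Prop :=
  ∀ A ∈ P, ∀ σ τ : Equiv.Perm (Fin A.1),
    (⟨A.1, σ.permMatrix R * A.2 * τ.permMatrix R⟩ : SqMat R) ∈ P

theorem permMatrix_mul_mul_permMatrix {n : ℕ} (σ τ : Equiv.Perm (Fin n))
    (A : Matrix (Fin n) (Fin n) R) :
    σ.permMatrix R * A * τ.permMatrix R = A.submatrix σ τ.symm := by
  rw [Equiv.Perm.permMatrix, Equiv.Perm.permMatrix, PEquiv.toMatrix_toPEquiv_mul,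
    PEquiv.mul_toMatrix_toPEquiv, Matrix.submatrix_submatrix]
  rfl

variable {P : Set (SqMat R)}

theorem permInv_iff : PermInv P ↔ ∀ (n : ℕ) (A : Matrix (Fin n) (Fin n) R),
    (⟨n, A⟩ : SqMat R) ∈ P → ∀ σ τ : Equiv.Perm (Fin n), (⟨n, A.submatrix σ τ⟩ : SqMat R) ∈ P := by
  constructor
  · intro h n A hA σ τ
    have := h _ hA σ τ.symm
    rwa [permMatrix_mul_mul_permMatrix] at this
  · rintro h ⟨n, A⟩ hA σ τ
    rw [permMatrix_mul_mul_permMatrix]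
    exact h n A hA _ _

/-- Two enumerations of the index types differ by permutations, so under `PermInv` any choice
decides membership. -/
theorem sing_iff_mem (hP : PermInv P) {ι κ : Type*} {A : Matrix ι κ R} {n : ℕ} (e : Fin n ≃ ι)
    (e' : Fin n ≃ κ) : Sing P A ↔ (⟨n, A.submatrix e e'⟩ : SqMat R) ∈ P := by
  refine ⟨?_, fun h => ⟨n, e, e', h⟩⟩
  rintro ⟨m, f, f', h⟩
  obtain rfl : m = n := by simpa using Fintype.card_congr (f.trans e.symm)
  have := permInv_iff.1 hP _ _ h (e.trans f.symm) (e'.trans f'.symm)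
  simpa [Matrix.submatrix_submatrix, Function.comp_def] using this

theorem sing_submatrix_of {ι κ ι' κ' : Type*} {A : Matrix ι κ R} (e : ι' ≃ ι)
    (e' : κ' ≃ κ) (h : Sing P A) : Sing P (A.submatrix e e') := by
  obtain ⟨n, f, f', h⟩ := h
  refine ⟨n, f.trans e.symm, f'.trans e'.symm, ?_⟩
  simpa [Matrix.submatrix_submatrix, Function.comp_def] using h

theorem sing_submatrix {ι κ ι' κ' : Type*} {A : Matrix ι κ R} (e : ι' ≃ ι)
    (e' : κ' ≃ κ) : Sing P (A.submatrix e e') ↔ Sing P A := by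
  refine ⟨fun h => ?_, sing_submatrix_of e e'⟩
  have h' := sing_submatrix_of e.symm e'.symm h
  rwa [Matrix.submatrix_submatrix, e.self_comp_symm, e'.self_comp_symm,
    Matrix.submatrix_id_id] at h'

theorem sing_congr {ι κ ι' κ' : Type*} {A : Matrix ι κ R} {B : Matrix ι' κ' R} (e : ι' ≃ ι)
    (e' : κ' ≃ κ) (h : ∀ i j, B i j = A (e i) (e' j)) : Sing P B ↔ Sing P A := by
  rw [← sing_submatrix e e']
  have : B = A.submatrix e e' := by ext i j; exact h i j
  rw [this]

theorem sing_fin (hP : PermInv P) (A : SqMat R) : Sing P A.2 ↔ A ∈ P :=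
  sing_iff_mem hP (Equiv.refl _) (Equiv.refl _)

theorem sing_diagSum (hP : PermInv P) (A B : SqMat R) :
    Sing P (Matrix.fromBlocks A.2 0 0 B.2) ↔ diagSum A B ∈ P :=
  sing_iff_mem hP finSumFinEquiv.symm finSumFinEquiv.symm

end Sing

/-! ### Determinant-like calculus for a gr-prime matrix ideal -/

section Prime

variable {Γ : Type v} [AddGroup Γ] [DecidableEq Γ] {R : Type u} [Ring R] {𝒜 : Γ → AddSubgroup R}
  [GradedRing 𝒜] {P : Set (SqMat R)}

theorem IsGrPrimeMatrixIdeal.permInv (hP : IsGrPrimeMatrixIdeal 𝒜 P) : PermInv P := hP.perm_mem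

variable {ι κ ι' κ' μ : Type*}

theorem exists_equiv_fin [Finite ι] (ε : ι ≃ κ) :
    ∃ n, ∃ (_ : Fin n ≃ ι) (_ : Fin n ≃ κ), True :=
  let ⟨n, ⟨e⟩⟩ := Finite.exists_equiv_fin ι
  ⟨n, e.symm, e.symm.trans ε, trivial⟩

theorem mem_homMat_of_sing [Finite ι] [Nonempty ι] {α : ι → Γ} {β : κ → Γ} {A : Matrix ι κ R}
    (hA : HD 𝒜 α β A) {n : ℕ} (e : Fin n ≃ ι) (e' : Fin n ≃ κ) :
    (⟨n, A.submatrix e e'⟩ : SqMat R) ∈ homMat 𝒜 := by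
  refine ⟨?_, α ∘ e, β ∘ e', hA.submatrix e e'⟩
  obtain ⟨i⟩ := ‹Nonempty ι›
  exact Fin.pos (e.symm i)

theorem IsGrPrimeMatrixIdeal.sing_of_factor (hP : IsGrPrimeMatrixIdeal 𝒜 P) {ρ : Type*} [Fintype ι]
    [Fintype ρ] (ε : ι ≃ κ) {α : ι → Γ} {β : κ → Γ} {l : ρ → Γ}
    {A : Matrix ι κ R} {X : Matrix ι ρ R} {Y : Matrix ρ κ R} (hX : HD 𝒜 α l X) (hY : HD 𝒜 l β Y)
    (h : A = X * Y) (hr : Fintype.card ρ < Fintype.card ι) : Sing P A := by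
  have : Nonempty ι := Fintype.card_pos_iff.1 (by omega)
  obtain ⟨n, e, e', -⟩ := exists_equiv_fin ε
  refine ⟨n, e, e', hP.nonFull_subset ⟨mem_homMat_of_sing (h ▸ hX.mul hY) e e', fun hf => ?_⟩⟩
  have hn : n = Fintype.card ι := by simpa using Fintype.card_congr e
  let r := (Fintype.equivFin ρ).symm
  have := hf _ _ _ _ (X.submatrix e r) (Y.submatrix r e') (hX.submatrix e r) (hY.submatrix r e')
    (by rw [Matrix.submatrix_mul_equiv, h])
  simp only at this
  omega

/-- Members of `homMat` have positive size. The empty matrix thus counts as regular, which starts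
several inductions. -/
theorem IsGrPrimeMatrixIdeal.not_sing_of_isEmpty (hP : IsGrPrimeMatrixIdeal 𝒜 P) [IsEmpty ι]
    {A : Matrix ι κ R} : ¬ Sing P A := by
  rintro ⟨n, e, e', h⟩
  have := (hP.subset_homMat h).1
  exact isEmptyElim (e ⟨0, this⟩)

theorem IsGrPrimeMatrixIdeal.sing_updateRow_add [DecidableEq ι] (hP : IsGrPrimeMatrixIdeal 𝒜 P)
    {α : ι → Γ} {β : κ → Γ} {A B C : Matrix ι κ R} (hA : HD 𝒜 α β A) (hB : HD 𝒜 α β B) (i : ι)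
    (hAB : ∀ k ≠ i, A k = B k) (hC : ∀ k ≠ i, C k = A k) (hCi : C i = A i + B i)
    (sA : Sing P A) (sB : Sing P B) : Sing P C := by
  obtain ⟨n, e, e', sA⟩ := sA
  rw [sing_iff_mem hP.permInv e e'] at sB ⊢
  refine hP.detSum_mem n _ _ _ sA sB
    ⟨⟨_, _, hA.submatrix e e', hB.submatrix e e'⟩, Or.inr ⟨e.symm i, fun k j hk => ?_, ?_⟩⟩
  · simp only [Matrix.submatrix_apply]
    rw [hAB]
    rintro rfl
    simp at hk
  · ext k j
    rcases eq_or_ne k (e.symm i) with rfl | hk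
    · simp [hCi]
    · rw [Matrix.updateRow_ne hk]
      simp only [Matrix.submatrix_apply]
      rw [hC]
      rintro rfl
      simp at hk

/-- Adding the rows of `B` to those of `A`, for the indices in `s`, does not change membership if
every matrix in which such a row is replaced by a row of `± B` is a member. -/
theorem IsGrPrimeMatrixIdeal.sing_add_rows [DecidableEq ι] (hP : IsGrPrimeMatrixIdeal 𝒜 P)
    {α : ι → Γ} {β : κ → Γ} {A B : Matrix ι κ R} (hA : HD 𝒜 α β A) (hB : HD 𝒜 α β B)
    (s : Finset ι)
    (h : ∀ i ∈ s, ∀ A' : Matrix ι κ R, HD 𝒜 α β A' → (∀ k ∉ s, A' k = A k) →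
      (A' i = B i ∨ A' i = - B i) → Sing P A') :
    Sing P (Matrix.of fun i => if i ∈ s then A i + B i else A i) ↔ Sing P A := by
  suffices H : ∀ t ⊆ s, Sing P (Matrix.of fun i => if i ∈ t then A i + B i else A i) ↔ Sing P A from
    H s subset_rfl
  intro t
  have hD : ∀ t : Finset ι, HD 𝒜 α β (Matrix.of fun i => if i ∈ t then A i + B i else A i) := by
    intro t i j
    by_cases hi : i ∈ t
    · simpa [hi] using add_mem (hA i j) (hB i j)
    · simpa [hi] using hA i j
  have hU : ∀ (M : Matrix ι κ R) (i : ι) (b : κ → R), HD 𝒜 α β M → (∀ j, b j ∈ 𝒜 (α i - β j)) →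
      HD 𝒜 α β (M.updateRow i b) := by
    intro M i b hM hb k j
    rcases eq_or_ne k i with rfl | hk
    · simpa using hb j
    · simpa [Matrix.updateRow_ne hk] using hM k j
  induction t using Finset.induction_on with
  | empty =>
    intro _
    have : (Matrix.of fun i => if i ∈ (∅ : Finset ι) then A i + B i else A i) = A := by ext; simp
    rw [this]
  | insert i t hi ih =>
    intro ht
    have hi' := ht (Finset.mem_insert_self i t)
    have hts : t ⊆ s := (Finset.subset_insert i t).trans ht
    rw [← ih hts]
    set M := Matrix.of fun i => if i ∈ t then A i + B i else A i with hM
    set M' := Matrix.of fun k => if k ∈ insert i t then A k + B k else A k with hM'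
    have hMM : ∀ k ≠ i, M k = M' k := by
      intro k hk
      ext j
      simp [hM, hM', hk]
    have hMi : M i = A i := by ext j; simp [hM, hi]
    have hMi' : M' i = A i + B i := by ext j; simp [hM']
    have hs : ∀ (b : κ → R), (b = B i ∨ b = - B i) → Sing P (M.updateRow i b) := by
      intro b hb
      refine h i hi' _ (hU _ _ _ (hD t) ?_) ?_ (by simpa using hb)
      · rintro j
        rcases hb with rfl | rfl
        · exact hB i j
        · exact neg_mem (hB i j)
      · intro k hk
        have hki : k ≠ i := by rintro rfl; exact hk hi'
        have hkt : k ∉ t := fun h => hk (hts h)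
        ext j
        simp [Matrix.updateRow_ne hki, hM, hkt]
    -- `M'` is the determinantal sum of `M` and of `M` with row `i` replaced by `B i`; conversely
    -- `M` is that of `M'` and of `M` with row `i` replaced by `-B i`. Both replacements are
    -- singular by `h`.
    constructor
    · intro H
      refine hP.sing_updateRow_add (hD (insert i t)) (hU _ i (- B i) (hD t) (hB.neg i)) i
        (fun k hk => ?_) (fun k hk => hMM k hk) ?_ H (hs _ (Or.inr rfl))
      · ext j
        rw [Matrix.updateRow_ne hk]
        exact (congrFun (hMM k hk) j).symm
      · rw [hMi]
        change A i = M' i + _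
        rw [hMi']
        ext j
        simp
    · intro H
      refine hP.sing_updateRow_add (hD t) (hU _ i (B i) (hD t) (hB i)) i
        (fun k hk => ?_) (fun k hk => (hMM k hk).symm) ?_ H (hs _ (Or.inl rfl))
      · ext j
        rw [Matrix.updateRow_ne hk]
      · rw [hMi']
        change _ = M i + _
        rw [hMi]
        ext j
        simp

/-- A row that is a combination of the other rows. -/
theorem IsGrPrimeMatrixIdeal.sing_of_row_eq [Fintype ι] (hP : IsGrPrimeMatrixIdeal 𝒜 P)
    (ε : ι ≃ κ) {α : ι → Γ} {β : κ → Γ} {A : Matrix ι κ R} (hA : HD 𝒜 α β A) (i : ι) (c : ι → R)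
    (hc : ∀ k, c k ∈ 𝒜 (α i - α k)) (hci : c i = 0) (h : ∀ j, A i j = ∑ k, c k * A k j) :
    Sing P A := by
  classical
  -- `A` is `X` times `A` without its row `i`: row `i` of `X` is `c`, the other rows are unit
  -- vectors. The inner size is one less than the size of `A`.
  let X : Matrix ι {k // k ≠ i} R :=
    Matrix.of fun k l => if k = i then c l else if k = l then 1 else 0
  have hX : HD 𝒜 α (fun l : {k // k ≠ i} => α l) X := by
    intro k l
    by_cases hk : k = i
    · subst hk; simpa [X] using hc l
    · by_cases hkl : k = l
      · have : X k l = 1 := by simp [X, hkl, l.2]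
        rw [this, hkl]
        simpa using SetLike.GradedOne.one_mem (A := 𝒜)
      · simp [X, hk, hkl]
  refine hP.sing_of_factor ε hX (hA.submatrix Subtype.val id) ?_ ?_
  · ext k j
    by_cases hk : k = i
    · subst hk
      rw [h, Matrix.mul_apply]
      simp only [X, Matrix.of_apply, Matrix.submatrix_apply, id, if_true]
      rw [← Fintype.sum_subtype_add_sum_subtype (fun l => l ≠ k) (fun l => c l * A l j)]
      simp only [add_eq_left]
      exact Finset.sum_eq_zero fun l _ => by
        have : l.1 = k := not_not.1 l.2
        simp [this, hci]
    · rw [Matrix.mul_apply, Finset.sum_eq_single ⟨k, hk⟩]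
      · simp [X, hk]
      · rintro ⟨l, hl⟩ _ hlk
        have : k ≠ l := fun h => hlk (by simp [h])
        simp [X, hk, this]
      · simp
  · exact Fintype.card_subtype_lt (x := i) (by simp)

/-- A hollow matrix. -/
theorem IsGrPrimeMatrixIdeal.sing_of_zero_block [Fintype ι] (hP : IsGrPrimeMatrixIdeal 𝒜 P)
    [Fintype κ] [Fintype ι'] [Fintype κ'] (ε : ι ⊕ ι' ≃ κ ⊕ κ') {α : ι ⊕ ι' → Γ} {β : κ ⊕ κ' → Γ}
    {A : Matrix (ι ⊕ ι') (κ ⊕ κ') R} (hA : HD 𝒜 α β A) (h : ∀ i j, A (Sum.inr i) (Sum.inl j) = 0)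
    (hc : Fintype.card ι < Fintype.card κ) : Sing P A := by
  classical
  have hcard := Fintype.card_congr ε
  simp only [Fintype.card_sum] at hcard
  have e : A = Matrix.fromBlocks A.toBlocks₁₁ A.toBlocks₁₂ 0 A.toBlocks₂₂ := by
    ext (i | i) (j | j) <;> simp [h, Matrix.toBlocks₁₁, Matrix.toBlocks₁₂, Matrix.toBlocks₂₂]
  -- `[A₁₁ A₁₂; 0 A₂₂] = [1 A₁₂; 0 A₂₂] [A₁₁ 0; 0 1]`, with an inner size smaller by `card κ - card
  -- ι`.
  refine hP.sing_of_factor ε (ρ := ι ⊕ κ') (α := α) (β := β)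
    (X := Matrix.fromBlocks 1 A.toBlocks₁₂ 0 A.toBlocks₂₂)
    (Y := Matrix.fromBlocks A.toBlocks₁₁ 0 0 1)
    (l := Sum.elim (α ∘ Sum.inl) (β ∘ Sum.inr)) ?_ ?_ ?_ ?_
  · rintro (i | i) (j | j)
    · exact HD.one (α ∘ Sum.inl) i j
    · exact hA _ _
    · exact zero_mem _
    · exact hA _ _
  · rintro (i | i) (j | j)
    · exact hA _ _
    · exact zero_mem _
    · exact zero_mem _
    · exact HD.one (β ∘ Sum.inr) i j
  · rw [Matrix.fromBlocks_multiply]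
    conv_lhs => rw [e]
    simp
  · simp only [Fintype.card_sum]
    omega

/-- These are the axioms on diagonal sums, together with a permutation exchanging the blocks. Empty
blocks need separate treatment because `homMat` contains no matrix of size zero. -/
theorem IsGrPrimeMatrixIdeal.sing_fromBlocks_diag (hP : IsGrPrimeMatrixIdeal 𝒜 P) [Finite ι]
    [Finite ι'] (ε : ι ≃ κ) (ε' : ι' ≃ κ') {α : ι → Γ} {β : κ → Γ} {α' : ι' → Γ} {β' : κ' → Γ}
    {A : Matrix ι κ R} {B : Matrix ι' κ' R} (hA : HD 𝒜 α β A) (hB : HD 𝒜 α' β' B) :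
    Sing P (Matrix.fromBlocks A 0 0 B) ↔ Sing P A ∨ Sing P B := by
  obtain ⟨n, e, f, -⟩ := exists_equiv_fin ε
  obtain ⟨n', e', f', -⟩ := exists_equiv_fin ε'
  have key : Sing P (Matrix.fromBlocks A 0 0 B) ↔
      diagSum ⟨n, A.submatrix e f⟩ ⟨n', B.submatrix e' f'⟩ ∈ P := by
    rw [← sing_diagSum hP.permInv]
    refine sing_congr (e.sumCongr e').symm (f.sumCongr f').symm ?_
    rintro (i | i) (j | j) <;> simp
  have key' : Sing P (Matrix.fromBlocks A 0 0 B) ↔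
      diagSum ⟨n', B.submatrix e' f'⟩ ⟨n, A.submatrix e f⟩ ∈ P := by
    rw [← sing_diagSum hP.permInv]
    refine sing_congr ((Equiv.sumComm _ _).trans (e'.sumCongr e).symm)
      ((Equiv.sumComm _ _).trans (f'.sumCongr f).symm) ?_
    rintro (i | i) (j | j) <;> simp
  rcases isEmpty_or_nonempty ι with hι | hι
  · have : IsEmpty κ := ε.symm.isEmpty
    have h1 : Sing P (Matrix.fromBlocks A 0 0 B) ↔ Sing P B := by
      refine sing_congr (Equiv.emptySum _ _) (Equiv.emptySum _ _) ?_
      rintro (i | i) (j | j)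
      · exact isEmptyElim i
      · exact isEmptyElim i
      · exact isEmptyElim j
      · simp
    rw [h1]
    exact ⟨Or.inr, fun h => h.resolve_left hP.not_sing_of_isEmpty⟩
  rcases isEmpty_or_nonempty ι' with hι' | hι'
  · have : IsEmpty κ' := ε'.symm.isEmpty
    have h1 : Sing P (Matrix.fromBlocks A 0 0 B) ↔ Sing P A := by
      refine sing_congr (Equiv.sumEmpty _ _) (Equiv.sumEmpty _ _) ?_
      rintro (i | i) (j | j)
      · simp
      · exact isEmptyElim j
      · exact isEmptyElim i
      · exact isEmptyElim i
    rw [h1]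
    exact ⟨Or.inl, fun h => h.resolve_right hP.not_sing_of_isEmpty⟩
  have hA' := mem_homMat_of_sing hA e f
  have hB' := mem_homMat_of_sing hB e' f'
  rw [sing_iff_mem hP.permInv e f, sing_iff_mem hP.permInv e' f']
  refine ⟨fun h => hP.mem_or_mem _ hA' _ hB' (key.1 h), ?_⟩
  rintro (h | h)
  · exact key.2 (hP.diagSum_mem _ h _ hB')
  · exact key'.2 (hP.diagSum_mem _ h _ hA')

/-- `C` is added to the diagonal matrix row by row. A matrix whose upper row `i` is replaced by
`±(0, C i)` is hollow: row `i` and the lower rows vanish on the columns `κ`, and only `card ι - 1`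
rows are left for these. -/
theorem IsGrPrimeMatrixIdeal.sing_fromBlocks_upper (hP : IsGrPrimeMatrixIdeal 𝒜 P) [Finite ι]
    [Finite ι'] (ε : ι ≃ κ) (ε' : ι' ≃ κ') {α : ι → Γ} {β : κ → Γ} {α' : ι' → Γ} {β' : κ' → Γ}
    {A : Matrix ι κ R} {B : Matrix ι' κ' R} {C : Matrix ι κ' R} (hA : HD 𝒜 α β A)
    (hB : HD 𝒜 α' β' B) (hC : HD 𝒜 α β' C) :
    Sing P (Matrix.fromBlocks A C 0 B) ↔ Sing P A ∨ Sing P B := by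
  classical
  have := Fintype.ofFinite ι
  have := Fintype.ofFinite ι'
  have := Fintype.ofEquiv _ ε
  have := Fintype.ofEquiv _ ε'
  rw [← hP.sing_fromBlocks_diag ε ε' hA hB]
  have h1 := HD.fromBlocks hA (HD.zero α β') (HD.zero α' β) hB
  have h2 := HD.fromBlocks (HD.zero α β) hC (HD.zero α' β) (HD.zero (𝒜 := 𝒜) α' β')
  rw [← hP.sing_add_rows h1 h2 (Finset.univ.map Function.Embedding.inl) ?_]
  · refine sing_congr (Equiv.refl _) (Equiv.refl _) ?_
    rintro (i | i) (j | j) <;> simp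
  · intro i hi A' hA' h h'
    obtain ⟨i, -, hi⟩ := Finset.mem_map.1 hi
    change Sum.inl i = _ at hi
    subst hi
    have hz : ∀ j, A' (Sum.inl i) (Sum.inl j) = 0 := by
      intro j
      rcases h' with h' | h' <;> rw [h'] <;> simp
    have hz' : ∀ k j, A' (Sum.inr k) (Sum.inl j) = 0 := by
      intro k j
      rw [h _ (by simp)]
      simp
    let e : {k // k ≠ i} ⊕ (Unit ⊕ ι') ≃ ι ⊕ ι' :=
      (Equiv.sumAssoc _ _ _).symm.trans (Equiv.sumCongr
        ((Equiv.sumCongr (Equiv.refl _) (Equiv.ofUnique Unit {k // k = i})).trans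
        ((Equiv.sumComm _ _).trans (Equiv.sumCompl (fun k => k = i)))) (Equiv.refl _))
    rw [← sing_submatrix e (Equiv.refl _)]
    refine hP.sing_of_zero_block (e.trans (ε.sumCongr ε')) (hA'.submatrix e (Equiv.refl _)) ?_ ?_
    · rintro (k | k) j
      · exact hz j
      · simpa [e] using hz' k j
    · rw [← Fintype.card_congr ε]
      exact Fintype.card_subtype_lt (x := i) (by simp)

theorem IsGrPrimeMatrixIdeal.sing_fromBlocks_lower (hP : IsGrPrimeMatrixIdeal 𝒜 P) [Finite ι]
    [Finite ι'] (ε : ι ≃ κ) (ε' : ι' ≃ κ') {α : ι → Γ} {β : κ → Γ} {α' : ι' → Γ} {β' : κ' → Γ}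
    {A : Matrix ι κ R} {B : Matrix ι' κ' R} {C : Matrix ι' κ R} (hA : HD 𝒜 α β A)
    (hB : HD 𝒜 α' β' B) (hC : HD 𝒜 α' β C) :
    Sing P (Matrix.fromBlocks A 0 C B) ↔ Sing P A ∨ Sing P B := by
  rw [or_comm, ← hP.sing_fromBlocks_upper ε' ε hB hA hC]
  refine sing_congr (Equiv.sumComm _ _) (Equiv.sumComm _ _) ?_
  rintro (i | i) (j | j) <;> simp

theorem IsGrPrimeMatrixIdeal.not_sing_one (hP : IsGrPrimeMatrixIdeal 𝒜 P) [Finite ι]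
    [DecidableEq ι] : ¬ Sing P (1 : Matrix ι ι R) := by
  have h1 : ¬ Sing P (1 : Matrix (Fin 1) (Fin 1) R) := fun h =>
    hP.one_notMem ((sing_fin hP.permInv (idMat R 1)).1 h)
  have : ∀ n, ¬ Sing P (1 : Matrix (Fin n) (Fin n) R) := by
    intro n
    induction n with
    | zero => exact hP.not_sing_of_isEmpty
    | succ n ih =>
      rw [sing_congr (A := Matrix.fromBlocks (1 : Matrix (Fin n) (Fin n) R) 0 0
        (1 : Matrix (Fin 1) (Fin 1) R)) finSumFinEquiv.symm finSumFinEquiv.symm,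
        hP.sing_fromBlocks_diag (Equiv.refl _) (Equiv.refl _) (HD.one (fun _ => 0))
          (HD.one (fun _ => 0))]
      · exact fun h => h.elim ih h1
      · intro i j
        rw [Matrix.fromBlocks_one, Matrix.one_apply, Matrix.one_apply]
        simp only [EmbeddingLike.apply_eq_iff_eq]
  obtain ⟨n, ⟨e⟩⟩ := Finite.exists_equiv_fin ι
  rw [← sing_congr (B := (1 : Matrix (Fin n) (Fin n) R)) e.symm e.symm]
  · exact this n
  · intro i j
    simp only [Matrix.one_apply, EmbeddingLike.apply_eq_iff_eq]

/-- Subtracting `X` times the upper rows turns `[1 A; X 0]` into `[1 A; 0 -XA]`. Up to an exchange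
of columns the former is block triangular with diagonal blocks `A` and `X`. The rows to be added are
combinations of the upper rows, so `sing_add_rows` applies. -/
theorem IsGrPrimeMatrixIdeal.sing_neg_mul_aux (hP : IsGrPrimeMatrixIdeal 𝒜 P) [Fintype ι]
    [Fintype κ] [Finite μ] (ε : ι ≃ κ) (ε' : κ ≃ μ) {α : ι → Γ} {β : κ → Γ} {γ : μ → Γ}
    {X : Matrix ι κ R} {A : Matrix κ μ R} (hX : HD 𝒜 α β X) (hA : HD 𝒜 β γ A) :
    Sing P (-(X * A)) ↔ Sing P X ∨ Sing P A := by
  classical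
  have h0 : Sing P (Matrix.fromBlocks (1 : Matrix κ κ R) A X 0) ↔ Sing P X ∨ Sing P A := by
    rw [or_comm, ← hP.sing_fromBlocks_upper ε' ε hA hX (HD.one β)]
    refine sing_congr (Equiv.refl _) (Equiv.sumComm _ _) ?_
    rintro (i | i) (j | j) <;> simp
  have h1 : Sing P (Matrix.fromBlocks (1 : Matrix κ κ R) A 0 (-(X * A))) ↔ Sing P (-(X * A)) := by
    rw [hP.sing_fromBlocks_upper (Equiv.refl _) (ε.trans ε') (HD.one β) (hX.mul hA).neg hA]
    simp [hP.not_sing_one]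
  have hd1 := HD.fromBlocks (HD.one β) hA hX (HD.zero (𝒜 := 𝒜) α γ)
  have hd2 := HD.fromBlocks (HD.zero β β) (HD.zero β γ) hX.neg (hX.mul hA).neg
  rw [← h0, ← h1, ← hP.sing_add_rows hd1 hd2 (Finset.univ.map Function.Embedding.inr) ?_]
  · refine sing_congr (Equiv.refl _) (Equiv.refl _) ?_
    rintro (i | i) (j | j) <;> simp
  · intro i hi A' hA' h h'
    obtain ⟨i, -, hi⟩ := Finset.mem_map.1 hi
    change Sum.inr i = _ at hi
    subst hi
    have hr : ∀ k, A' (Sum.inl k) = Matrix.fromBlocks (1 : Matrix κ κ R) A X 0 (Sum.inl k) :=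
      fun k => h _ (by simp)
    have hσ : ∃ σ : R → R, (σ = id ∨ σ = Neg.neg) ∧ ∀ j, A' (Sum.inr i) j = σ
        (Matrix.fromBlocks (0 : Matrix κ κ R) 0 (-X) (-(X * A)) (Sum.inr i) j) := by
      rcases h' with h' | h'
      · exact ⟨id, Or.inl rfl, fun j => by rw [h']; rfl⟩
      · exact ⟨Neg.neg, Or.inr rfl, fun j => by rw [h']; rfl⟩
    obtain ⟨σ, hσ, hA'i⟩ := hσ
    refine hP.sing_of_row_eq (((Equiv.refl κ).sumCongr (ε.trans ε'))) hA' (Sum.inr i)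
      (Sum.elim (fun k => σ (-X i k)) 0) ?_ (by simp) ?_
    · rintro (k | k)
      · rcases hσ with rfl | rfl
        · exact neg_mem (hX i k)
        · simpa using hX i k
      · exact zero_mem _
    · intro j
      rw [hA'i, Fintype.sum_sum_type]
      simp only [Sum.elim_inl, Sum.elim_inr, Pi.zero_apply, zero_mul, Finset.sum_const_zero,
        add_zero, hr]
      rcases j with j | j
      · rcases hσ with rfl | rfl <;> simp [Matrix.one_apply]
      · rcases hσ with rfl | rfl <;> simp [Matrix.mul_apply]

/-- The product formula up to sign, with an identity matrix as second factor, already gives the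
invariance under the sign. -/
theorem IsGrPrimeMatrixIdeal.sing_neg (hP : IsGrPrimeMatrixIdeal 𝒜 P) [Finite ι]
    (ε : ι ≃ κ) {α : ι → Γ} {β : κ → Γ} {X : Matrix ι κ R} (hX : HD 𝒜 α β X) :
    Sing P (-X) ↔ Sing P X := by
  classical
  have := Fintype.ofFinite ι
  have := Fintype.ofEquiv _ ε
  have := hP.sing_neg_mul_aux ε (Equiv.refl _) hX (HD.one β)
  simpa [hP.not_sing_one] using this

theorem IsGrPrimeMatrixIdeal.sing_mul (hP : IsGrPrimeMatrixIdeal 𝒜 P) [Finite ι]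
    [Fintype κ] (ε : ι ≃ κ) (ε' : κ ≃ μ) {α : ι → Γ} {β : κ → Γ} {γ : μ → Γ}
    {X : Matrix ι κ R} {A : Matrix κ μ R} (hX : HD 𝒜 α β X) (hA : HD 𝒜 β γ A) :
    Sing P (X * A) ↔ Sing P X ∨ Sing P A := by
  have := Fintype.ofFinite ι
  have := Finite.of_equiv _ ε'
  rw [← hP.sing_neg_mul_aux ε ε' hX hA, hP.sing_neg (ε.trans ε') (hX.mul hA)]

end Prime

end GradedDivision

namespace GradedDivision

open Matrix

/-! ### Bordered matrices -/

section Bordered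

variable {Γ : Type v} [AddGroup Γ] [DecidableEq Γ] {R : Type u} [Ring R] {𝒜 : Γ → AddSubgroup R}
  [GradedRing 𝒜] {P : Set (SqMat R)} {ι κ ι' κ' : Type*}

theorem HD.toBlocks₁₁ {α : ι ⊕ ι' → Γ} {β : κ ⊕ κ' → Γ} {A : Matrix (ι ⊕ ι') (κ ⊕ κ') R}
    (h : HD 𝒜 α β A) : HD 𝒜 (α ∘ Sum.inl) (β ∘ Sum.inl) A.toBlocks₁₁ :=
  fun i j => h (Sum.inl i) (Sum.inl j)

theorem HD.toBlocks₁₂ {α : ι ⊕ ι' → Γ} {β : κ ⊕ κ' → Γ} {A : Matrix (ι ⊕ ι') (κ ⊕ κ') R}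
    (h : HD 𝒜 α β A) : HD 𝒜 (α ∘ Sum.inl) (β ∘ Sum.inr) A.toBlocks₁₂ :=
  fun i j => h (Sum.inl i) (Sum.inr j)

theorem HD.toBlocks₂₂ {α : ι ⊕ ι' → Γ} {β : κ ⊕ κ' → Γ} {A : Matrix (ι ⊕ ι') (κ ⊕ κ') R}
    (h : HD 𝒜 α β A) : HD 𝒜 (α ∘ Sum.inr) (β ∘ Sum.inr) A.toBlocks₂₂ :=
  fun i j => h (Sum.inr i) (Sum.inr j)

/-- The bordered matrix whose Schur complement is `f A⁻¹ x + r`. -/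
def bord (A : Matrix ι κ R) (x : ι → R) (f : κ → R) (r : R) : Matrix (ι ⊕ Unit) (κ ⊕ Unit) R :=
  Matrix.fromBlocks A (Matrix.of fun i _ => -x i) (Matrix.of fun _ j => f j)
    (Matrix.of fun _ _ => r)

theorem HD.bord {α : ι → Γ} {β : κ → Γ} {γ δ : Γ} {A : Matrix ι κ R} (hA : HD 𝒜 α β A)
    {x : ι → R} (hx : ∀ i, x i ∈ 𝒜 (α i - δ)) {f : κ → R} (hf : ∀ j, f j ∈ 𝒜 (γ - β j))
    {r : R} (hr : r ∈ 𝒜 (γ - δ)) :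
    HD 𝒜 (Sum.elim α fun _ : Unit => γ) (Sum.elim β fun _ : Unit => δ) (bord A x f r) :=
  HD.fromBlocks hA (fun i _ => neg_mem (hx i)) (fun _ j => hf j) (fun _ _ => hr)

theorem IsGrPrimeMatrixIdeal.sing_bord_smul (hP : IsGrPrimeMatrixIdeal 𝒜 P) [Finite ι]
    (ε : ι ≃ κ) {α : ι → Γ} {β : κ → Γ} {γ δ η : Γ} {A : Matrix ι κ R} (hA : HD 𝒜 α β A)
    {x : ι → R} (hx : ∀ i, x i ∈ 𝒜 (α i - δ)) {f : κ → R} (hf : ∀ j, f j ∈ 𝒜 (γ - β j))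
    {r : R} (hr : r ∈ 𝒜 (γ - δ)) {a : R} (ha : a ∈ 𝒜 η) (h : Sing P (bord A x f r)) :
    Sing P (bord A x (fun j => a * f j) (a * r)) := by
  classical
  have := Fintype.ofFinite ι
  have e : bord A x (fun j => a * f j) (a * r) =
      Matrix.fromBlocks (1 : Matrix ι ι R) 0 0 (Matrix.of fun _ _ : Unit => a) * bord A x f r := by
    rw [GradedDivision.bord, GradedDivision.bord, Matrix.fromBlocks_multiply]
    congr 1 <;> ext <;> simp [Matrix.mul_apply]
  rw [e, hP.sing_mul (Equiv.refl _) (ε.sumCongr (Equiv.refl _))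
    (HD.fromBlocks (HD.one α) (HD.zero α (fun _ => γ)) (HD.zero (fun _ => η + γ) α)
      (fun _ _ => ?_)) (hA.bord hx hf hr)]
  · exact Or.inr h
  · simpa using ha

/-- The exchange of the last two summands. -/
def sumRightComm (a b c : Type*) : (a ⊕ b) ⊕ c ≃ (a ⊕ c) ⊕ b :=
  (Equiv.sumAssoc a b c).trans (((Equiv.refl a).sumCongr (Equiv.sumComm b c)).trans
    (Equiv.sumAssoc a c b).symm)

/-- Enlarging a bordered matrix by an identity block makes room for the unknowns of a second system,
with which it is then multiplied. -/
theorem IsGrPrimeMatrixIdeal.sing_bord_one (hP : IsGrPrimeMatrixIdeal 𝒜 P) [Finite ι] [Finite ι']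
    [DecidableEq ι'] (ε : ι ≃ κ) {α : ι → Γ} {β : κ → Γ} {γ δ : Γ} {A : Matrix ι κ R}
    (hA : HD 𝒜 α β A) {x : ι → R} (hx : ∀ i, x i ∈ 𝒜 (α i - δ)) {f : κ → R}
    (hf : ∀ j, f j ∈ 𝒜 (γ - β j)) {r : R} (hr : r ∈ 𝒜 (γ - δ)) :
    Sing P (bord (Matrix.fromBlocks A 0 0 (1 : Matrix ι' ι' R)) (Sum.elim x 0) (Sum.elim f 0) r) ↔
      Sing P (bord A x f r) := by
  have : Sing P (Matrix.fromBlocks (bord A x f r) 0 0 (1 : Matrix ι' ι' R)) ↔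
      Sing P (bord A x f r) := by
    rw [hP.sing_fromBlocks_diag (ε.sumCongr (Equiv.refl _)) (Equiv.refl _) (hA.bord hx hf hr)
      (HD.one (fun _ => 0))]
    simp [hP.not_sing_one]
  rw [← this]
  refine sing_congr (sumRightComm _ _ _) (sumRightComm _ _ _) ?_
  rintro ((i | i) | i) ((j | j) | j) <;> simp [sumRightComm, bord]

theorem sum_mul_mem [Fintype κ] {β : κ → Γ} {γ δ : Γ} {f d : κ → R}
    (hf : ∀ j, f j ∈ 𝒜 (γ - β j)) (hd : ∀ k, d k ∈ 𝒜 (β k - δ)) : ∑ k, f k * d k ∈ 𝒜 (γ - δ) :=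
  sum_mem fun k _ => mul_mem_sub (hf k) (hd k)

/-- If the values of the combinations `A C U⁻¹ Y + A d - x` vanish, then that of
`f C U⁻¹ Y + f d + r` is the Schur complement `f A⁻¹ x + r`. -/
theorem IsGrPrimeMatrixIdeal.sing_bord_comp (hP : IsGrPrimeMatrixIdeal 𝒜 P) [Fintype ι] [Fintype κ]
    [Fintype ι'] [Fintype κ'] (ε : ι ≃ κ) (ε' : ι' ≃ κ') {α : ι → Γ} {β : κ → Γ} {α' : ι' → Γ}
    {β' : κ' → Γ} {γ δ : Γ}
    {A : Matrix ι κ R} (hA : HD 𝒜 α β A) (sA : ¬ Sing P A)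
    {x : ι → R} (hx : ∀ i, x i ∈ 𝒜 (α i - δ)) {f : κ → R} (hf : ∀ j, f j ∈ 𝒜 (γ - β j))
    {r : R} (hr : r ∈ 𝒜 (γ - δ)) {U : Matrix ι' κ' R} (hU : HD 𝒜 α' β' U) (sU : ¬ Sing P U)
    {Y : ι' → R} (hY : ∀ i, Y i ∈ 𝒜 (α' i - δ)) {C : Matrix κ κ' R} (hC : HD 𝒜 β β' C)
    {d : κ → R} (hd : ∀ k, d k ∈ 𝒜 (β k - δ))
    (H : ∀ i, Sing P (bord U Y (fun j => ∑ k, A i k * C k j) (∑ k, A i k * d k - x i))) :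
    Sing P (bord U Y (fun j => ∑ k, f k * C k j) (∑ k, f k * d k + r)) ↔ Sing P (bord A x f r) := by
  classical
  have hAC : HD 𝒜 α β' (A * C) := hA.mul hC
  have hAd : ∀ i, ∑ k, A i k * d k ∈ 𝒜 (α i - δ) := fun i => sum_mul_mem (hA i) hd
  have hxd : ∀ i, x i - ∑ k, A i k * d k ∈ 𝒜 (α i - δ) := fun i => sub_mem (hx i) (hAd i)
  have hfC : ∀ j, ∑ k, f k * C k j ∈ 𝒜 (γ - β' j) := fun j => sum_mul_mem hf fun k => hC k j
  have hfd : ∑ k, f k * d k + r ∈ 𝒜 (γ - δ) := add_mem (sum_mul_mem hf hd) hr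
  -- the product of the bordered matrix with a regular matrix
  have h1 : Sing P (bord (Matrix.fromBlocks A (A * C) 0 U)
      (Sum.elim (fun i => x i - ∑ k, A i k * d k) Y) (Sum.elim f fun j => ∑ k, f k * C k j)
      (∑ k, f k * d k + r)) ↔ Sing P (bord A x f r) := by
    -- `[A 0 -x; 0 1 0; f 0 r] [1 C d; 0 U -Y; 0 0 1] = [A AC Ad-x; 0 U -Y; f fC fd+r]`. The second
    -- factor is block triangular with the regular diagonal blocks `1`, `U`, `1`.
    have sR : ¬ Sing P (Matrix.fromBlocks (Matrix.fromBlocks (1 : Matrix κ κ R) C 0 U)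
        (Matrix.of fun i (_ : Unit) => Sum.elim d (fun j => - Y j) i) 0
          (1 : Matrix Unit Unit R)) := by
      rw [hP.sing_fromBlocks_upper ((Equiv.refl _).sumCongr ε') (Equiv.refl _)
        (HD.fromBlocks (HD.one β) hC (HD.zero α' β) hU) (HD.one fun _ => δ),
        hP.sing_fromBlocks_upper (Equiv.refl _) ε' (HD.one β) hU hC]
      · simp [hP.not_sing_one, sU]
      · rintro (i | i) j
        · exact hd i
        · exact neg_mem (hY i)
    have hm := hP.sing_mul (((ε.sumCongr (Equiv.refl _))).sumCongr (Equiv.refl _))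
        ((((Equiv.refl _).sumCongr ε')).sumCongr (Equiv.refl _))
        (HD.bord (α := Sum.elim α α') (β := Sum.elim β α') (γ := γ) (δ := δ)
          (x := Sum.elim x 0) (f := Sum.elim f 0)
          (HD.fromBlocks hA (HD.zero _ _) (HD.zero _ _) (HD.one _)) ?_ ?_ hr)
        (HD.fromBlocks (B := Matrix.of fun i (_ : Unit) => Sum.elim d (fun j => - Y j) i)
          (HD.fromBlocks (HD.one β) hC (HD.zero α' β) hU) ?_ (HD.zero _ _)
          (HD.one fun _ => δ))
    · rw [or_iff_left sR, hP.sing_bord_one (ι' := ι') ε hA hx hf hr] at hm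
      rw [← hm]
      refine sing_congr (Equiv.refl _) (Equiv.refl _) ?_
      rintro ((i | i) | i) ((j | j) | j) <;>
        simp [bord, Matrix.mul_apply, Matrix.one_apply, sub_eq_add_neg, Finset.sum_ite_eq,
          add_comm]
    · rintro (i | i)
      · exact hx i
      · exact zero_mem _
    · rintro (i | i)
      · exact hf i
      · exact zero_mem _
    · rintro (i | i) j
      · exact hd i
      · exact neg_mem (hY i)
  -- omission of the vanishing rows
  have h2 : Sing P (bord (Matrix.fromBlocks A 0 0 U) (Sum.elim 0 Y)
      (Sum.elim f fun j => ∑ k, f k * C k j) (∑ k, f k * d k + r)) ↔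
      Sing P (bord U Y (fun j => ∑ k, f k * C k j) (∑ k, f k * d k + r)) := by
    have := hP.sing_fromBlocks_lower ε (ε'.sumCongr (Equiv.refl Unit)) hA
      (hU.bord hY hfC hfd) (C := Matrix.of (Sum.elim (fun _ _ => 0) fun _ => f)) ?_
    · rw [or_iff_right sA] at this
      rw [← this]
      refine sing_congr (Equiv.sumAssoc _ _ _) (Equiv.sumAssoc _ _ _) ?_
      rintro ((i | i) | i) ((j | j) | j) <;> simp [bord]
    · rintro (i | i) j
      · exact zero_mem _
      · exact hf j
  rw [← h1, ← h2]
  have hd1 : HD 𝒜 (Sum.elim (Sum.elim α α') fun _ : Unit => γ)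
      (Sum.elim (Sum.elim β β') fun _ : Unit => δ)
      (bord (Matrix.fromBlocks A 0 0 U) (Sum.elim 0 Y)
      (Sum.elim f fun j => ∑ k, f k * C k j) (∑ k, f k * d k + r)) := by
    refine HD.bord (HD.fromBlocks hA (HD.zero _ _) (HD.zero _ _) hU) ?_ ?_ hfd
    · rintro (i | i)
      · exact zero_mem _
      · exact hY i
    · rintro (i | i)
      · exact hf i
      · exact hfC i
  have hd2 : HD 𝒜 (Sum.elim (Sum.elim α α') fun _ : Unit => γ)
      (Sum.elim (Sum.elim β β') fun _ : Unit => δ)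
      (bord (Matrix.fromBlocks (0 : Matrix ι κ R) (A * C) (0 : Matrix ι' κ R) 0)
        (Sum.elim (fun i => x i - ∑ k, A i k * d k) 0) (0 : κ ⊕ κ' → R) 0) := by
    refine HD.bord (HD.fromBlocks (HD.zero _ _) hAC (HD.zero _ _) (HD.zero _ _)) ?_ ?_ (zero_mem _)
    · rintro (i | i)
      · exact hxd i
      · exact zero_mem _
    · rintro (i | i) <;> exact zero_mem _
  -- The two matrices differ by the rows `(0, AC, Ad - x)`, which are removed by means of `H`.
  rw [← hP.sing_add_rows hd1 hd2
    (Finset.univ.map (Function.Embedding.inl.trans Function.Embedding.inl)) ?_]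
  · symm
    refine sing_congr (Equiv.refl _) (Equiv.refl _) ?_
    rintro ((i | i) | i) ((j | j) | j) <;> simp [bord]
  · intro i hi A' hA' h h'
    obtain ⟨i, -, hi⟩ := Finset.mem_map.1 hi
    change Sum.inl (Sum.inl i) = _ at hi
    subst hi
    have hr : ∀ (k : ι') j, A' (Sum.inl (Sum.inr k)) j =
        Sum.elim (Sum.elim (fun _ => (0 : R)) (U k)) (fun _ => - Y k) j := by
      intro k j
      rw [h _ (by simp)]
      rcases j with (j | j) | j <;> simp [bord]
    obtain ⟨a, ha, hA'i⟩ : ∃ a ∈ 𝒜 0, ∀ j, A' (Sum.inl (Sum.inl i)) j = a *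
        Sum.elim (Sum.elim (fun _ => (0 : R)) (fun j => ∑ k, A i k * C k j))
          (fun _ => ∑ k, A i k * d k - x i) j := by
      rcases h' with h' | h'
      · refine ⟨1, SetLike.GradedOne.one_mem, fun j => ?_⟩
        rw [h']
        rcases j with (j | j) | j <;> simp [bord, Matrix.mul_apply]
      · refine ⟨-1, neg_mem SetLike.GradedOne.one_mem, fun j => ?_⟩
        rw [h']
        rcases j with (j | j) | j <;> simp [bord, Matrix.mul_apply]
    have hS := hP.sing_bord_smul ε' hU hY (f := fun j => ∑ k, A i k * C k j)
      (fun j => hAC i j) (sub_mem (hAd i) (hx i)) ha (H i)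
    -- Exchanging the replaced row with the last one gives a block upper triangular matrix, whose
    -- lower right block is the singular bordered matrix of `H i`, up to the sign `a`.
    let e : ι ⊕ (ι' ⊕ Unit) ≃ (ι ⊕ ι') ⊕ Unit :=
      (Equiv.sumAssoc ι ι' Unit).symm.trans (Equiv.swap (Sum.inl (Sum.inl i)) (Sum.inr ()))
    let e' : κ ⊕ (κ' ⊕ Unit) ≃ (κ ⊕ κ') ⊕ Unit := (Equiv.sumAssoc κ κ' Unit).symm
    have hM := hA'.submatrix e e'
    have he1 : ∀ k : ι', e (Sum.inr (Sum.inl k)) = Sum.inl (Sum.inr k) := fun k => by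
      change Equiv.swap (Sum.inl (Sum.inl i) : (ι ⊕ ι') ⊕ Unit) (Sum.inr ())
        (Sum.inl (Sum.inr k)) = _
      exact Equiv.swap_apply_of_ne_of_ne (by simp) (by simp)
    have he2 : e (Sum.inr (Sum.inr ())) = Sum.inl (Sum.inl i) :=
      Equiv.swap_apply_right (Sum.inl (Sum.inl i) : (ι ⊕ ι') ⊕ Unit) (Sum.inr ())
    have h22 : (A'.submatrix e e').toBlocks₂₂ = bord U Y
        (fun j => a * ∑ k, A i k * C k j) (a * (∑ k, A i k * d k - x i)) := by
      ext (k | k) (j | j)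
      · simp [Matrix.toBlocks₂₂, he1, hr, e', bord]
      · simp [Matrix.toBlocks₂₂, he1, hr, e', bord]
      · simp [Matrix.toBlocks₂₂, he2, hA'i, e', bord]
      · simp [Matrix.toBlocks₂₂, he2, hA'i, e', bord]
    have h21 : (A'.submatrix e e').toBlocks₂₁ = 0 := by
      ext (k | k) j
      · simp [Matrix.toBlocks₂₁, he1, hr, e']
      · simp [Matrix.toBlocks₂₁, he2, hA'i, e']
    rw [← sing_submatrix e e', ← Matrix.fromBlocks_toBlocks (A'.submatrix e e'), h21,
      hP.sing_fromBlocks_upper ε (ε'.sumCongr (Equiv.refl _)) hM.toBlocks₁₁ hM.toBlocks₂₂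
        hM.toBlocks₁₂, h22]
    exact Or.inr hS

end Bordered

end GradedDivision

namespace GradedDivision

open Matrix

/-! ### Graded modules -/

section Decomposition

variable {Γ : Type v} [DecidableEq Γ] {M : Type*} [AddCommGroup M]

theorem isInternal_of_closure (ℳ : Γ → AddSubgroup M)
    (h : ∀ (s : Finset Γ) (m : Γ → M), (∀ γ, m γ ∈ ℳ γ) → ∑ γ ∈ s, m γ = 0 → ∀ γ ∈ s, m γ = 0)
    (h' : AddSubgroup.closure (⋃ γ, (ℳ γ : Set M)) = ⊤) : DirectSum.IsInternal ℳ := by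
  classical
  constructor
  · rw [injective_iff_map_eq_zero]
    intro x hx
    rw [DirectSum.coeAddMonoidHom_eq_dfinsuppSum, DFinsupp.sum] at hx
    ext γ
    by_cases hγ : γ ∈ DFinsupp.support x
    · exact h _ (fun γ => (x γ : M)) (fun γ => (x γ).2) hx γ hγ
    · rw [DFinsupp.notMem_support_iff.1 hγ]
      rfl
  · rw [← AddMonoidHom.range_eq_top, eq_top_iff, ← h', AddSubgroup.closure_le]
    intro m hm
    obtain ⟨γ, hγ⟩ := Set.mem_iUnion.1 hm
    exact ⟨DirectSum.of (fun γ => ℳ γ) γ ⟨m, hγ⟩, DirectSum.coeAddMonoidHom_of _ _ _⟩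

variable (ℳ : Γ → AddSubgroup M) [DirectSum.Decomposition ℳ]

/-- The projection onto a homogeneous component. -/
def comp (γ : Γ) : M →+ M where
  toFun m := (DirectSum.decompose ℳ m γ : M)
  map_zero' := by simp
  map_add' x y := by simp

theorem comp_mem (γ : Γ) (m : M) : comp ℳ γ m ∈ ℳ γ := SetLike.coe_mem _

theorem comp_same {γ : Γ} {m : M} (h : m ∈ ℳ γ) : comp ℳ γ m = m :=
  DirectSum.decompose_of_mem_same ℳ h

theorem comp_ne {γ δ : Γ} {m : M} (h : m ∈ ℳ γ) (hne : γ ≠ δ) : comp ℳ δ m = 0 :=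
  DirectSum.decompose_of_mem_ne ℳ h hne

theorem eq_zero_of_comp {m : M} (h : ∀ γ, comp ℳ γ m = 0) : m = 0 := by
  classical
  rw [← DirectSum.sum_support_decompose ℳ m]
  exact Finset.sum_eq_zero fun γ _ => h γ

theorem mem_of_comp {m : M} {γ : Γ} (h : ∀ δ ≠ γ, comp ℳ δ m = 0) : m ∈ ℳ γ := by
  have : m - comp ℳ γ m = 0 := by
    refine eq_zero_of_comp ℳ fun δ => ?_
    rw [map_sub]
    rcases eq_or_ne δ γ with rfl | hδ
    · rw [comp_same ℳ (comp_mem ℳ _ _), sub_self]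
    · rw [h δ hδ, comp_ne ℳ (comp_mem ℳ _ _) hδ.symm, sub_self]
  rw [sub_eq_zero.1 this]
  exact comp_mem _ _ _

variable [AddGroup Γ] {R : Type u} [Ring R] {𝒜 : Γ → AddSubgroup R} [Module R M]

theorem comp_smul (hsm : ∀ {γ δ : Γ} {a : R} {m : M}, a ∈ 𝒜 γ → m ∈ ℳ δ → a • m ∈ ℳ (γ + δ))
    {γ δ : Γ} {a : R} (ha : a ∈ 𝒜 γ) (m : M) : comp ℳ (γ + δ) (a • m) = a • comp ℳ δ m := by
  induction m using DirectSum.Decomposition.inductionOn ℳ with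
  | zero => simp
  | @homogeneous η m =>
    rcases eq_or_ne η δ with rfl | h
    · rw [comp_same ℳ m.2, comp_same ℳ (hsm ha m.2)]
    · rw [comp_ne ℳ m.2 h, comp_ne ℳ (hsm ha m.2) (by simpa using h), smul_zero]
  | add m m' h h' => rw [smul_add, map_add, map_add, h, h', smul_add]

end Decomposition

/-! ### The module attached to a gr-prime matrix ideal -/

section Module

variable {Γ : Type v} [AddGroup Γ] [DecidableEq Γ] {R : Type u} [Ring R] (𝒜 : Γ → AddSubgroup R)
  [GradedRing 𝒜] (P : Set (SqMat R))

/-- An infinite system `U u = Y` of linear equations that is exhausted by finite regular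
subsystems. -/
structure Sys where
  J : Type u
  U : Matrix J J R
  Y : J → R
  α : J → Γ
  β : J → Γ
  hU : HD 𝒜 α β U
  hY : ∀ i, Y i ∈ 𝒜 (α i)
  T : Set (Finset J)
  empty_mem : ∅ ∈ T
  directed : ∀ S ∈ T, ∀ S' ∈ T, ∃ S'' ∈ T, S ⊆ S'' ∧ S' ⊆ S''
  cover : ∀ j, ∃ S ∈ T, j ∈ S
  closed : ∀ S ∈ T, ∀ i ∈ S, ∀ j ∉ S, U i j = 0
  regular : ∀ S ∈ T, ¬ Sing P (U.submatrix (Subtype.val : S → J) (Subtype.val : S → J))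
  exists_subsystem : ∀ {n : ℕ} {A : Matrix (Fin n) (Fin n) R} {α' β' : Fin n → Γ} {x : Fin n → R},
    HD 𝒜 α' β' A → (∀ i, x i ∈ 𝒜 (α' i)) → ¬ Sing P A → ∃ e : Fin n ↪ J,
      Finset.univ.map e ∈ T ∧ (∀ i j, U (e i) (e j) = A i j) ∧ ∀ i, Y (e i) = x i

variable {𝒜 P}

namespace Sys

variable (s : Sys 𝒜 P)

theorem exists_subset (S : Finset s.J) : ∃ T ∈ s.T, S ⊆ T := by
  classical
  induction S using Finset.induction_on with
  | empty => exact ⟨∅, s.empty_mem, subset_rfl⟩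
  | insert j S _ ih =>
    obtain ⟨T, hT, hST⟩ := ih
    obtain ⟨T', hT', hj⟩ := s.cover j
    obtain ⟨T'', hT'', h, h'⟩ := s.directed T hT T' hT'
    exact ⟨T'', hT'', Finset.insert_subset (h' hj) (hST.trans h)⟩

/-- The free module on a base point and on the unknowns of the system. -/
abbrev F : Type u := Option s.J →₀ R

/-- The degrees of the basis. -/
def deg (y : Option s.J) : Γ := y.elim 0 s.β

/-- The homogeneous components of the free module. -/
def homF (γ : Γ) : AddSubgroup s.F where
  carrier := {c | ∀ y, c y ∈ 𝒜 (γ - s.deg y)}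
  zero_mem' _ := zero_mem _
  add_mem' h h' y := add_mem (h y) (h' y)
  neg_mem' h y := neg_mem (h y)

/-- The projection of the free module onto a homogeneous component. -/
noncomputable def compF (γ : Γ) : s.F →+ s.F where
  toFun c := Finsupp.onFinset c.support (fun y => comp 𝒜 (γ - s.deg y) (c y)) (by
    intro y h
    rw [Finsupp.mem_support_iff]
    intro h0
    simp [h0] at h)
  map_zero' := by ext; simp
  map_add' c d := by ext; simp

theorem compF_apply (γ : Γ) (c : s.F) (y : Option s.J) :
    s.compF γ c y = comp 𝒜 (γ - s.deg y) (c y) := rfl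

theorem compF_mem (γ : Γ) (c : s.F) : s.compF γ c ∈ s.homF γ := fun _ => comp_mem 𝒜 _ _

theorem compF_same {γ : Γ} {c : s.F} (h : c ∈ s.homF γ) : s.compF γ c = c := by
  ext y
  rw [compF_apply, comp_same 𝒜 (h y)]

theorem compF_ne {γ δ : Γ} {c : s.F} (h : c ∈ s.homF γ) (hne : γ ≠ δ) : s.compF δ c = 0 := by
  ext y
  rw [compF_apply, comp_ne 𝒜 (h y) (by simpa using hne)]
  rfl

theorem smul_mem_homF {γ δ : Γ} {a : R} {c : s.F} (ha : a ∈ 𝒜 γ) (hc : c ∈ s.homF δ) :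
    a • c ∈ s.homF (γ + δ) := fun y => by
  rw [add_sub_assoc]
  exact SetLike.GradedMul.mul_mem ha (hc y)

theorem compF_smul {γ δ : Γ} {a : R} (ha : a ∈ 𝒜 γ) (c : s.F) :
    s.compF (γ + δ) (a • c) = a • s.compF δ c := by
  ext y
  rw [compF_apply, add_sub_assoc, Finsupp.smul_apply, Finsupp.smul_apply, compF_apply]
  exact comp_smul (M := R) 𝒜 (fun h h' => SetLike.GradedMul.mul_mem h h') ha (c y)

theorem closure_homF : AddSubgroup.closure (⋃ γ, (s.homF γ : Set s.F)) = ⊤ := by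
  classical
  rw [eq_top_iff]
  rintro c -
  induction c using Finsupp.induction_linear with
  | zero => exact zero_mem _
  | add f g hf hg => exact add_mem hf hg
  | single y r =>
    induction r using DirectSum.Decomposition.inductionOn 𝒜 with
    | zero => simp
    | @homogeneous δ r =>
      refine AddSubgroup.subset_closure (Set.mem_iUnion.2 ⟨δ + s.deg y, fun z => ?_⟩)
      rcases eq_or_ne y z with rfl | h
      · simp
      · simp [h]
    | add m m' h h' =>
      rw [Finsupp.single_add]
      exact add_mem h h'

/-- The matrix that decides whether `c` vanishes on the solution of the system. -/
def mat (T : Finset s.J) (c : s.F) : Matrix (T ⊕ Unit) (T ⊕ Unit) R :=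
  bord (s.U.submatrix Subtype.val Subtype.val) (fun i => s.Y i) (fun j => c (some j)) (c none)

/-- The homogeneous elements that vanish on the solution of the system. -/
def Vanish (c : s.F) : Prop := ∃ T ∈ s.T, (∀ j ∉ T, c (some j) = 0) ∧ Sing P (s.mat T c)

theorem hd_sub (T : Finset s.J) : HD 𝒜 (fun i : T => s.α i) (fun i : T => s.β i)
    (s.U.submatrix Subtype.val Subtype.val) := fun i j => s.hU i j

theorem hd_mat (T : Finset s.J) {γ : Γ} {c : s.F} (hc : c ∈ s.homF γ) :
    HD 𝒜 (Sum.elim (fun i : T => s.α i) fun _ : Unit => γ)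
      (Sum.elim (fun i : T => s.β i) fun _ : Unit => 0) (s.mat T c) :=
  (s.hd_sub T).bord (fun i => by simpa using s.hY i) (fun j => hc (some j)) (hc none)

variable (hP : IsGrPrimeMatrixIdeal 𝒜 P)
include hP

/-- With the indices of `T' \ T` first, the larger bordered matrix is block triangular: the
equations of `T` involve only unknowns of `T`. The additional diagonal block is regular because the
whole subsystem on `T'` is. -/
theorem sing_mat_of_subset {T T' : Finset s.J} (hT : T ∈ s.T) (hT' : T' ∈ s.T) (h : T ⊆ T')
    {γ : Γ} {c : s.F} (hc : c ∈ s.homF γ) (h0 : ∀ j ∉ T, c (some j) = 0) :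
    Sing P (s.mat T' c) ↔ Sing P (s.mat T c) := by
  classical
  let e0 : {j : T' // ¬ j.1 ∈ T} ⊕ T ≃ T' :=
    ((Equiv.refl _).sumCongr ⟨fun j => (⟨⟨j.1, h j.2⟩, j.2⟩ : {j : T' // j.1 ∈ T}),
      fun j => ⟨j.1.1, j.2⟩, fun _ => rfl, fun _ => rfl⟩).trans
      ((Equiv.sumComm _ _).trans (Equiv.sumCompl (fun j : T' => j.1 ∈ T)))
  let e : {j : T' // ¬ j.1 ∈ T} ⊕ (T ⊕ Unit) ≃ T' ⊕ Unit :=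
    (Equiv.sumAssoc _ _ _).symm.trans (e0.sumCongr (Equiv.refl _))
  let V : Matrix {j : T' // ¬ j.1 ∈ T} {j : T' // ¬ j.1 ∈ T} R := fun i j => s.U i.1 j.1
  have hV : HD 𝒜 (fun i : {j : T' // ¬ j.1 ∈ T} => s.α i.1) (fun i => s.β i.1) V :=
    fun i j => s.hU _ _
  have sV : ¬ Sing P V := by
    intro hs
    have := (hP.sing_fromBlocks_upper (Equiv.refl _) (Equiv.refl _) hV (s.hd_sub T)
      (C := fun (i : {j : T' // ¬ j.1 ∈ T}) (j : T) => s.U i.1 j) (fun i j => s.hU _ _)).2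
      (Or.inl hs)
    refine s.regular T' hT' ((sing_congr e0 e0 ?_).1 this)
    rintro (i | i) (j | j)
    · rfl
    · rfl
    · exact (s.closed T hT _ i.2 _ j.2).symm
    · rfl
  have := hP.sing_fromBlocks_upper (Equiv.refl _) (Equiv.refl _) hV (s.hd_mat T hc)
    (C := fun (i : {j : T' // ¬ j.1 ∈ T}) j => Sum.elim (fun j : T => s.U i.1 j)
      (fun _ => - s.Y i.1) j) ?_
  · rw [or_iff_right sV] at this
    rw [← this]
    symm
    refine sing_congr e e ?_
    rintro (i | i | i) (j | j | j)
    · rfl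
    · rfl
    · rfl
    · exact (s.closed T hT _ i.2 _ j.2).symm
    · rfl
    · rfl
    · exact (h0 _ j.2).symm
    · rfl
    · rfl
  · rintro i (j | j)
    · exact s.hU _ _
    · simpa using s.hY i.1

theorem vanish_iff {T : Finset s.J} (hT : T ∈ s.T) {γ : Γ} {c : s.F} (hc : c ∈ s.homF γ)
    (h0 : ∀ j ∉ T, c (some j) = 0) : s.Vanish c ↔ Sing P (s.mat T c) := by
  refine ⟨?_, fun h => ⟨T, hT, h0, h⟩⟩
  rintro ⟨T', hT', h0', h⟩
  obtain ⟨T'', hT'', h1, h2⟩ := s.directed T hT T' hT'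
  rw [← s.sing_mat_of_subset hP hT hT'' h1 hc h0, s.sing_mat_of_subset hP hT' hT'' h2 hc h0']
  exact h

omit hP in
theorem exists_cover (c : s.F) : ∃ T ∈ s.T, ∀ j ∉ T, c (some j) = 0 := by
  obtain ⟨T, hT, h⟩ := s.exists_subset (Finset.eraseNone c.support)
  refine ⟨T, hT, fun j hj => ?_⟩
  by_contra h0
  exact hj (h (by simpa using h0))

/-- Over a common finite subsystem the bordered matrices differ only in the last row, so that of the
sum is a determinantal sum. -/
theorem vanish_add {γ : Γ} {c d : s.F} (hc : c ∈ s.homF γ) (hd : d ∈ s.homF γ) (h : s.Vanish c)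
    (h' : s.Vanish d) : s.Vanish (c + d) := by
  classical
  obtain ⟨T, hT, hcT⟩ := s.exists_cover c
  obtain ⟨T', hT', hdT⟩ := s.exists_cover d
  obtain ⟨S, hS, h1, h2⟩ := s.directed T hT T' hT'
  have hc0 : ∀ j ∉ S, c (some j) = 0 := fun j hj => hcT j fun h => hj (h1 h)
  have hd0 : ∀ j ∉ S, d (some j) = 0 := fun j hj => hdT j fun h => hj (h2 h)
  rw [s.vanish_iff hP hS hc hc0] at h
  rw [s.vanish_iff hP hS hd hd0] at h'
  rw [s.vanish_iff hP hS (add_mem hc hd) fun j hj => by simp [hc0 j hj, hd0 j hj]]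
  refine hP.sing_updateRow_add (s.hd_mat S hc) (s.hd_mat S hd) (Sum.inr ()) ?_ ?_ ?_ h h'
  · rintro (k | k) hk
    · rfl
    · simp at hk
  · rintro (k | k) hk
    · rfl
    · simp at hk
  · ext (j | j) <;> rfl

theorem vanish_zero : s.Vanish 0 := by
  rw [s.vanish_iff hP s.empty_mem (zero_mem (s.homF 0)) (by simp)]
  refine hP.sing_of_row_eq (Equiv.refl _) (s.hd_mat ∅ (zero_mem (s.homF 0))) (Sum.inr ()) 0
    (fun _ => zero_mem _) rfl ?_
  rintro (j | j)
  · exact isEmptyElim j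
  · simp [mat, bord]

theorem vanish_smul {γ δ : Γ} {a : R} {c : s.F} (ha : a ∈ 𝒜 γ) (hc : c ∈ s.homF δ)
    (h : s.Vanish c) : s.Vanish (a • c) := by
  obtain ⟨T, hT, hcT⟩ := s.exists_cover c
  rw [s.vanish_iff hP hT hc hcT] at h
  rw [s.vanish_iff hP hT (s.smul_mem_homF ha hc) fun j hj => by simp [hcT j hj]]
  exact hP.sing_bord_smul (Equiv.refl _) (s.hd_sub T) (δ := 0) (fun i => by simpa using s.hY i)
    (fun j => hc (some j)) (hc none) ha h

/-- The elements that vanish on the solution of the system. -/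
def N : Submodule R s.F where
  carrier := {c | ∀ γ, s.Vanish (s.compF γ c)}
  zero_mem' γ := by simpa using s.vanish_zero hP
  add_mem' {c d} hc hd γ := by
    rw [map_add]
    exact s.vanish_add hP (s.compF_mem γ c) (s.compF_mem γ d) (hc γ) (hd γ)
  smul_mem' a c hc := by
    change ∀ γ, s.Vanish (s.compF γ (a • c))
    induction a using DirectSum.Decomposition.inductionOn 𝒜 with
    | zero => intro γ; simpa using s.vanish_zero hP
    | @homogeneous δ a =>
      intro γ
      have : γ = δ + (-δ + γ) := by simp
      rw [this, s.compF_smul a.2]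
      exact s.vanish_smul hP a.2 (s.compF_mem _ _) (hc _)
    | add a b ha hb =>
      intro γ
      rw [add_smul, map_add]
      exact s.vanish_add hP (s.compF_mem γ _) (s.compF_mem γ _) (ha γ) (hb γ)

theorem mem_N_of_vanish {γ : Γ} {c : s.F} (hc : c ∈ s.homF γ) (h : s.Vanish c) : c ∈ s.N hP := by
  intro δ
  rcases eq_or_ne γ δ with rfl | hne
  · rwa [s.compF_same hc]
  · rw [s.compF_ne hc hne]
    exact s.vanish_zero hP

theorem mem_N_iff {γ : Γ} {c : s.F} (hc : c ∈ s.homF γ) : c ∈ s.N hP ↔ s.Vanish c := by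
  refine ⟨fun h => ?_, s.mem_N_of_vanish hP hc⟩
  have := h γ
  rwa [s.compF_same hc] at this

/-- The module generated by the universal solution of the system. -/
abbrev M : Type u := s.F ⧸ s.N hP

/-- The homogeneous components of the module. -/
noncomputable def homM (γ : Γ) : AddSubgroup (s.M hP) := (s.homF γ).map (s.N hP).mkQ.toAddMonoidHom

/-- `N` is defined through homogeneous components, hence is a graded submodule, and the grading
passes to the quotient. -/
theorem isInternal_homM : DirectSum.IsInternal (s.homM hP) := by
  refine isInternal_of_closure _ ?_ ?_
  · intro S m hm h0 γ hγ
    choose c hc hcm using hm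
    have h1 : ∑ γ ∈ S, c γ ∈ s.N hP := by
      rw [← Submodule.ker_mkQ (s.N hP), LinearMap.mem_ker, map_sum, ← h0]
      exact Finset.sum_congr rfl fun γ _ => hcm γ
    have h2 := h1 γ
    rw [map_sum, Finset.sum_eq_single γ, s.compF_same (hc γ)] at h2
    · rw [← hcm γ]
      exact (Submodule.Quotient.mk_eq_zero _).2 (s.mem_N_of_vanish hP (hc γ) h2)
    · intro δ _ hδ
      exact s.compF_ne (hc δ) hδ
    · exact fun h => absurd hγ h
  · have := congrArg (AddSubgroup.map (s.N hP).mkQ.toAddMonoidHom) s.closure_homF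
    rw [AddMonoidHom.map_closure, Set.image_iUnion, ← AddMonoidHom.range_eq_map,
      AddMonoidHom.range_eq_top.2 (Submodule.mkQ_surjective _)] at this
    exact this

noncomputable instance decompositionM : DirectSum.Decomposition (s.homM hP) :=
  (s.isInternal_homM hP).chooseDecomposition

theorem smul_mem_homM {γ δ : Γ} {a : R} {m : s.M hP} (ha : a ∈ 𝒜 γ) (hm : m ∈ s.homM hP δ) :
    a • m ∈ s.homM hP (γ + δ) := by
  obtain ⟨c, hc, rfl⟩ := hm
  exact ⟨a • c, s.smul_mem_homF ha hc, map_smul (s.N hP).mkQ a c⟩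

/-- The base point. -/
noncomputable def pt : s.M hP := (s.N hP).mkQ (Finsupp.single none 1)

/-- The unknowns of the system. -/
noncomputable def sol (j : s.J) : s.M hP := (s.N hP).mkQ (Finsupp.single (some j) 1)

omit hP in
theorem single_mem_homF (y : Option s.J) : Finsupp.single y (1 : R) ∈ s.homF (s.deg y) := by
  classical
  intro z
  rcases eq_or_ne y z with rfl | h
  · simpa using SetLike.GradedOne.one_mem (A := 𝒜)
  · simp [h]

theorem pt_mem : s.pt hP ∈ s.homM hP 0 := ⟨_, s.single_mem_homF none, rfl⟩

theorem sol_mem (j : s.J) : s.sol hP j ∈ s.homM hP (s.β j) := ⟨_, s.single_mem_homF (some j), rfl⟩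

omit hP in
theorem eq_sum_single {T : Finset s.J} {c : s.F} (h0 : ∀ j ∉ T, c (some j) = 0) :
    c = ∑ j ∈ T, c (some j) • Finsupp.single (some j) 1 + c none • Finsupp.single none 1 := by
  classical
  ext y
  rw [Finsupp.add_apply, Finsupp.finsetSum_apply]
  rcases y with _ | y
  · simp
  · by_cases hy : y ∈ T
    · simp [Finsupp.single_apply, hy]
    · simp [Finsupp.single_apply, hy, h0 y hy]

theorem mkQ_eq {T : Finset s.J} {c : s.F} (h0 : ∀ j ∉ T, c (some j) = 0) :
    (s.N hP).mkQ c = ∑ j : T, c (some j) • s.sol hP j + c none • s.pt hP := by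
  conv_lhs => rw [s.eq_sum_single h0]
  rw [Finset.sum_coe_sort T (fun j => c (some j) • s.sol hP j)]
  simp only [map_add, map_sum, map_smul]
  rfl

/-- In the bordered matrix of the difference of the two sides, the last row repeats row `i`. -/
theorem sum_smul_sol {T : Finset s.J} (hT : T ∈ s.T) (i : T) :
    ∑ j : T, s.U i j • s.sol hP j = s.Y i • s.pt hP := by
  classical
  let c : s.F := ∑ j ∈ T, s.U i j • Finsupp.single (some j) 1 - s.Y i • Finsupp.single none 1
  have hc1 : ∀ j ∈ T, c (some j) = s.U i j := by
    intro j hj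
    simp [c, Finsupp.single_apply, hj]
  have hc2 : c none = - s.Y i := by
    simp [c]
  have hc0 : ∀ j ∉ T, c (some j) = 0 := by
    intro j hj
    simp [c, Finsupp.single_apply, hj]
  have hc : c ∈ s.homF (s.α i) := by
    rintro (_ | j)
    · rw [hc2]
      simpa [deg] using s.hY i
    · by_cases hj : j ∈ T
      · rw [hc1 j hj]
        exact s.hU i j
      · rw [hc0 j hj]
        exact zero_mem _
  have hv : s.Vanish c := by
    rw [s.vanish_iff hP hT hc hc0]
    refine hP.sing_of_row_eq (Equiv.refl _) (s.hd_mat T hc) (Sum.inr ())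
      (Sum.elim (Pi.single i 1) 0) ?_ rfl ?_
    · rintro (k | k)
      · rcases eq_or_ne k i with rfl | hk
        · simpa using SetLike.GradedOne.one_mem (A := 𝒜)
        · simp [hk]
      · exact zero_mem _
    · rintro (j | j)
      · simp [mat, bord, hc1, Pi.single_apply]
      · simp [mat, bord, hc2, Pi.single_apply]
  have := (Submodule.Quotient.mk_eq_zero _).2 (s.mem_N_of_vanish hP hc hv)
  rw [← Submodule.mkQ_apply, s.mkQ_eq hP hc0, hc2, neg_smul, add_neg_eq_zero] at this
  rw [← this]
  exact Finset.sum_congr rfl fun j _ => by rw [hc1 j j.2]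

variable {ι κ : Type*} [Fintype ι] [Fintype κ]

/-- Cramer's rule: a combination of the solution of a regular system is zero if and only if the
bordered matrix is singular. -/
theorem sum_smul_add_eq_zero_iff (ε : ι ≃ κ) {α : ι → Γ} {β : κ → Γ} {γ : Γ} {A : Matrix ι κ R}
    (hA : HD 𝒜 α β A) (sA : ¬ Sing P A) {x : ι → R} (hx : ∀ i, x i ∈ 𝒜 (α i)) {u : κ → s.M hP}
    (hu : ∀ k, u k ∈ s.homM hP (β k)) (h : ∀ i, ∑ k, A i k • u k = x i • s.pt hP)
    {f : κ → R} (hf : ∀ k, f k ∈ 𝒜 (γ - β k)) {r : R} (hr : r ∈ 𝒜 γ) :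
    ∑ k, f k • u k + r • s.pt hP = 0 ↔ Sing P (bord A x f r) := by
  classical
  choose c hc hcu using hu
  obtain ⟨T, hT, hTc⟩ := s.exists_subset
    (Finset.univ.biUnion fun k => Finset.eraseNone (c k).support)
  have hc0 : ∀ k, ∀ j ∉ T, c k (some j) = 0 := by
    intro k j hj
    by_contra h0
    exact hj (hTc (Finset.mem_biUnion.2 ⟨k, Finset.mem_univ _, by simpa using h0⟩))
  -- Write `u` as `C` times the unknowns of `T` plus `c k none` times the base point. The definition
  -- of `N` then decides any combination of `u` by a bordered matrix over `T`, and `sing_bord_comp`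
  -- converts this to one over `A`.
  have key : ∀ {γ : Γ} {f : κ → R} (_ : ∀ k, f k ∈ 𝒜 (γ - β k)) {r : R} (_ : r ∈ 𝒜 γ),
      ∑ k, f k • u k + r • s.pt hP = 0 ↔ Sing P (bord (s.U.submatrix Subtype.val Subtype.val)
        (fun i : T => s.Y i) (fun j : T => ∑ k, f k * c k (some j)) (∑ k, f k * c k none + r)) := by
    intro γ f hf r hr
    let w : s.F := ∑ k, f k • c k + r • Finsupp.single none 1
    have hw1 : ∀ j, w (some j) = ∑ k, f k * c k (some j) := by
      intro j
      simp [w]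
    have hw2 : w none = ∑ k, f k * c k none + r := by
      simp [w]
    have hw : w ∈ s.homF γ := by
      refine add_mem (sum_mem fun k _ => ?_) ?_
      · have := s.smul_mem_homF (hf k) (hc k)
        rwa [sub_add_cancel] at this
      · have := s.smul_mem_homF hr (s.single_mem_homF none)
        rwa [deg, Option.elim_none, add_zero] at this
    have hwu : (s.N hP).mkQ w = ∑ k, f k • u k + r • s.pt hP := by
      simp only [w, map_add, map_sum, map_smul]
      exact congrArg₂ _ (Finset.sum_congr rfl fun k _ => by rw [← hcu k]; rfl) rfl
    rw [← hwu, Submodule.mkQ_apply, Submodule.Quotient.mk_eq_zero, s.mem_N_iff hP hw,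
      s.vanish_iff hP hT hw fun j hj => by simp [hw1, hc0 _ _ hj], mat]
    simp only [hw1, hw2]
  rw [key hf hr]
  refine hP.sing_bord_comp (δ := 0) (C := fun k (j : T) => c k (some j)) ε (Equiv.refl _) hA sA
    (fun i => by simpa using hx i) hf (by simpa using hr) (s.hd_sub T) (s.regular T hT)
    (fun i => by simpa using s.hY i) (fun k j => hc k (some j)) (fun k => hc k none) fun i => ?_
  have := (key (hA i) (neg_mem (hx i))).1 (by rw [h, neg_smul, add_neg_cancel])
  simpa only [sub_eq_add_neg] using this

/-- Cramer's rule for the empty system: the bordered matrix of the base point is `(1)`. -/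
theorem pt_ne_zero : s.pt hP ≠ 0 := by
  intro h0
  have h := s.sum_smul_add_eq_zero_iff hP (Equiv.refl Empty) (γ := 0) (α := fun _ => 0)
    (β := fun _ => 0) (A := 0) (fun i => i.elim) hP.not_sing_of_isEmpty (x := fun _ => 0)
    (fun i => i.elim) (u := fun _ => 0) (fun i => i.elim) (fun i => i.elim) (f := fun _ => 0)
    (fun i => i.elim) (r := 1) SetLike.GradedOne.one_mem
  simp only [h0, Finset.univ_eq_empty, Finset.sum_empty, smul_zero, add_zero, true_iff] at h
  refine hP.not_sing_one (ι := Empty ⊕ Unit) ?_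
  convert h using 1
  ext (i | i) (j | j)
  · exact i.elim
  · exact i.elim
  · exact j.elim
  · simp [bord]

/-- For homogeneous `u`, Cramer's rule with `x = 0`, `r = 0` and `f` a unit vector gives the matrix
`[A 0; f 0]`, which is singular. -/
theorem solution_unique (ε : ι ≃ κ) {α : ι → Γ} {β : κ → Γ} {A : Matrix ι κ R}
    (hA : HD 𝒜 α β A) (sA : ¬ Sing P A) {u : κ → s.M hP} (h : ∀ i, ∑ k, A i k • u k = 0) (k : κ) :
    u k = 0 := by
  classical
  have hom : ∀ {α : ι → Γ} {β : κ → Γ} (_ : HD 𝒜 α β A) {u : κ → s.M hP}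
      (_ : ∀ k, u k ∈ s.homM hP (β k)) (_ : ∀ i, ∑ k, A i k • u k = 0) (k : κ), u k = 0 := by
    intro α β hA u hu h k
    have hf : ∀ l, (Pi.single k 1 : κ → R) l ∈ 𝒜 (β k - β l) := by
      intro l
      rcases eq_or_ne l k with rfl | hl
      · simpa using SetLike.GradedOne.one_mem (A := 𝒜)
      · simp [hl]
    have := (s.sum_smul_add_eq_zero_iff hP ε (γ := β k) hA sA (x := 0) (fun _ => zero_mem _) hu
      (by simpa using h) hf (zero_mem _)).2 ?_
    · simpa [Pi.single_apply, ite_smul] using this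
    · have hb := (hP.sing_fromBlocks_lower ε (Equiv.refl Unit) hA (B := 0)
        (HD.zero (fun _ => β k) (fun _ => 0))
        (C := Matrix.of fun _ l => (Pi.single k 1 : κ → R) l) (fun _ l => hf l)).2 (Or.inr ?_)
      · convert hb using 1
        ext (i | i) (j | j) <;> simp [bord]
      · exact hP.sing_of_row_eq (Equiv.refl _) (HD.zero (fun _ => 0) (fun _ => 0)) () 0
          (fun _ => zero_mem _) rfl (by simp)
  refine eq_zero_of_comp (s.homM hP) fun γ => ?_
  -- The degrees are shifted on the right so that the component of `u k` is the one of degree `γ`.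
  have := hom (hA.shift (-β k + γ)) (u := fun l => comp (s.homM hP) (β l + (-β k + γ)) (u l))
    (fun l => comp_mem _ _ _) (fun i => ?_) k
  · simpa using this
  · have h' := congrArg (comp (s.homM hP) (α i + (-β k + γ))) (h i)
    rw [map_sum, map_zero] at h'
    rw [← h']
    refine Finset.sum_congr rfl fun l _ => ?_
    rw [← comp_smul (s.homM hP) (s.smul_mem_homM hP) (hA i l)]
    congr 1
    simp [← add_assoc]

theorem exists_solution_pt (ε : ι ≃ κ) {α : ι → Γ} {β : κ → Γ} {A : Matrix ι κ R}
    (hA : HD 𝒜 α β A) (sA : ¬ Sing P A) {x : ι → R} (hx : ∀ i, x i ∈ 𝒜 (α i)) :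
    ∃ u : κ → s.M hP, (∀ k, u k ∈ s.homM hP (β k)) ∧ ∀ i, ∑ k, A i k • u k = x i • s.pt hP := by
  classical
  obtain ⟨n, e, e', -⟩ := exists_equiv_fin ε
  obtain ⟨g, hg, hgU, hgY⟩ := s.exists_subsystem (hA.submatrix e e') (x := x ∘ e)
    (fun i => hx (e i))
    (by rwa [sing_submatrix])
  refine ⟨fun k => comp (s.homM hP) (β k) (s.sol hP (g (e'.symm k))), fun k => comp_mem _ _ _,
    fun i => ?_⟩
  have h := s.sum_smul_sol hP hg ⟨g (e.symm i), by simp⟩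
  rw [Finset.sum_coe_sort _ (fun j => s.U (g (e.symm i)) j • s.sol hP j), Finset.sum_map] at h
  simp only [hgU, hgY, Matrix.submatrix_apply, Function.comp_apply, Equiv.apply_symm_apply] at h
  rw [← Equiv.sum_comp e']
  simp only [Equiv.symm_apply_apply]
  -- A matrix may have several distributions, and the degrees in the system need not be `α` and `β`.
  -- Projecting to the required components repairs this.
  have h' := congrArg (comp (s.homM hP) (α i)) h
  rw [map_sum, comp_same (s.homM hP) (m := x i • _)] at h'
  · rw [← h']
    refine Finset.sum_congr rfl fun l _ => ?_
    rw [← comp_smul (s.homM hP) (s.smul_mem_homM hP) (hA i _), sub_add_cancel]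
  · simpa using s.smul_mem_homM hP (hx i) (s.pt_mem hP)

/-- The representation of a homogeneous element. -/
theorem exists_rep {δ : Γ} {m : s.M hP} (hm : m ∈ s.homM hP δ) :
    ∃ T ∈ s.T, ∃ (g : T → R) (r : R), (∀ j : T, g j ∈ 𝒜 (δ - s.β j)) ∧ r ∈ 𝒜 δ ∧
      m = ∑ j : T, g j • s.sol hP j + r • s.pt hP := by
  obtain ⟨c, hc, rfl⟩ := hm
  obtain ⟨T, hT, h0⟩ := s.exists_cover c
  exact ⟨T, hT, fun j => c (some j), c none, fun j => hc (some j), by simpa [deg] using hc none,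
    s.mkQ_eq hP h0⟩

/-- A relation that is forced on the solution of `A u = x pt` holds for `A u = x m` too. If `m` is
`g` times unknowns plus `a` times the base point, then `u` and these unknowns solve the system `[A
-xg; 0 U]` with right-hand side `(xa, Y)`, to which Cramer's rule applies. -/
theorem sum_smul_add_eq_zero_of_sing (ε : ι ≃ κ) {α : ι → Γ} {β : κ → Γ} {γ δ : Γ}
    {A : Matrix ι κ R} (hA : HD 𝒜 α β A) (sA : ¬ Sing P A) {x : ι → R} (hx : ∀ i, x i ∈ 𝒜 (α i))
    {m : s.M hP} (hm : m ∈ s.homM hP δ) {u : κ → s.M hP}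
    (hu : ∀ k, u k ∈ s.homM hP (β k + δ)) (h : ∀ i, ∑ k, A i k • u k = x i • m)
    {f : κ → R} (hf : ∀ k, f k ∈ 𝒜 (γ - β k)) {r : R} (hr : r ∈ 𝒜 γ) (hS : Sing P (bord A x f r)) :
    ∑ k, f k • u k + r • m = 0 := by
  classical
  obtain ⟨T, hT, g, a, hg, ha, rfl⟩ := s.exists_rep hP hm
  have hC : HD 𝒜 (fun i => α i + δ) (fun j : T => s.β j) (Matrix.of fun i j => - (x i * g j)) := by
    refine fun i j => neg_mem ?_
    rw [add_sub_assoc]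
    exact SetLike.GradedMul.mul_mem (hx i) (hg j)
  have hA' := HD.fromBlocks (hA.shift δ) hC (HD.zero _ _) (s.hd_sub T)
  have hx' : ∀ i, Sum.elim (fun i => x i * a) (fun i : T => s.Y i) i ∈
      𝒜 (Sum.elim (fun i => α i + δ) (fun i : T => s.α i) i) := by
    rintro (i | i)
    · exact SetLike.GradedMul.mul_mem (hx i) ha
    · exact s.hY i
  have hf' : ∀ k, Sum.elim f (fun j => r * g j) k ∈
      𝒜 (γ + δ - Sum.elim (fun i => β i + δ) (fun i : T => s.β i) k) := by
    rintro (k | k)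
    · simpa using hf k
    · rw [add_sub_assoc]
      exact SetLike.GradedMul.mul_mem hr (hg k)
  have key := (s.sum_smul_add_eq_zero_iff hP (ε.sumCongr (Equiv.refl _)) hA' ?_ hx'
    (u := Sum.elim u fun j : T => s.sol hP j) ?_ ?_ hf' (SetLike.GradedMul.mul_mem hr ha)).2 ?_
  · rw [Fintype.sum_sum_type] at key
    simp only [Sum.elim_inl, Sum.elim_inr, mul_smul, ← Finset.smul_sum] at key
    rw [smul_add, ← add_assoc]
    exact key
  · rw [hP.sing_fromBlocks_upper ε (Equiv.refl _) (hA.shift δ) (s.hd_sub T) hC]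
    exact not_or.2 ⟨sA, s.regular T hT⟩
  · rintro (k | k)
    · exact hu k
    · exact s.sol_mem hP k
  · rintro (i | i)
    · have := h i
      rw [smul_add, ← sub_eq_iff_eq_add'] at this
      rw [Fintype.sum_sum_type]
      simp only [Matrix.fromBlocks_apply₁₁, Matrix.fromBlocks_apply₁₂, Sum.elim_inl, Sum.elim_inr,
        Matrix.of_apply, neg_smul, mul_smul, Finset.sum_neg_distrib, ← Finset.smul_sum]
      rw [← this, sub_eq_add_neg]
    · rw [Fintype.sum_sum_type]
      simpa using s.sum_smul_sol hP hT i
  -- `[A 0 -x; 0 1 0; f 0 r] [1 0 0; 0 U -Y; 0 g a] = [A -xg -xa; 0 U -Y; f rg ra]`, and the first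
  -- factor is singular by `hS`.
  · have hm := hP.sing_mul (((ε.sumCongr (Equiv.refl T))).sumCongr (Equiv.refl Unit))
      ((((Equiv.refl κ).sumCongr (Equiv.refl T))).sumCongr (Equiv.refl Unit))
      (HD.bord (α := Sum.elim (fun i => α i + δ) fun i : T => s.α i)
        (β := Sum.elim (fun i => β i + δ) fun i : T => s.α i) (γ := γ + δ) (δ := δ)
        (x := Sum.elim x 0) (f := Sum.elim f 0) (r := r)
        (HD.fromBlocks (hA.shift δ) (HD.zero _ _) (HD.zero _ _) (HD.one _)) ?_ ?_
        (by simpa using hr))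
      (HD.bord (γ := δ) (δ := 0) (x := Sum.elim 0 fun i : T => s.Y i) (f := Sum.elim 0 g) (r := a)
        (HD.fromBlocks (HD.one fun i => β i + δ) (HD.zero _ _) (HD.zero _ _) (s.hd_sub T)) ?_ ?_
        (by simpa using ha))
    · have h1 := (hP.sing_bord_one (ι' := T) (δ := 0) ε hA (fun i => by simpa using hx i) hf
        (by simpa using hr)).2 hS
      convert hm.2 (Or.inl h1) using 1
      ext ((i | i) | i) ((j | j) | j) <;> simp [bord, Matrix.mul_apply, Matrix.one_apply]
    · rintro (i | i)
      · simpa using hx i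
      · exact zero_mem _
    · rintro (i | i)
      · simpa using hf i
      · exact zero_mem _
    · rintro (i | i)
      · exact zero_mem _
      · simpa using s.hY i
    · rintro (i | i)
      · exact zero_mem _
      · exact hg i

/-- The representation of `m` by the base point and finitely many unknowns reduces this to a larger
regular system over the base point. -/
theorem exists_solution (ε : ι ≃ κ) {α : ι → Γ} {β : κ → Γ} {δ : Γ} {A : Matrix ι κ R}
    (hA : HD 𝒜 α β A) (sA : ¬ Sing P A) {x : ι → R} (hx : ∀ i, x i ∈ 𝒜 (α i))
    {m : s.M hP} (hm : m ∈ s.homM hP δ) :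
    ∃ u : κ → s.M hP, (∀ k, u k ∈ s.homM hP (β k + δ)) ∧ ∀ i, ∑ k, A i k • u k = x i • m := by
  classical
  obtain ⟨T, hT, g, a, hg, ha, rfl⟩ := s.exists_rep hP hm
  have hC : HD 𝒜 (fun i => α i + δ) (fun j : T => s.β j) (Matrix.of fun i j => - (x i * g j)) := by
    refine fun i j => neg_mem ?_
    rw [add_sub_assoc]
    exact SetLike.GradedMul.mul_mem (hx i) (hg j)
  have hA' := HD.fromBlocks (hA.shift δ) hC (HD.zero _ _) (s.hd_sub T)
  have hx' : ∀ i, Sum.elim (fun i => x i * a) (fun i : T => s.Y i) i ∈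
      𝒜 (Sum.elim (fun i => α i + δ) (fun i : T => s.α i) i) := by
    rintro (i | i)
    · exact SetLike.GradedMul.mul_mem (hx i) ha
    · exact s.hY i
  obtain ⟨u, hu, h⟩ := s.exists_solution_pt hP (ε.sumCongr (Equiv.refl _)) hA' (by
    rw [hP.sing_fromBlocks_upper ε (Equiv.refl _) (hA.shift δ) (s.hd_sub T) hC]
    exact not_or.2 ⟨sA, s.regular T hT⟩) hx'
  -- The second half of the solution satisfies the equations of `T`, so it is the given solution
  -- there; the first equations then read `A u = x m`.
  have hu2 : ∀ j : T, u (Sum.inr j) = s.sol hP j := by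
    intro j
    rw [← sub_eq_zero]
    refine s.solution_unique hP (Equiv.refl _) (s.hd_sub T) (s.regular T hT)
      (u := fun j => u (Sum.inr j) - s.sol hP j) (fun i => ?_) j
    have := h (Sum.inr i)
    rw [Fintype.sum_sum_type] at this
    simp only [smul_sub, Finset.sum_sub_distrib]
    rw [sub_eq_zero]
    refine Eq.trans ?_ (s.sum_smul_sol hP hT i).symm
    simpa using this
  refine ⟨fun k => u (Sum.inl k), fun k => hu (Sum.inl k), fun i => ?_⟩
  have := h (Sum.inl i)
  rw [Fintype.sum_sum_type] at this
  simp only [Matrix.fromBlocks_apply₁₁, Matrix.fromBlocks_apply₁₂, Sum.elim_inl, hu2,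
    Matrix.of_apply, neg_smul, mul_smul, Finset.sum_neg_distrib, ← Finset.smul_sum] at this
  rw [smul_add, ← this]
  abel

end Sys

end Module

end GradedDivision

namespace GradedDivision

open Matrix

/-! ### Endomorphisms of the module, and existence of the exhausting system -/

section Module

variable {Γ : Type v} [AddGroup Γ] [DecidableEq Γ] {R : Type u} [Ring R] {𝒜 : Γ → AddSubgroup R}
  [GradedRing 𝒜] {P : Set (SqMat R)}

namespace Sys

variable (s : Sys 𝒜 P) (hP : IsGrPrimeMatrixIdeal 𝒜 P)
include hP

/-- By closedness the equations of `T` do not see the unknowns outside `T`, so a solution on `T'`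
restricts to one on `T`, where solutions are unique. -/
theorem solution_eq_of_subset {T T' : Finset s.J} (hT : T ∈ s.T) (h : T ⊆ T') {m : s.M hP}
    {w w' : s.J → s.M hP} (hw : ∀ i ∈ T, ∑ j ∈ T, s.U i j • w j = s.Y i • m)
    (hw' : ∀ i ∈ T', ∑ j ∈ T', s.U i j • w' j = s.Y i • m) {j : s.J} (hj : j ∈ T) :
    w' j = w j := by
  rw [← sub_eq_zero]
  refine s.solution_unique hP (Equiv.refl _) (s.hd_sub T) (s.regular T hT)
    (u := fun j => w' j - w j) (fun i => ?_) ⟨j, hj⟩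
  simp only [smul_sub, Finset.sum_sub_distrib, Matrix.submatrix_apply]
  rw [sub_eq_zero, Finset.sum_coe_sort T (fun j => s.U i j • w j), hw i i.2,
    Finset.sum_coe_sort T (fun j => s.U i j • w' j), ← hw' i (h i.2)]
  refine Finset.sum_subset h fun k _ hkT => ?_
  rw [s.closed T hT i i.2 k hkT, zero_smul]

theorem exists_solution_finset {T : Finset s.J} (hT : T ∈ s.T) {δ : Γ} {m : s.M hP}
    (hm : m ∈ s.homM hP δ) : ∃ w : s.J → s.M hP, (∀ j ∈ T, w j ∈ s.homM hP (s.β j + δ)) ∧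
      ∀ i ∈ T, ∑ j ∈ T, s.U i j • w j = s.Y i • m := by
  classical
  obtain ⟨w, hw, hwT⟩ := s.exists_solution hP (Equiv.refl T) (s.hd_sub T) (s.regular T hT)
    (fun i => s.hY i) hm
  refine ⟨fun j => if hj : j ∈ T then w ⟨j, hj⟩ else 0, fun j hj => ?_, fun i hi => ?_⟩
  · simpa only [dif_pos hj] using hw ⟨j, hj⟩
  · rw [← hwT ⟨i, hi⟩, ← Finset.sum_coe_sort]
    refine Finset.sum_congr rfl fun k _ => ?_
    exact congrArg (s.U i k • ·) (dif_pos k.2)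

/-- The solutions on the finite subsystems agree on overlaps by directedness, hence glue. -/
theorem exists_solution_sys {δ : Γ} {m : s.M hP} (hm : m ∈ s.homM hP δ) :
    ∃ v : s.J → s.M hP, (∀ j, v j ∈ s.homM hP (s.β j + δ)) ∧
      ∀ T ∈ s.T, ∀ i ∈ T, ∑ j ∈ T, s.U i j • v j = s.Y i • m := by
  choose w hw hwT using fun T : s.T => s.exists_solution_finset hP T.2 hm
  choose T hT hjT using s.cover
  refine ⟨fun j => w ⟨T j, hT j⟩ j, fun j => hw _ j (hjT j), fun S hS i hi => ?_⟩
  rw [← hwT ⟨S, hS⟩ i hi]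
  refine Finset.sum_congr rfl fun j hj => ?_
  obtain ⟨S', hS', h, h'⟩ := s.directed S hS (T j) (hT j)
  exact congrArg (s.U i j • ·)
    ((s.solution_eq_of_subset hP (hT j) h' (hwT ⟨T j, hT j⟩) (hwT ⟨S', hS'⟩) (hjT j)).symm.trans
      (s.solution_eq_of_subset hP hS h (hwT ⟨S, hS⟩) (hwT ⟨S', hS'⟩) hj))

/-- Every homogeneous element is the image of the base point under an endomorphism. -/
theorem exists_end {δ : Γ} {m : s.M hP} (hm : m ∈ s.homM hP δ) :
    ∃ g : s.M hP →ₗ[R] s.M hP, g (s.pt hP) = m := by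
  classical
  obtain ⟨v, hvm, hv⟩ := s.exists_solution_sys hP hm
  let g := Finsupp.linearCombination R (fun y : Option s.J => y.elim m v)
  -- The unknowns go to a solution `v` for the right-hand side `Y m`, and homogeneous relations
  -- valid for the base point remain valid for `m`.
  have hg0 : ∀ {γ : Γ} {c : s.F}, c ∈ s.homF γ → s.Vanish c → g c = 0 := by
    intro γ c hc h
    obtain ⟨S, hS, hcS⟩ := s.exists_cover c
    rw [s.vanish_iff hP hS hc hcS] at h
    have := s.sum_smul_add_eq_zero_of_sing hP (Equiv.refl S) (s.hd_sub S) (s.regular S hS)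
      (fun i => s.hY i) hm (fun k => hvm k) (fun i => by
        rw [← hv S hS i i.2]
        exact Finset.sum_coe_sort S (fun j => s.U i j • v j)) (fun k => hc (some k))
      (r := c none) (by simpa [deg] using hc none) h
    rw [← this, Finset.sum_coe_sort S (fun j => c (some j) • v j)]
    conv_lhs => rw [s.eq_sum_single hcS]
    simp only [g, map_add, map_sum, map_smul, Finsupp.linearCombination_single, Option.elim_some,
      Option.elim_none, one_smul]
  have hgm : ∀ {γ : Γ} {c : s.F}, c ∈ s.homF γ → g c ∈ s.homM hP (γ + δ) := by
    intro γ c hc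
    simp only [g, Finsupp.linearCombination_apply]
    refine sum_mem fun y _ => ?_
    rcases y with _ | y
    · have := s.smul_mem_homM hP (hc none) hm
      rwa [deg, Option.elim_none, sub_zero] at this
    · have := s.smul_mem_homM hP (hc (some y)) (hvm y)
      rwa [deg, Option.elim_some, ← add_assoc, sub_add_cancel] at this
  -- `g` raises degrees by `δ` on the right, so it respects components; this reduces the vanishing
  -- on `N` to homogeneous elements.
  have hgc : ∀ (γ : Γ) (c : s.F), comp (s.homM hP) (γ + δ) (g c) = g (s.compF γ c) := by
    intro γ
    have : (comp (s.homM hP) (γ + δ)).comp g.toAddMonoidHom =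
        g.toAddMonoidHom.comp (s.compF γ) := by
      refine AddMonoidHom.eq_of_eqOn_dense s.closure_homF fun c hc => ?_
      obtain ⟨η, hη⟩ := Set.mem_iUnion.1 hc
      change comp (s.homM hP) (γ + δ) (g c) = g (s.compF γ c)
      rcases eq_or_ne η γ with rfl | hne
      · rw [s.compF_same hη, comp_same _ (hgm hη)]
      · rw [s.compF_ne hη hne, comp_ne _ (hgm hη) (by simpa using hne), map_zero]
    exact fun c => DFunLike.congr_fun this c
  refine ⟨(s.N hP).liftQ g fun c hc => ?_, ?_⟩
  · refine eq_zero_of_comp (s.homM hP) fun η => ?_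
    have := hgc (η - δ) c
    rw [sub_add_cancel] at this
    rw [this]
    exact hg0 (s.compF_mem _ _) (hc _)
  · refine (Submodule.liftQ_apply _ _ _).trans ?_
    simp [g]

end Sys

/-- The regular systems of linear equations with homogeneous coefficients. -/
abbrev Gen (𝒜 : Γ → AddSubgroup R) (P : Set (SqMat R)) : Type u :=
  {g : Σ n : ℕ, Matrix (Fin n) (Fin n) R × (Fin n → R) //
    ∃ α β, HD 𝒜 α β g.2.1 ∧ (∀ i, g.2.2 i ∈ 𝒜 (α i)) ∧ ¬ Sing P g.2.1}

/-- The unknowns of all regular systems. -/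
abbrev GenIdx (𝒜 : Γ → AddSubgroup R) (P : Set (SqMat R)) : Type u := Σ g : Gen 𝒜 P, Fin g.1.1

/-- The unknowns of finitely many regular systems. -/
def genFinset (S : Finset (Gen 𝒜 P)) : Finset (GenIdx 𝒜 P) := S.sigma fun _ => Finset.univ

theorem mem_genFinset {S : Finset (Gen 𝒜 P)} {j : GenIdx 𝒜 P} : j ∈ genFinset S ↔ j.1 ∈ S := by
  simp [genFinset]

/-- All regular systems are placed side by side in disjoint unknowns. The matrix is block diagonal,
and the exhausting subsystems are the finite unions of blocks. -/
theorem exists_sys (hP : IsGrPrimeMatrixIdeal 𝒜 P) : Nonempty (Sys 𝒜 P) := by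
  classical
  have hg : ∀ g : Gen 𝒜 P, ∃ α β, HD 𝒜 α β g.1.2.1 ∧ (∀ i, g.1.2.2 i ∈ 𝒜 (α i)) ∧
    ¬ Sing P g.1.2.1 := fun g => g.2
  choose a b hab ha sg using hg
  obtain ⟨U, hU1, hU2⟩ : ∃ U : Matrix (GenIdx 𝒜 P) (GenIdx 𝒜 P) R,
      (∀ (g : Gen 𝒜 P) (i j : Fin g.1.1), U ⟨g, i⟩ ⟨g, j⟩ = g.1.2.1 i j) ∧
      ∀ i j, i.1 ≠ j.1 → U i j = 0 :=
    ⟨Matrix.blockDiagonal' fun g : Gen 𝒜 P => g.1.2.1,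
      fun g i j => Matrix.blockDiagonal'_apply_eq _ _ _ _,
      fun i j h => by rw [Matrix.blockDiagonal'_apply, dif_neg h]⟩
  have hU : HD 𝒜 (fun j : GenIdx 𝒜 P => a j.1 j.2) (fun j : GenIdx 𝒜 P => b j.1 j.2) U := by
    rintro ⟨g, i⟩ ⟨h, j⟩
    by_cases hgh : g = h
    · subst hgh
      rw [hU1]
      exact hab g i j
    · rw [hU2 _ _ hgh]
      exact zero_mem _
  have hreg : ∀ S : Finset (Gen 𝒜 P), ¬ Sing P (U.submatrix
      (Subtype.val : genFinset S → GenIdx 𝒜 P) (Subtype.val : genFinset S → GenIdx 𝒜 P)) := by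
    intro S
    induction S using Finset.induction_on with
    | empty =>
      have : IsEmpty (genFinset (∅ : Finset (Gen 𝒜 P))) :=
        ⟨fun j => by simpa using mem_genFinset.1 j.2⟩
      exact hP.not_sing_of_isEmpty
    | insert g S hgS ih =>
      let e : Fin g.1.1 ⊕ genFinset S → genFinset (insert g S) :=
        Sum.elim (fun i => ⟨⟨g, i⟩, mem_genFinset.2 (Finset.mem_insert_self _ _)⟩) fun j => ⟨j.1,
          mem_genFinset.2 (Finset.mem_insert_of_mem (mem_genFinset.1 j.2))⟩
      have hne : ∀ j : genFinset S, g ≠ j.1.1 := by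
        rintro ⟨j, hj⟩ rfl
        exact hgS (mem_genFinset.1 hj)
      have he : Function.Bijective e := by
        constructor
        · rintro (i | i) (j | j) h
          · simpa [e] using h
          · exact absurd (congrArg (fun x => x.1.1) h) (hne j)
          · exact absurd (congrArg (fun x => x.1.1) h).symm (hne i)
          · have : i.1 = j.1 := congrArg (fun x => x.1) h
            rw [Subtype.ext this]
        · rintro ⟨⟨h, i⟩, hi⟩
          have hi' := Finset.mem_insert.1 (mem_genFinset.1 hi)
          by_cases hh : h = g
          · subst hh
            exact ⟨Sum.inl i, rfl⟩
          · exact ⟨Sum.inr ⟨⟨h, i⟩, mem_genFinset.2 (hi'.resolve_left hh)⟩, rfl⟩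
      have := hP.sing_fromBlocks_diag (Equiv.refl _) (Equiv.refl _) (hab g)
        (hU.submatrix (Subtype.val : genFinset S → GenIdx 𝒜 P)
        (Subtype.val : genFinset S → GenIdx 𝒜 P))
      rw [← sing_submatrix (Equiv.ofBijective e he) (Equiv.ofBijective e he)]
      intro h
      refine (not_or.2 ⟨sg g, ih⟩) (this.1 ?_)
      convert h using 1
      ext (i | i) (j | j)
      · exact (hU1 g i j).symm
      · exact (hU2 _ _ (hne j)).symm
      · exact (hU2 _ _ (hne i).symm).symm
      · rfl
  refine ⟨⟨GenIdx 𝒜 P, U, fun j => j.1.1.2.2 j.2, fun j => a j.1 j.2, fun j => b j.1 j.2, hU,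
    fun j => ha j.1 j.2, Set.range genFinset, ⟨∅, rfl⟩, ?_, ?_, ?_, ?_, ?_⟩⟩
  · rintro _ ⟨S, rfl⟩ _ ⟨S', rfl⟩
    refine ⟨_, ⟨S ∪ S', rfl⟩, fun j hj => ?_, fun j hj => ?_⟩
    · exact mem_genFinset.2 (Finset.mem_union_left _ (mem_genFinset.1 hj))
    · exact mem_genFinset.2 (Finset.mem_union_right _ (mem_genFinset.1 hj))
  · exact fun j => ⟨_, ⟨{j.1}, rfl⟩, mem_genFinset.2 (Finset.mem_singleton_self _)⟩
  · rintro _ ⟨S, rfl⟩ i hi j hj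
    exact hU2 i j fun h => hj (mem_genFinset.2 (h ▸ mem_genFinset.1 hi))
  · rintro _ ⟨S, rfl⟩
    exact hreg S
  · intro n A α' β' x hA hx sA
    let g : Gen 𝒜 P := ⟨⟨n, A, x⟩, α', β', hA, hx, sA⟩
    refine ⟨⟨fun i => ⟨g, i⟩, fun i j h => ?_⟩, ⟨{g}, ?_⟩, fun i j => hU1 g i j, fun i => rfl⟩
    · simpa using h
    · ext ⟨h, j⟩
      rw [mem_genFinset, Finset.mem_singleton, Finset.mem_map]
      constructor
      · rintro rfl
        exact ⟨j, Finset.mem_univ _, rfl⟩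
      · rintro ⟨i, -, hi⟩
        exact (congrArg Sigma.fst hi).symm

end Module

end GradedDivision

namespace GradedDivision

open Matrix

/-! ### Linear algebra over graded division rings -/

section Units

variable {K : Type*} [Ring K] {ι κ : Type*} [Fintype ι] [DecidableEq ι] [Fintype κ] [DecidableEq κ]

theorem isUnit_submatrix_of_isUnit {A : Matrix ι ι K} (e e' : κ ≃ ι) (h : IsUnit A) :
    IsUnit (A.submatrix e e') := by
  obtain ⟨X, hX, hX'⟩ := isUnit_iff_exists.1 h
  refine isUnit_iff_exists.2 ⟨X.submatrix e' e, ?_, ?_⟩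
  · rw [Matrix.submatrix_mul_equiv, hX, Matrix.submatrix_one_equiv]
  · rw [Matrix.submatrix_mul_equiv, hX', Matrix.submatrix_one_equiv]

theorem isUnit_submatrix_iff {A : Matrix ι ι K} (e e' : κ ≃ ι) :
    IsUnit (A.submatrix e e') ↔ IsUnit A := by
  refine ⟨fun h => ?_, isUnit_submatrix_of_isUnit e e'⟩
  have := isUnit_submatrix_of_isUnit e.symm e'.symm h
  rwa [Matrix.submatrix_submatrix, e.self_comp_symm, e'.self_comp_symm,
    Matrix.submatrix_id_id] at this

theorem isUnit_fromBlocks_diag_iff {A : Matrix ι ι K} {B : Matrix κ κ K} :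
    IsUnit (Matrix.fromBlocks A 0 0 B) ↔ IsUnit A ∧ IsUnit B := by
  simp only [isUnit_iff_exists]
  constructor
  · rintro ⟨X, h, h'⟩
    rw [← Matrix.fromBlocks_toBlocks X, Matrix.fromBlocks_multiply, ← Matrix.fromBlocks_one,
      Matrix.fromBlocks_inj] at h h'
    simp only [Matrix.zero_mul, Matrix.mul_zero, add_zero, zero_add] at h h'
    exact ⟨⟨_, h.1, h'.1⟩, ⟨_, h.2.2.2, h'.2.2.2⟩⟩
  · rintro ⟨⟨X, h, h'⟩, ⟨Y, k, k'⟩⟩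
    refine ⟨Matrix.fromBlocks X 0 0 Y, ?_, ?_⟩
    · rw [Matrix.fromBlocks_multiply]; simp [h, k]
    · rw [Matrix.fromBlocks_multiply]; simp [h', k']

theorem vecMul_eq_zero_of_isUnit {A : Matrix ι ι K} (h : IsUnit A) {v : ι → K}
    (hv : v ᵥ* A = 0) : v = 0 := by
  obtain ⟨X, hX, -⟩ := isUnit_iff_exists.1 h
  rw [← Matrix.vecMul_one v, ← hX, ← Matrix.vecMul_vecMul, hv, Matrix.zero_vecMul]

theorem mulVec_eq_zero_of_isUnit {A : Matrix ι ι K} (h : IsUnit A) {v : ι → K}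
    (hv : A *ᵥ v = 0) : v = 0 := by
  obtain ⟨X, -, hX⟩ := isUnit_iff_exists.1 h
  rw [← Matrix.one_mulVec v, ← hX, ← Matrix.mulVec_mulVec, hv, Matrix.mulVec_zero]

end Units

section Inverse

variable {Γ : Type v} [AddGroup Γ] [DecidableEq Γ] {K : Type*} [Ring K] {𝒦 : Γ → AddSubgroup K}
  [GradedRing 𝒦]

/-- The component of `y` of degree `-γ` is a right inverse of `x` as well, hence equal to `y`. -/
theorem inverse_mem {γ : Γ} {x y : K} (hx : x ∈ 𝒦 γ) (h : x * y = 1) (h' : y * x = 1) :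
    y ∈ 𝒦 (-γ) := by
  have h1 : x * comp 𝒦 (-γ) y = 1 := by
    have := comp_smul (M := K) 𝒦 (fun h h' => SetLike.GradedMul.mul_mem h h') hx y (δ := -γ)
    rw [smul_eq_mul, smul_eq_mul, h, add_neg_cancel, comp_same 𝒦 SetLike.GradedOne.one_mem] at this
    exact this.symm
  have h2 : y = comp 𝒦 (-γ) y := by
    rw [← one_mul (comp 𝒦 (-γ) y), ← h', mul_assoc, h1, mul_one]
  rw [h2]
  exact comp_mem 𝒦 _ _

variable (hK : IsGrDivisionRing 𝒦) (S : Subring K)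
  (hS : ∀ x ∈ S, SetLike.IsHomogeneousElem 𝒦 x → ∀ y : K, x * y = 1 → y * x = 1 → y ∈ S)
include hK hS

/-- The subring `S` is carried through the elimination so that inverse matrices are seen to have
entries in every such subring containing the coefficients. This yields the epicness of the
constructed ring. -/
theorem exists_inverse_mem {γ : Γ} {x : K} (hx : x ∈ 𝒦 γ) (hxS : x ∈ S) (h0 : x ≠ 0) :
    ∃ y ∈ S, y ∈ 𝒦 (-γ) ∧ x * y = 1 ∧ y * x = 1 := by
  obtain ⟨y, h, h'⟩ := isUnit_iff_exists.1 (hK.2 x ⟨γ, hx⟩ h0)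
  exact ⟨y, hS x hxS ⟨γ, hx⟩ y h h', inverse_mem hx h h', h, h'⟩

/-- A homogeneous matrix with more rows than columns has dependent rows. -/
theorem exists_vecMul_eq_zero : ∀ (n : ℕ) {ι : Type} [Fintype ι] (_ : n < Fintype.card ι)
    {α : ι → Γ} {β : Fin n → Γ} {C : Matrix ι (Fin n) K} (_ : HD 𝒦 α β C) (_ : ∀ i j, C i j ∈ S),
    ∃ (γ : Γ) (v : ι → K), (∀ i, v i ∈ 𝒦 (γ - α i)) ∧ (∀ i, v i ∈ S) ∧ v ≠ 0 ∧
      ∀ j, ∑ i, v i * C i j = 0 := by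
  classical
  intro n
  induction n with
  | zero =>
    intro ι _ hn α β C hC hCS
    obtain ⟨i⟩ := Fintype.card_pos_iff.1 hn
    refine ⟨α i, Pi.single i 1, fun k => ?_, fun k => ?_, ?_, fun j => j.elim0⟩
    · rcases eq_or_ne k i with rfl | h
      · simpa using SetLike.GradedOne.one_mem (A := 𝒦)
      · simp [h]
    · rcases eq_or_ne k i with rfl | h
      · simp
      · simp [h]
    · have := hK.1
      simp
  | succ n ih =>
    intro ι _ hn α β C hC hCS
    by_cases h0 : ∀ i, C i 0 = 0
    · obtain ⟨γ, v, h1, h2, h3, h4⟩ := ih (by omega) (hC.submatrix id Fin.succ)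
        (fun i j => hCS _ _)
      refine ⟨γ, v, h1, h2, h3, fun j => ?_⟩
      refine Fin.cases ?_ (fun j => ?_) j
      · simp [h0]
      · exact h4 j
    · push Not at h0
      obtain ⟨i₀, hi₀⟩ := h0
      -- Gaussian elimination with pivot `C i₀ 0`: `C'` is the Schur complement, without row `i₀`
      -- and the first column.
      obtain ⟨q, hqS, hq, hq1, hq2⟩ := exists_inverse_mem hK S hS (hC i₀ 0) (hCS _ _) hi₀
      rw [neg_sub] at hq
      let C' : Matrix {i // i ≠ i₀} (Fin n) K :=
        Matrix.of fun i j => C i j.succ - C i 0 * q * C i₀ j.succ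
      have hC' : HD 𝒦 (fun i : {i // i ≠ i₀} => α i) (fun j => β j.succ) C' := fun i j =>
        sub_mem (hC _ _) (mul_mem_sub (mul_mem_sub (hC _ _) hq) (hC _ _))
      obtain ⟨γ, v, h1, h2, h3, h4⟩ := ih (by
        rw [Fintype.card_subtype_compl, Fintype.card_subtype_eq]
        omega) hC' (fun i j => sub_mem (hCS _ _) (mul_mem (mul_mem (hCS _ _) hqS) (hCS _ _)))
      -- The coefficient at the pivot row is determined by the first column.
      let w : ι → K := fun i => if h : i ≠ i₀ then v ⟨i, h⟩ else - ∑ k, v k * C k 0 * q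
      have hw : ∀ i : {i // i ≠ i₀}, w i = v i := fun i => dif_pos i.2
      have hw0 : w i₀ = - ∑ k, v k * C k 0 * q := dif_neg (by simp)
      refine ⟨γ, w, fun i => ?_, fun i => ?_, ?_, fun j => ?_⟩
      · by_cases hi : i = i₀
        · subst hi
          rw [hw0]
          exact neg_mem (sum_mem fun k _ => mul_mem_sub (mul_mem_sub (h1 k) (hC _ _)) hq)
        · rw [hw ⟨i, hi⟩]
          exact h1 ⟨i, hi⟩
      · by_cases hi : i = i₀
        · subst hi
          rw [hw0]
          exact neg_mem (sum_mem fun k _ => mul_mem (mul_mem (h2 k) (hCS _ _)) hqS)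
        · rw [hw ⟨i, hi⟩]
          exact h2 ⟨i, hi⟩
      · intro hw0
        refine h3 (funext fun i => ?_)
        rw [← hw, hw0]
        rfl
      · rw [Fintype.sum_eq_add_sum_subtype_ne _ i₀, hw0, neg_mul, neg_add_eq_zero]
        simp only [hw]
        refine Fin.cases ?_ (fun j => ?_) j
        · rw [Finset.sum_mul]
          exact Finset.sum_congr rfl fun k _ => by rw [mul_assoc _ q, hq2, mul_one]
        · have := h4 j
          simp only [C', Matrix.of_apply, mul_sub, Finset.sum_sub_distrib] at this
          rw [sub_eq_zero] at this
          rw [this, Finset.sum_mul]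
          exact Finset.sum_congr rfl fun k _ => by simp only [mul_assoc]

/-- Appending the unit vector `e_j` to the rows of `A` gives `n + 1` rows of length `n`, which are
dependent. The coefficient of `e_j` is nonzero because `A` has no left kernel, and dividing by it
gives row `j` of the inverse. -/
theorem exists_left_inverse {n : ℕ} {α β : Fin n → Γ} {A : Matrix (Fin n) (Fin n) K}
    (hA : HD 𝒦 α β A) (hAS : ∀ i j, A i j ∈ S)
    (h : ∀ (γ : Γ) (v : Fin n → K), (∀ i, v i ∈ 𝒦 (γ - α i)) → v ᵥ* A = 0 → v = 0) :
    ∃ X : Matrix (Fin n) (Fin n) K, X * A = 1 ∧ HD 𝒦 β α X ∧ ∀ i j, X i j ∈ S := by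
  have key : ∀ j, ∃ x : Fin n → K, (∀ i, x i ∈ 𝒦 (β j - α i)) ∧ (∀ i, x i ∈ S) ∧
      ∀ k, ∑ i, x i * A i k = (1 : Matrix (Fin n) (Fin n) K) j k := by
    intro j
    let C : Matrix (Fin n ⊕ Unit) (Fin n) K :=
      Matrix.of (Sum.elim (fun i => A i) fun _ => (1 : Matrix (Fin n) (Fin n) K) j)
    have hC : HD 𝒦 (Sum.elim α fun _ => β j) β C := by
      rintro (i | i) k
      · exact hA i k
      · exact HD.one β j k
    obtain ⟨γ, v, h1, h2, h3, h4⟩ := exists_vecMul_eq_zero hK S hS n (by simp) hC (by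
      rintro (i | i) k
      · exact hAS i k
      · change (1 : Matrix (Fin n) (Fin n) K) j k ∈ S
        rw [Matrix.one_apply]
        split_ifs
        · exact one_mem S
        · exact zero_mem S)
    have h4 : ∀ k, ∑ i, v (Sum.inl i) * A i k +
        v (Sum.inr ()) * (1 : Matrix (Fin n) (Fin n) K) j k = 0 := fun k => by
      simpa [C, Fintype.sum_sum_type] using h4 k
    set t := v (Sum.inr ()) with ht
    have ht0 : t ≠ 0 := by
      intro ht0
      apply h3
      have := h γ (fun i => v (Sum.inl i)) (fun i => h1 (Sum.inl i)) (funext fun k => by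
        have := h4 k
        rw [ht0, zero_mul, add_zero] at this
        exact this)
      funext i
      rcases i with i | i
      · exact congrFun this i
      · exact ht0
    obtain ⟨t', ht'S, ht', htt, htt'⟩ := exists_inverse_mem hK S hS (h1 (Sum.inr ())) (h2 _) ht0
    rw [neg_sub] at ht'
    refine ⟨fun i => - (t' * v (Sum.inl i)), fun i => neg_mem (mul_mem_sub ht' (h1 (Sum.inl i))),
      fun i => neg_mem (mul_mem ht'S (h2 _)), fun k => ?_⟩
    have := congrArg (t' * ·) (h4 k)
    simp only [mul_add, mul_zero, Finset.mul_sum] at this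
    rw [← mul_assoc t', htt', one_mul] at this
    simp only [neg_mul, Finset.sum_neg_distrib, mul_assoc]
    exact neg_eq_of_add_eq_zero_right this
  choose X hX hXS hXA using key
  exact ⟨Matrix.of X, by ext j k; exact hXA j k, fun i j => hX i j, hXS⟩

/-- A left inverse `X` of `A` has no left kernel either, since `X A = 1`. So `X` has a left inverse
too, which must be `A`. -/
theorem isUnit_of_vecMul {n : ℕ} {α β : Fin n → Γ} {A : Matrix (Fin n) (Fin n) K}
    (hA : HD 𝒦 α β A) (hAS : ∀ i j, A i j ∈ S)
    (h : ∀ (γ : Γ) (v : Fin n → K), (∀ i, v i ∈ 𝒦 (γ - α i)) → v ᵥ* A = 0 → v = 0) :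
    ∃ X : Matrix (Fin n) (Fin n) K, A * X = 1 ∧ X * A = 1 ∧ HD 𝒦 β α X ∧ ∀ i j, X i j ∈ S := by
  obtain ⟨X, hXA, hX, hXS⟩ := exists_left_inverse hK S hS hA hAS h
  obtain ⟨Y, hYX, -, -⟩ := exists_left_inverse hK S hS hX hXS fun γ v _ hv => by
    rw [← Matrix.vecMul_one v, ← hXA, ← Matrix.vecMul_vecMul, hv, Matrix.zero_vecMul]
  have hYA : Y = A := by
    rw [← mul_one Y, ← hXA, ← mul_assoc, hYX, one_mul]
  exact ⟨X, hYA ▸ hYX, hXA, hX, hXS⟩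

/-- The entries of the inverse of a homogeneous matrix over `S` are in `S`. -/
theorem inverse_entries_mem {n : ℕ} {α β : Fin n → Γ} {A B : Matrix (Fin n) (Fin n) K}
    (hA : HD 𝒦 α β A) (hAS : ∀ i j, A i j ∈ S) (h : A * B = 1) (h' : B * A = 1) :
    HD 𝒦 β α B ∧ ∀ i j, B i j ∈ S := by
  obtain ⟨X, hAX, hXA, hX, hXS⟩ := isUnit_of_vecMul hK S hS hA hAS fun γ v _ hv =>
    vecMul_eq_zero_of_isUnit (isUnit_iff_exists.2 ⟨B, h, h'⟩) hv
  have : B = X := by rw [← one_mul B, ← hXA, mul_assoc, h, mul_one]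
  rw [this]
  exact ⟨hX, hXS⟩

end Inverse

/-! ### Singular kernels are gr-prime matrix ideals -/

section SingularKernel

variable {Γ : Type v} [AddGroup Γ] [DecidableEq Γ] {K : Type*} [Ring K] {𝒦 : Γ → AddSubgroup K}
  [GradedRing 𝒦] (hK : IsGrDivisionRing 𝒦)
include hK

theorem exists_kernel_of_not_isUnit {n : ℕ} {α β : Fin n → Γ} {A : Matrix (Fin n) (Fin n) K}
    (hA : HD 𝒦 α β A) (h : ¬ IsUnit A) :
    ∃ (γ : Γ) (v : Fin n → K), (∀ i, v i ∈ 𝒦 (γ - α i)) ∧ v ᵥ* A = 0 ∧ v ≠ 0 := by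
  by_contra! hv
  obtain ⟨X, h1, h2, -⟩ := isUnit_of_vecMul hK ⊤ (fun _ _ _ _ _ _ => Subring.mem_top _) hA
    (fun _ _ => Subring.mem_top _) hv
  exact h (isUnit_iff_exists.2 ⟨X, h1, h2⟩)

/-- Left kernel vectors `v` of `A` and `w` of `B` satisfy `v M = s e_j` and `w M = t e_j`. If `M`
were invertible, `s` and `t` would be nonzero and `w = t s⁻¹ v`, whence `w A = 0` and `t = 0`. -/
theorem not_isUnit_updateCol_add {n : ℕ} {α β : Fin n → Γ} {A B : Matrix (Fin n) (Fin n) K}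
    (hA : HD 𝒦 α β A) (hB : HD 𝒦 α β B) (j : Fin n) (hAB : ∀ i k, k ≠ j → A i k = B i k)
    (sA : ¬ IsUnit A) (sB : ¬ IsUnit B) :
    ¬ IsUnit (A.updateCol j fun i => A i j + B i j) := by
  intro hM
  set M := A.updateCol j fun i => A i j + B i j with hMdef
  obtain ⟨γ, v, hv, hvA, hv0⟩ := exists_kernel_of_not_isUnit hK hA sA
  obtain ⟨δ, w, hw, hwB, hw0⟩ := exists_kernel_of_not_isUnit hK hB sB
  obtain ⟨X, hX, -⟩ := isUnit_iff_exists.1 hM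
  have hMj : ∀ u : Fin n → K, (u ᵥ* M) j = (u ᵥ* A) j + (u ᵥ* B) j := by
    intro u
    simp [Matrix.vecMul, dotProduct, hMdef, mul_add, Finset.sum_add_distrib]
  have hMk : ∀ (u : Fin n → K) (k), k ≠ j → (u ᵥ* M) k = (u ᵥ* A) k ∧ (u ᵥ* M) k = (u ᵥ* B) k := by
    intro u k hk
    simp [Matrix.vecMul, dotProduct, hMdef, hk, hAB]
  set s := (v ᵥ* B) j with hs
  set t := (w ᵥ* A) j with ht
  have hvM : v ᵥ* M = Pi.single j s := by
    ext k
    rcases eq_or_ne k j with rfl | hk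
    · simp [hMj, hvA, hs]
    · rw [(hMk v k hk).1, hvA]
      simp [hk]
  have hwM : w ᵥ* M = Pi.single j t := by
    ext k
    rcases eq_or_ne k j with rfl | hk
    · simp [hMj, hwB, ht]
    · rw [(hMk w k hk).2, hwB]
      simp [hk]
  have hs0 : s ≠ 0 := by
    intro h
    rw [h, Pi.single_zero] at hvM
    exact hv0 (vecMul_eq_zero_of_isUnit hM hvM)
  have ht0 : t ≠ 0 := by
    intro h
    rw [h, Pi.single_zero] at hwM
    exact hw0 (vecMul_eq_zero_of_isUnit hM hwM)
  have hsh : s ∈ 𝒦 (γ - β j) := sum_mul_mem hv fun i => hB i j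
  obtain ⟨s', -, hss'⟩ := isUnit_iff_exists.1 (hK.2 s ⟨_, hsh⟩ hs0)
  have hwv : w = (t * s') • v := by
    refine sub_eq_zero.1 (vecMul_eq_zero_of_isUnit hM ?_)
    rw [Matrix.sub_vecMul, Matrix.smul_vecMul, hvM, hwM, ← Pi.single_smul, smul_eq_mul, mul_assoc,
      hss', mul_one, sub_self]
  apply ht0
  rw [ht, hwv, Matrix.smul_vecMul, hvA]
  simp

/-- If `M` is invertible, left kernel vectors of `A` and `B` are nonzero at `i` and can be scaled to
`1` there. Adding their other coordinates and keeping `1` at `i` gives a kernel vector of `M`. -/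
theorem not_isUnit_updateRow_add {n : ℕ} {α β : Fin n → Γ} {A B : Matrix (Fin n) (Fin n) K}
    (hA : HD 𝒦 α β A) (hB : HD 𝒦 α β B) (i : Fin n) (hAB : ∀ k j, k ≠ i → A k j = B k j)
    (sA : ¬ IsUnit A) (sB : ¬ IsUnit B) :
    ¬ IsUnit (A.updateRow i fun j => A i j + B i j) := by
  intro hM
  set M := A.updateRow i fun j => A i j + B i j with hMdef
  obtain ⟨γ, v, hv, hvA, hv0⟩ := exists_kernel_of_not_isUnit hK hA sA
  obtain ⟨δ, w, hw, hwB, hw0⟩ := exists_kernel_of_not_isUnit hK hB sB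
  have hsum : ∀ (u : Fin n → K) (N : Matrix (Fin n) (Fin n) K) (k : Fin n), (u ᵥ* N) k =
      u i * N i k + ∑ l : {l // l ≠ i}, u l * N l k := fun u N k =>
    Fintype.sum_eq_add_sum_subtype_ne _ i
  have hMA : ∀ (l : {l // l ≠ i}) k, M l k = A l k := fun l k => by
    rw [hMdef, Matrix.updateRow_ne l.2]
  have hMi : ∀ k, M i k = A i k + B i k := fun k => by rw [hMdef, Matrix.updateRow_self]
  -- rescaling of the relations
  have scale : ∀ {N : Matrix (Fin n) (Fin n) K} {γ : Γ} {v : Fin n → K},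
      (∀ k, v k ∈ 𝒦 (γ - α k)) → v ᵥ* N = 0 → v ≠ 0 → (∀ l : {l // l ≠ i}, ∀ k, N l k = A l k) →
      ∃ u : Fin n → K, u ᵥ* N = 0 ∧ u i = 1 := by
    intro N γ v hv hvN hv0 hN
    have h0 : v i ≠ 0 := by
      intro h0
      refine hv0 (vecMul_eq_zero_of_isUnit hM ?_)
      ext k
      rw [← hvN, hsum, hsum, h0]
      simp only [hN, hMA, zero_mul]
    obtain ⟨y, -, hy⟩ := isUnit_iff_exists.1 (hK.2 _ ⟨_, hv i⟩ h0)
    exact ⟨y • v, by rw [Matrix.smul_vecMul, hvN, smul_zero], hy⟩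
  obtain ⟨v, hvA, hvi⟩ := scale hv hvA hv0 fun _ _ => rfl
  obtain ⟨w, hwB, hwi⟩ := scale hw hwB hw0 fun l k => (hAB l k l.2).symm
  let u : Fin n → K := fun k => if k = i then 1 else v k + w k
  have hu : u ᵥ* M = 0 := by
    ext k
    have h1 := congrFun hvA k
    have h2 := congrFun hwB k
    rw [hsum, hvi] at h1
    rw [hsum, hwi] at h2
    rw [hsum, hMi]
    have : ∀ l : {l // l ≠ i}, u l * M l k = v l * A l k + w l * B l k := by
      intro l
      simp only [u, if_neg l.2]
      rw [hMA, add_mul, hAB l k l.2]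
    simp only [this, Finset.sum_add_distrib, u, if_true]
    calc _ = (1 * A i k + ∑ l : {l // l ≠ i}, v l * A l k) +
        (1 * B i k + ∑ l : {l // l ≠ i}, w l * B l k) := by
          rw [mul_add]; abel
      _ = _ := by rw [h1, h2]; simp
  have := hK.1
  exact one_ne_zero (α := K) (by simpa [u] using congrFun (vecMul_eq_zero_of_isUnit hM hu) i)

end SingularKernel

section Kernel

variable {Γ : Type v} [AddGroup Γ] [DecidableEq Γ] {R : Type u} [Ring R] {𝒜 : Γ → AddSubgroup R}
  [GradedRing 𝒜] (L : GrEpicDivisionRing 𝒜)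

theorem isUnit_diagSum_map {K : Type*} [Ring K] (φ : R →+* K) (A B : SqMat R) :
    IsUnit ((diagSum A B).2.map φ) ↔ IsUnit (A.2.map φ) ∧ IsUnit (B.2.map φ) := by
  rw [← isUnit_fromBlocks_diag_iff, ← isUnit_submatrix_iff finSumFinEquiv.symm finSumFinEquiv.symm]
  have : (diagSum A B).2.map φ = (Matrix.fromBlocks (A.2.map φ) 0 0 (B.2.map φ)).submatrix
      finSumFinEquiv.symm finSumFinEquiv.symm := by
    rw [← Matrix.map_zero φ (map_zero φ), ← Matrix.map_zero φ (map_zero φ), ← Matrix.fromBlocks_map]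
    rfl
  rw [this]
  rfl

theorem diagSum_mem_homMat {A B : SqMat R} (hA : A ∈ homMat 𝒜) (hB : B ∈ homMat 𝒜) :
    diagSum A B ∈ homMat 𝒜 := by
  obtain ⟨h0, α, β, hd⟩ := hA
  obtain ⟨-, α', β', hd'⟩ := hB
  exact ⟨Nat.add_pos_left h0 _, _, _, (HD.fromBlocks hd (HD.zero α β') (HD.zero α' β) hd').submatrix
    finSumFinEquiv.symm finSumFinEquiv.symm⟩

/-- The homogeneous square matrices that are not invertible over `L`. -/
def GrEpicDivisionRing.singularKernel : Set (SqMat R) :=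
  {A | A ∈ homMat 𝒜 ∧ ¬ IsUnit (A.2.map L.map)}

theorem GrEpicDivisionRing.hd_map {ι κ : Type*} {α : ι → Γ} {β : κ → Γ} {A : Matrix ι κ R}
    (hA : HD 𝒜 α β A) : HD L.grading α β (A.map L.map) := fun i j => L.map_mem _ _ (hA i j)

theorem GrEpicDivisionRing.isGrPrimeMatrixIdeal_singularKernel :
    IsGrPrimeMatrixIdeal 𝒜 L.singularKernel where
  subset_homMat _ h := h.1
  nonFull_subset := by
    rintro ⟨n, A⟩ ⟨hA, hf⟩
    refine ⟨hA, fun hu => ?_⟩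
    simp only [IsGrFull] at hf
    push Not at hf
    obtain ⟨r, α, β, l, X, Y, hX, hY, h, hr⟩ := hf
    obtain ⟨γ, v, -, -, hv0, hv⟩ := exists_vecMul_eq_zero L.isGrDivisionRing ⊤
      (fun _ _ _ _ _ _ => Subring.mem_top _) r (by simpa using hr) (L.hd_map hX)
      (fun _ _ => Subring.mem_top _)
    refine hv0 (vecMul_eq_zero_of_isUnit hu ?_)
    rw [h, Matrix.map_mul, ← Matrix.vecMul_vecMul, show v ᵥ* X.map L.map = 0 from funext hv,
      Matrix.zero_vecMul]
  detSum_mem := by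
    rintro n A B C ⟨hA, sA⟩ ⟨hB, sB⟩ ⟨⟨α, β, dA, dB⟩, h⟩
    rcases h with ⟨j, hAB, rfl⟩ | ⟨i, hAB, rfl⟩
    · have dC : HD 𝒜 α β (A.updateCol j fun i => A i j + B i j) := by
        intro i k
        rcases eq_or_ne k j with rfl | hk
        · simpa using add_mem (dA i k) (dB i k)
        · simpa [hk] using dA i k
      refine ⟨⟨hA.1, α, β, dC⟩, ?_⟩
      · have := not_isUnit_updateCol_add L.isGrDivisionRing (L.hd_map dA) (L.hd_map dB) j
          (fun i k hk => by simp [hAB i k hk]) sA sB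
        refine fun hu => this ?_
        convert hu using 1
        change _ = (A.updateCol j fun i => A i j + B i j).map L.map
        ext i k
        rcases eq_or_ne k j with rfl | hk
        · simp
        · simp [hk]
    · have dC : HD 𝒜 α β (A.updateRow i fun j => A i j + B i j) := by
        intro k j
        rcases eq_or_ne k i with rfl | hk
        · simpa using add_mem (dA k j) (dB k j)
        · simpa [Matrix.updateRow_ne hk] using dA k j
      refine ⟨⟨hA.1, α, β, dC⟩, ?_⟩
      · have := not_isUnit_updateRow_add L.isGrDivisionRing (L.hd_map dA) (L.hd_map dB) i
          (fun k j hk => by simp [hAB k j hk]) sA sB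
        refine fun hu => this ?_
        convert hu using 1
        change _ = (A.updateRow i fun j => A i j + B i j).map L.map
        ext k j
        rcases eq_or_ne k i with rfl | hk
        · simp
        · simp [Matrix.updateRow_ne hk]
  diagSum_mem A hA B hB := ⟨diagSum_mem_homMat hA.1 hB, fun h =>
    hA.2 ((isUnit_diagSum_map L.map A B).1 h).1⟩
  mem_or_mem A hA B hB h := by
    by_contra! hAB
    refine h.2 ((isUnit_diagSum_map L.map A B).2 ⟨?_, ?_⟩)
    · by_contra hu
      exact hAB.1 ⟨hA, hu⟩
    · by_contra hu
      exact hAB.2 ⟨hB, hu⟩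
  one_notMem h := h.2 (by
    have : (idMat R 1).2.map L.map = 1 := Matrix.map_one _ (map_zero _) (map_one _)
    rw [this]
    exact isUnit_one)
  perm_mem := permInv_iff.2 fun n A hA σ τ => by
    obtain ⟨⟨h0, α, β, hd⟩, hu⟩ := hA
    exact ⟨⟨h0, _, _, HD.submatrix hd σ τ⟩, fun h => hu ((isUnit_submatrix_iff σ τ).1 h)⟩

end Kernel

end GradedDivision

namespace GradedDivision

open Matrix

/-! ### The graded division ring attached to a gr-prime matrix ideal -/

section DivisionRing

variable {Γ : Type v} [AddGroup Γ] [DecidableEq Γ] {R : Type u} [Ring R] {𝒜 : Γ → AddSubgroup R}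
  [GradedRing 𝒜] {P : Set (SqMat R)}

namespace Sys

variable (s : Sys 𝒜 P) (hP : IsGrPrimeMatrixIdeal 𝒜 P)

theorem map_sol_unique {T : Finset s.J} (hT : T ∈ s.T) (g : s.M hP →ₗ[R] s.M hP)
    {u : T → s.M hP} (hu : ∀ i : T, ∑ j : T, s.U i j • u j = s.Y i • g (s.pt hP)) (j : T) :
    g (s.sol hP j) = u j := by
  rw [← sub_eq_zero]
  refine s.solution_unique hP (Equiv.refl _) (s.hd_sub T) (s.regular T hT)
    (u := fun j => g (s.sol hP j) - u j) (fun i => ?_) j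
  have := congrArg g (s.sum_smul_sol hP hT i)
  simp only [map_sum, map_smul] at this
  simp only [smul_sub, Finset.sum_sub_distrib, Matrix.submatrix_apply]
  rw [this, hu, sub_self]

/-- The images of the unknowns solve the system with the image of the base point, so they are
determined by it. -/
theorem end_eq_zero {g : s.M hP →ₗ[R] s.M hP} (h : g (s.pt hP) = 0) : g = 0 := by
  refine Submodule.linearMap_qext _ (Finsupp.lhom_ext' fun y => LinearMap.ext_ring ?_)
  rcases y with _ | j
  · exact h
  · obtain ⟨T, hT, hj⟩ := s.cover j
    exact s.map_sol_unique hP hT g (u := fun _ => 0) (fun i => by simp [h]) ⟨j, hj⟩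

theorem end_mem {g : s.M hP →ₗ[R] s.M hP} {γ δ : Γ} (hg : g (s.pt hP) ∈ s.homM hP δ)
    {m : s.M hP} (hm : m ∈ s.homM hP γ) : g m ∈ s.homM hP (γ + δ) := by
  obtain ⟨T, hT, f, r, hf, hr, rfl⟩ := s.exists_rep hP hm
  obtain ⟨u, hu, h⟩ := s.exists_solution hP (Equiv.refl T) (s.hd_sub T) (s.regular T hT)
    (fun i => s.hY i) hg
  simp only [map_add, map_sum, map_smul]
  refine add_mem (sum_mem fun j _ => ?_) (s.smul_mem_homM hP hr hg)
  rw [s.map_sol_unique hP hT g h]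
  have := s.smul_mem_homM hP (hf j) (hu j)
  rwa [← add_assoc, sub_add_cancel] at this

/-- The ring of endomorphisms of the module, written on the right. -/
def D : Type u := (Module.End R (s.M hP))ᵐᵒᵖ

noncomputable instance ringD : Ring (s.D hP) := inferInstanceAs (Ring (Module.End R (s.M hP))ᵐᵒᵖ)

/-- Evaluation at the base point. -/
noncomputable def ev : s.D hP ≃+ s.M hP :=
  AddEquiv.ofBijective
    (AddMonoidHom.mk' (fun d : s.D hP => d.unop (s.pt hP)) fun _ _ => rfl) (by
      constructor
      · rw [injective_iff_map_eq_zero]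
        exact fun d h => MulOpposite.unop_injective (s.end_eq_zero hP h)
      · intro m
        induction m using DirectSum.Decomposition.inductionOn (s.homM hP) with
        | zero => exact ⟨0, rfl⟩
        | homogeneous m =>
          obtain ⟨g, hg⟩ := s.exists_end hP m.2
          exact ⟨MulOpposite.op g, hg⟩
        | add m m' h h' =>
          obtain ⟨d, hd⟩ := h
          obtain ⟨d', hd'⟩ := h'
          exact ⟨d + d', by rw [map_add, hd, hd']⟩)

theorem ev_apply (d : s.D hP) : s.ev hP d = d.unop (s.pt hP) := rfl

theorem ev_mul (d d' : s.D hP) : s.ev hP (d * d') = d'.unop (s.ev hP d) := rfl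

theorem ev_one : s.ev hP 1 = s.pt hP := rfl

/-- The homogeneous components of the endomorphism ring. -/
noncomputable def homD (γ : Γ) : AddSubgroup (s.D hP) :=
  (s.homM hP γ).comap (s.ev hP).toAddMonoidHom

theorem mem_homD {γ : Γ} {d : s.D hP} : d ∈ s.homD hP γ ↔ s.ev hP d ∈ s.homM hP γ := Iff.rfl

theorem isInternal_homD : DirectSum.IsInternal (s.homD hP) := by
  classical
  refine isInternal_of_closure _ ?_ ?_
  · intro S d hd h0 γ hγ
    have h1 := congrArg (s.ev hP) h0
    rw [map_sum, map_zero] at h1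
    have h2 := congrArg (comp (s.homM hP) γ) h1
    rw [map_sum, map_zero, Finset.sum_eq_single γ,
      comp_same (s.homM hP) ((s.mem_homD hP).1 (hd γ))] at h2
    · exact (s.ev hP).map_eq_zero_iff.1 h2
    · exact fun δ _ hδ => comp_ne (s.homM hP) ((s.mem_homD hP).1 (hd δ)) hδ
    · exact fun h => absurd hγ h
  · rw [eq_top_iff]
    rintro d -
    rw [← (s.ev hP).symm_apply_apply d, ← DirectSum.sum_support_decompose (s.homM hP) (s.ev hP d),
      map_sum]
    refine sum_mem fun γ _ => AddSubgroup.subset_closure (Set.mem_iUnion.2 ⟨γ, ?_⟩)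
    change s.ev hP _ ∈ s.homM hP γ
    rw [AddEquiv.apply_symm_apply]
    exact SetLike.coe_mem _

noncomputable instance decompositionD : DirectSum.Decomposition (s.homD hP) :=
  (s.isInternal_homD hP).chooseDecomposition

noncomputable instance gradedRingD : GradedRing (s.homD hP) where
  one_mem := s.pt_mem hP
  mul_mem _ _ _ _ hx hy := s.end_mem hP hy hx

/-- The structure map. -/
noncomputable def mapD : R →+* s.D hP where
  toFun r := (s.ev hP).symm (r • s.pt hP)
  map_one' := by rw [one_smul, ← s.ev_one hP, AddEquiv.symm_apply_apply]
  map_zero' := by rw [zero_smul, map_zero]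
  map_add' a b := by rw [add_smul, map_add]
  map_mul' a b := by
    apply (s.ev hP).injective
    rw [s.ev_mul hP, AddEquiv.apply_symm_apply, AddEquiv.apply_symm_apply, map_smul,
      ← s.ev_apply hP, AddEquiv.apply_symm_apply, mul_smul]

theorem ev_mapD (r : R) : s.ev hP (s.mapD hP r) = r • s.pt hP := (s.ev hP).apply_symm_apply _

theorem ev_mapD_mul (r : R) (d : s.D hP) : s.ev hP (s.mapD hP r * d) = r • s.ev hP d := by
  rw [s.ev_mul hP, s.ev_mapD hP, map_smul, s.ev_apply hP]

theorem mapD_mem {γ : Γ} {r : R} (hr : r ∈ 𝒜 γ) : s.mapD hP r ∈ s.homD hP γ := by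
  rw [s.mem_homD hP, s.ev_mapD hP]
  simpa using s.smul_mem_homM hP hr (s.pt_mem hP)

instance nontrivialD : Nontrivial (s.D hP) := by
  refine ⟨1, 0, fun h => s.pt_ne_zero hP ?_⟩
  rw [← s.ev_one hP, h, map_zero]

/-- By Cramer's rule `d ≠ 0` says that its bordered matrix `[U -Y; f r]` is regular. Solving this
system with the last unit vector as right-hand side gives, in the last coordinate, the image of the
base point under an endomorphism that takes `d` to the base point. -/
theorem exists_right_inverse {γ : Γ} {d : s.D hP} (hd : d ∈ s.homD hP γ) (h0 : d ≠ 0) :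
    ∃ d' ∈ s.homD hP (-γ), d * d' = 1 := by
  obtain ⟨T, hT, f, r, hf, hr, h⟩ := s.exists_rep hP hd
  change s.ev hP d = _ at h
  have hB : HD 𝒜 (Sum.elim (fun i : T => s.α i) fun _ : Unit => γ)
      (Sum.elim (fun i : T => s.β i) fun _ : Unit => 0)
      (bord (s.U.submatrix Subtype.val Subtype.val) (fun i : T => s.Y i) f r) :=
    (s.hd_sub T).bord (fun i => by simpa using s.hY i) hf (by simpa using hr)
  have sB : ¬ Sing P (bord (s.U.submatrix Subtype.val Subtype.val) (fun i : T => s.Y i) f r) := by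
    rw [← s.sum_smul_add_eq_zero_iff hP (Equiv.refl T) (s.hd_sub T) (s.regular T hT)
      (fun i => s.hY i) (fun k => s.sol_mem hP k) (s.sum_smul_sol hP hT) hf hr, ← h]
    exact fun h => h0 ((s.ev hP).map_eq_zero_iff.1 h)
  obtain ⟨u, hu, hs⟩ := s.exists_solution_pt hP (Equiv.refl _) (hB.shift (-γ)) sB
    (x := Sum.elim (fun _ => 0) fun _ => 1) (by
      rintro (i | i)
      · exact zero_mem _
      · simpa using SetLike.GradedOne.one_mem (A := 𝒜))
  refine ⟨(s.ev hP).symm (u (Sum.inr ())), ?_, ?_⟩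
  · rw [s.mem_homD hP, AddEquiv.apply_symm_apply]
    simpa using hu (Sum.inr ())
  · apply (s.ev hP).injective
    have hz : ((s.ev hP).symm (u (Sum.inr ()))).unop (s.pt hP) = u (Sum.inr ()) := by
      rw [← s.ev_apply hP, AddEquiv.apply_symm_apply]
    rw [s.ev_mul hP, h, s.ev_one hP, map_add, map_sum, map_smul, hz]
    have h1 : ∀ j : T, ((s.ev hP).symm (u (Sum.inr ()))).unop (s.sol hP j) = u (Sum.inl j) :=
      s.map_sol_unique hP hT _ fun i => by
        rw [hz]
        have := hs (Sum.inl i)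
        simpa [Fintype.sum_sum_type, bord, add_neg_eq_zero] using this
    simp only [map_smul, h1]
    have := hs (Sum.inr ())
    simpa [Fintype.sum_sum_type, bord] using this

theorem isGrDivisionRing_homD : IsGrDivisionRing (s.homD hP) := by
  refine ⟨inferInstance, fun d ⟨γ, hd⟩ h0 => ?_⟩
  obtain ⟨d', hd', h⟩ := s.exists_right_inverse hP hd h0
  obtain ⟨d'', -, h'⟩ := s.exists_right_inverse hP hd' (by
    rintro rfl
    rw [mul_zero] at h
    exact zero_ne_one h)
  have : d = d'' := by rw [← mul_one d, ← h', ← mul_assoc, h, one_mul]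
  exact isUnit_iff_exists.2 ⟨d', h, this ▸ h'⟩

/-- Solving `A u = e_j pt` for all `j` gives a right inverse; it excludes a left kernel, and
`isUnit_of_vecMul` applies. -/
theorem isUnit_map_of_not_sing {n : ℕ} {α β : Fin n → Γ} {A : Matrix (Fin n) (Fin n) R}
    (hA : HD 𝒜 α β A) (sA : ¬ Sing P A) : IsUnit (A.map (s.mapD hP)) := by
  have key : ∀ j, ∃ u : Fin n → s.M hP, ∀ i,
      ∑ k, A i k • u k = (Pi.single j 1 : Fin n → R) i • s.pt hP := by
    intro j
    obtain ⟨u, -, hu⟩ := s.exists_solution_pt hP (Equiv.refl _) (hA.shift (-α j)) sA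
      (x := Pi.single j 1) (fun i => by
        rcases eq_or_ne i j with rfl | h
        · simpa using SetLike.GradedOne.one_mem (A := 𝒜)
        · simp [h])
    exact ⟨u, hu⟩
  choose u hu using key
  let X : Matrix (Fin n) (Fin n) (s.D hP) := Matrix.of fun k j => (s.ev hP).symm (u j k)
  have hX : A.map (s.mapD hP) * X = 1 := by
    ext1 i j
    apply (s.ev hP).injective
    simp only [Matrix.mul_apply, map_sum, Matrix.map_apply, s.ev_mapD_mul hP, X, Matrix.of_apply,
      AddEquiv.apply_symm_apply, hu]
    rcases eq_or_ne i j with rfl | h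
    · simp [s.ev_one hP]
    · simp [h]
  obtain ⟨Y, h1, h2, -⟩ := isUnit_of_vecMul (s.isGrDivisionRing_homD hP) ⊤
    (fun _ _ _ _ _ _ => Subring.mem_top _) (A := A.map (s.mapD hP))
    (fun i j => s.mapD_mem hP (hA i j)) (fun _ _ => Subring.mem_top _) fun γ v _ hv => by
      rw [← Matrix.vecMul_one v, ← hX, ← Matrix.vecMul_vecMul, hv, Matrix.zero_vecMul]
  exact isUnit_iff_exists.2 ⟨Y, h1, h2⟩

/-- Take a regular minor that is not contained in the size of any larger one, and a column `j`
outside it. Solve for column `j` by the columns of the minor; by Cramer's rule the relation holds in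
every row, because the bordered minors are singular. This is a nonzero right kernel vector. -/
theorem not_isUnit_map_of_sing {n : ℕ} {α β : Fin n → Γ} {A : Matrix (Fin n) (Fin n) R}
    (hA : HD 𝒜 α β A) (sA : Sing P A) : ¬ IsUnit (A.map (s.mapD hP)) := by
  classical
  let Q : ℕ → Prop := fun k => ∃ σ τ : Fin k ↪ Fin n, ¬ Sing P (A.submatrix σ τ)
  have hQ0 : Q 0 := ⟨⟨Fin.elim0, fun i => i.elim0⟩, ⟨Fin.elim0, fun i => i.elim0⟩,
    hP.not_sing_of_isEmpty⟩
  have hQle : ∀ k, Q k → k < n := by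
    rintro k ⟨σ, τ, h⟩
    have hk : k ≤ n := by simpa using Fintype.card_le_of_embedding σ
    refine lt_of_le_of_ne hk ?_
    rintro rfl
    refine h ((sing_submatrix (Equiv.ofBijective σ ?_) (Equiv.ofBijective τ ?_)).2 sA)
    · exact Finite.injective_iff_bijective.1 σ.injective
    · exact Finite.injective_iff_bijective.1 τ.injective
  -- The empty minor is regular and `A` itself is not, so the property fails from some `k` to `k +
  -- 1`.
  obtain ⟨k, hk, hmax⟩ : ∃ k, Q k ∧ ¬ Q (k + 1) := by
    by_contra! h
    have : ∀ k, Q k := fun k => Nat.rec hQ0 h k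
    exact lt_irrefl _ (hQle n (this n))
  have hkn := hQle k hk
  obtain ⟨σ, τ, hB⟩ := hk
  obtain ⟨j, hj⟩ : ∃ j, j ∉ Set.range τ := by
    by_contra! h
    have := Fintype.card_le_of_surjective τ h
    simp at this
    omega
  obtain ⟨u, hu, hs⟩ := s.exists_solution_pt hP (Equiv.refl _)
    ((HD.submatrix hA σ τ).shift (-β j)) hB (x := fun i => - A (σ i) j) (fun i => by
      simpa [sub_eq_add_neg] using neg_mem (hA (σ i) j))
  have key : ∀ i, ∑ l, A i (τ l) • u l + A i j • s.pt hP = 0 := by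
    intro i
    by_cases hi : i ∈ Set.range σ
    · obtain ⟨i, rfl⟩ := hi
      simpa [add_eq_zero_iff_eq_neg] using hs i
    · rw [s.sum_smul_add_eq_zero_iff hP (Equiv.refl _) ((HD.submatrix hA σ τ).shift (-β j)) hB
        (fun i => by simpa [sub_eq_add_neg] using neg_mem (hA (σ i) j)) hu hs (γ := α i + -β j)
        (fun l => by simpa using hA i (τ l)) (by simpa [sub_eq_add_neg] using hA i j)]
      by_contra hS
      let e : Fin (k + 1) ≃ Fin k ⊕ Unit :=
        finSumFinEquiv.symm.trans ((Equiv.refl _).sumCongr (Equiv.ofUnique _ _))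
      have inj : ∀ (f : Fin k ↪ Fin n) (i : Fin n), i ∉ Set.range f →
          Function.Injective (Sum.elim f fun _ : Unit => i) := by
        intro f i hi
        refine Function.Injective.sumElim f.injective (fun _ _ _ => rfl) fun a _ h => hi ⟨a, h⟩
      refine hmax ⟨e.toEmbedding.trans ⟨_, inj σ i hi⟩, e.toEmbedding.trans ⟨_, inj τ j hj⟩, ?_⟩
      rw [sing_congr e e (A := bord (A.submatrix σ τ) (fun i => - A (σ i) j)
        (fun l => A i (τ l)) (A i j))]
      · exact hS
      · intro a b
        change A (Sum.elim σ _ (e a)) (Sum.elim τ _ (e b)) = _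
        rcases e a with a | a <;> rcases e b with b | b <;> simp [bord]
  intro hU
  -- The kernel vector: `u` on the columns of the minor, `1` at `j`, and `0` elsewhere.
  let w : Fin n → s.D hP := fun b => if h : ∃ l, τ l = b then (s.ev hP).symm (u h.choose) else
    if b = j then 1 else 0
  have hwτ : ∀ l, w (τ l) = (s.ev hP).symm (u l) := by
    intro l
    have h : ∃ l', τ l' = τ l := ⟨l, rfl⟩
    simp only [w, dif_pos h]
    rw [τ.injective h.choose_spec]
  have hwj : w j = 1 := by
    have h : ¬ ∃ l, τ l = j := hj
    simp only [w, dif_neg h, if_true]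
  have hw0 : ∀ b, b ∉ Set.range (Sum.elim τ fun _ : Unit => j) → w b = 0 := by
    intro b hb
    have h : ¬ ∃ l, τ l = b := fun ⟨l, hl⟩ => hb ⟨Sum.inl l, hl⟩
    have h' : b ≠ j := fun h => hb ⟨Sum.inr (), h.symm⟩
    simp only [w, dif_neg h, if_neg h']
  have := congrFun (mulVec_eq_zero_of_isUnit hU (v := w) ?_) j
  · rw [hwj] at this
    exact one_ne_zero this
  · ext1 i
    apply (s.ev hP).injective
    rw [Pi.zero_apply, map_zero, ← key i, Matrix.mulVec, dotProduct, map_sum]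
    simp only [Matrix.map_apply, s.ev_mapD_mul hP]
    have inj : Function.Injective (Sum.elim τ fun _ : Unit => j) :=
      Function.Injective.sumElim τ.injective (fun _ _ _ => rfl) fun a _ h => hj ⟨a, h⟩
    rw [← Finset.sum_subset (Finset.subset_univ (Finset.univ.map ⟨_, inj⟩)) (fun b _ hb => ?_),
      Finset.sum_map, Fintype.sum_sum_type]
    · simp [hwτ, hwj, s.ev_one hP]
    · rw [hw0 b (by simpa [and_comm, eq_comm] using hb), map_zero, smul_zero]

/-- The unknowns of `T` are `U⁻¹ Y` over the new ring, and the inverse matrix has entries in `S`. -/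
theorem sol_mem_of_closed {S : Subring (s.D hP)} (hR : ∀ r, s.mapD hP r ∈ S)
    (hS : ∀ x ∈ S, SetLike.IsHomogeneousElem (s.homD hP) x → ∀ y, x * y = 1 → y * x = 1 → y ∈ S)
    {T : Finset s.J} (hT : T ∈ s.T) (j : T) : (s.ev hP).symm (s.sol hP j) ∈ S := by
  obtain ⟨n, e, -⟩ := exists_equiv_fin (Equiv.refl T)
  let A : Matrix (Fin n) (Fin n) R := (s.U.submatrix Subtype.val Subtype.val).submatrix e e
  have hA : HD 𝒜 _ _ A := HD.submatrix (s.hd_sub T) e e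
  have sA : ¬ Sing P A := by
    rw [sing_submatrix]
    exact s.regular T hT
  obtain ⟨B, h, h'⟩ := isUnit_iff_exists.1 (s.isUnit_map_of_not_sing hP hA sA)
  have hB := (inverse_entries_mem (s.isGrDivisionRing_homD hP) S hS
    (fun i j => s.mapD_mem hP (hA i j)) (fun i j => hR _) h h').2
  let w : Fin n → s.D hP := fun i => (s.ev hP).symm (s.sol hP (e i))
  have hw : A.map (s.mapD hP) *ᵥ w = fun i => s.mapD hP (s.Y (e i)) := by
    ext1 i
    apply (s.ev hP).injective
    rw [s.ev_mapD hP, ← s.sum_smul_sol hP hT (e i), ← Equiv.sum_comp e, Matrix.mulVec, dotProduct,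
      map_sum]
    simp only [Matrix.map_apply, s.ev_mapD_mul hP, w, AddEquiv.apply_symm_apply]
    rfl
  have hwB : w = B *ᵥ fun i => s.mapD hP (s.Y (e i)) := by
    rw [← hw, Matrix.mulVec_mulVec, h', Matrix.one_mulVec]
  have : (s.ev hP).symm (s.sol hP j) = w (e.symm j) := by simp only [w, Equiv.apply_symm_apply]
  rw [this, hwB, Matrix.mulVec, dotProduct]
  exact sum_mem (f := fun i => B (e.symm j) i * s.mapD hP (s.Y (e i)))
    fun i _ => mul_mem (hB _ _) (hR _)

theorem divisionClosure_mapD : divisionClosure (s.homD hP) (s.mapD hP) = ⊤ := by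
  rw [divisionClosure, sInf_eq_top]
  rintro S ⟨hR, hS⟩
  rw [eq_top_iff]
  rintro d -
  induction d using DirectSum.Decomposition.inductionOn (s.homD hP) with
  | zero => exact zero_mem _
  | add d d' h h' => exact add_mem h h'
  | @homogeneous γ d =>
    obtain ⟨T, hT, f, r, -, -, h⟩ := s.exists_rep hP d.2
    have : (d : s.D hP) = ∑ j : T, s.mapD hP (f j) * (s.ev hP).symm (s.sol hP j) + s.mapD hP r := by
      apply (s.ev hP).injective
      rw [map_add, map_sum]
      simp only [s.ev_mapD_mul hP, AddEquiv.apply_symm_apply, s.ev_mapD hP]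
      exact h
    rw [this]
    exact add_mem (sum_mem fun j _ => mul_mem (hR _) (s.sol_mem_of_closed hP hR hS hT j)) (hR _)

/-- The graded epic `R`-division ring attached to a gr-prime matrix ideal. -/
noncomputable def divisionRing : GrEpicDivisionRing 𝒜 where
  carrier := s.D hP
  grading := s.homD hP
  map := s.mapD hP
  map_mem _ _ h := s.mapD_mem hP h
  isGrDivisionRing := s.isGrDivisionRing_homD hP
  epic := s.divisionClosure_mapD hP

theorem singularKernel_divisionRing : (s.divisionRing hP).singularKernel = P := by
  ext A
  constructor
  · rintro ⟨⟨-, α, β, hA⟩, h⟩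
    by_contra hAP
    exact h (s.isUnit_map_of_not_sing hP hA ((sing_fin hP.permInv A).not.2 hAP))
  · intro hAP
    have hA := hP.subset_homMat hAP
    refine ⟨hA, ?_⟩
    obtain ⟨-, α, β, hA⟩ := hA
    exact s.not_isUnit_map_of_sing hP hA ((sing_fin hP.permInv A).2 hAP)

end Sys

/-- Every gr-prime matrix ideal is the singular kernel of a graded epic `R`-division ring. -/
theorem exists_singularKernel_eq (hP : IsGrPrimeMatrixIdeal 𝒜 P) :
    ∃ K : GrEpicDivisionRing 𝒜, K.singularKernel = P := by
  obtain ⟨s⟩ := exists_sys hP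
  exact ⟨s.divisionRing hP, s.singularKernel_divisionRing hP⟩

end DivisionRing

end GradedDivision

namespace GradedDivision

open Matrix

/-! ### Gr-matrix ideals -/

section DiagSum

variable {R : Type u} [Ring R]

theorem diagSum_apply (A B : SqMat R) (i j : Fin A.1 ⊕ Fin B.1) :
    (diagSum A B).2 (finSumFinEquiv i) (finSumFinEquiv j) = Matrix.fromBlocks A.2 0 0 B.2 i j := by
  simp [diagSum]

variable {P : Set (SqMat R)} (hP : PermInv P)
include hP

theorem diagSum_comm_mem (A B : SqMat R) : diagSum A B ∈ P ↔ diagSum B A ∈ P := by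
  rw [← sing_diagSum hP, ← sing_diagSum hP]
  refine sing_congr (Equiv.sumComm _ _) (Equiv.sumComm _ _) ?_
  rintro (i | i) (j | j) <;> rfl

theorem sing_diagSum_diagSum (A B C : SqMat R) :
    Sing P (Matrix.fromBlocks (Matrix.fromBlocks A.2 0 0 B.2) 0 0 C.2) ↔
      diagSum (diagSum A B) C ∈ P := by
  rw [← sing_diagSum hP]
  refine sing_congr (finSumFinEquiv.sumCongr (Equiv.refl _))
    (finSumFinEquiv.sumCongr (Equiv.refl _)) ?_
  rintro (i | i) (j | j)
  · exact (diagSum_apply A B i j).symm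
  all_goals rfl

theorem diagSum_right_comm_mem (A B C : SqMat R) :
    diagSum (diagSum A B) C ∈ P ↔ diagSum (diagSum A C) B ∈ P := by
  rw [← sing_diagSum_diagSum hP, ← sing_diagSum_diagSum hP]
  refine sing_congr (sumRightComm _ _ _) (sumRightComm _ _ _) ?_
  rintro ((i | i) | i) ((j | j) | j) <;> rfl

theorem diagSum_assoc_mem (A B C : SqMat R) :
    diagSum (diagSum A B) C ∈ P ↔ diagSum A (diagSum B C) ∈ P := by
  rw [← sing_diagSum_diagSum hP, ← sing_diagSum hP]
  refine sing_congr ((Equiv.sumAssoc _ _ _).trans ((Equiv.refl _).sumCongr finSumFinEquiv))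
    ((Equiv.sumAssoc _ _ _).trans ((Equiv.refl _).sumCongr finSumFinEquiv)) ?_
  rintro ((i | i) | i) ((j | j) | j)
  · rfl
  · rfl
  · rfl
  · rfl
  · exact (diagSum_apply B C (Sum.inl i) (Sum.inl j)).symm
  · exact (diagSum_apply B C (Sum.inl i) (Sum.inr j)).symm
  · rfl
  · exact (diagSum_apply B C (Sum.inr i) (Sum.inl j)).symm
  · exact (diagSum_apply B C (Sum.inr i) (Sum.inr j)).symm

end DiagSum

theorem diagSum_idMat (R : Type u) [Ring R] (m n : ℕ) :
    diagSum (idMat R m) (idMat R n) = idMat R (m + n) := by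
  refine Sigma.ext rfl (heq_of_eq ?_)
  change (Matrix.fromBlocks (1 : Matrix (Fin m) (Fin m) R) 0 0
    (1 : Matrix (Fin n) (Fin n) R)).submatrix finSumFinEquiv.symm finSumFinEquiv.symm = 1
  rw [Matrix.fromBlocks_one, Matrix.submatrix_one_equiv]

section MatrixIdeal

variable {Γ : Type v} [AddGroup Γ] [DecidableEq Γ] {R : Type u} [Ring R] {𝒜 : Γ → AddSubgroup R}
  [GradedRing 𝒜]

theorem idMat_mem_homMat {n : ℕ} (hn : 1 ≤ n) : idMat R n ∈ homMat 𝒜 :=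
  ⟨hn, 0, 0, HD.one (fun _ => 0)⟩

theorem diagPow_mem_homMat {A : SqMat R} (hA : A ∈ homMat 𝒜) : ∀ k, diagPow A k ∈ homMat 𝒜
  | 0 => hA
  | k + 1 => diagSum_mem_homMat (diagPow_mem_homMat hA k) hA

theorem IsDetSum.submatrix {n : ℕ} {A B C : Matrix (Fin n) (Fin n) R} (h : IsDetSum 𝒜 A B C)
    (σ τ : Equiv.Perm (Fin n)) :
    IsDetSum 𝒜 (A.submatrix σ τ) (B.submatrix σ τ) (C.submatrix σ τ) := by
  obtain ⟨⟨α, β, hA, hB⟩, h⟩ := h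
  refine ⟨⟨_, _, HD.submatrix hA σ τ, HD.submatrix hB σ τ⟩, ?_⟩
  rcases h with ⟨j, h, rfl⟩ | ⟨i, h, rfl⟩
  · refine Or.inl ⟨τ.symm j, fun i k hk => h _ _ ?_, ?_⟩
    · rwa [Ne, ← Equiv.eq_symm_apply]
    · ext i k
      simp [Matrix.updateCol_apply, Equiv.eq_symm_apply]
  · refine Or.inr ⟨σ.symm i, fun k j hk => h _ _ ?_, ?_⟩
    · rwa [Ne, ← Equiv.eq_symm_apply]
    · ext i k
      simp [Matrix.updateRow_apply, Equiv.eq_symm_apply]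

theorem IsDetSum.fromBlocks {m n : ℕ} {A B C : Matrix (Fin n) (Fin n) R} (h : IsDetSum 𝒜 A B C)
    {X : Matrix (Fin m) (Fin m) R} {α' β' : Fin m → Γ} (hX : HD 𝒜 α' β' X) :
    IsDetSum 𝒜 ((Matrix.fromBlocks A 0 0 X).submatrix finSumFinEquiv.symm finSumFinEquiv.symm)
      ((Matrix.fromBlocks B 0 0 X).submatrix finSumFinEquiv.symm finSumFinEquiv.symm)
      ((Matrix.fromBlocks C 0 0 X).submatrix finSumFinEquiv.symm finSumFinEquiv.symm) := by
  obtain ⟨⟨α, β, hA, hB⟩, h⟩ := h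
  refine ⟨⟨_, _, (HD.fromBlocks hA (HD.zero α β') (HD.zero α' β) hX).submatrix
    finSumFinEquiv.symm finSumFinEquiv.symm, (HD.fromBlocks hB (HD.zero α β') (HD.zero α' β)
    hX).submatrix finSumFinEquiv.symm finSumFinEquiv.symm⟩, ?_⟩
  rcases h with ⟨j, h, rfl⟩ | ⟨i, h, rfl⟩
  · refine Or.inl ⟨finSumFinEquiv (Sum.inl j), fun i k hk => ?_, ?_⟩
    · obtain ⟨i, rfl⟩ := finSumFinEquiv.surjective i
      obtain ⟨k, rfl⟩ := finSumFinEquiv.surjective k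
      rcases i with i | i <;> rcases k with k | k
      · simpa using h i k fun h => hk (by rw [h])
      all_goals simp
    · ext i k
      obtain ⟨i, rfl⟩ := finSumFinEquiv.surjective i
      obtain ⟨k, rfl⟩ := finSumFinEquiv.surjective k
      simp only [Matrix.updateCol_apply, finSumFinEquiv.injective.eq_iff]
      rcases i with i | i <;> rcases k with k | k <;> simp [Matrix.updateCol_apply]
  · refine Or.inr ⟨finSumFinEquiv (Sum.inl i), fun k j hk => ?_, ?_⟩
    · obtain ⟨k, rfl⟩ := finSumFinEquiv.surjective k
      obtain ⟨j, rfl⟩ := finSumFinEquiv.surjective j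
      rcases k with k | k <;> rcases j with j | j
      · simpa using h k j fun h => hk (by rw [h])
      all_goals simp
    · ext k j
      obtain ⟨k, rfl⟩ := finSumFinEquiv.surjective k
      obtain ⟨j, rfl⟩ := finSumFinEquiv.surjective j
      simp only [Matrix.updateRow_apply, finSumFinEquiv.injective.eq_iff]
      rcases k with k | k <;> rcases j with j | j <;> simp [Matrix.updateRow_apply]

theorem IsDetSum.diagSum {n : ℕ} {A B C : Matrix (Fin n) (Fin n) R} (h : IsDetSum 𝒜 A B C)
    {X : SqMat R} (hX : X ∈ homMat 𝒜) : IsDetSum 𝒜 (n := n + X.1) (diagSum ⟨n, A⟩ X).2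
      (diagSum ⟨n, B⟩ X).2 (diagSum ⟨n, C⟩ X).2 := by
  obtain ⟨-, α', β', hX⟩ := hX
  exact h.fromBlocks hX

theorem nonFull_permInv : PermInv (nonFull 𝒜) := by
  refine permInv_iff.2 fun n A hA σ τ => ?_
  obtain ⟨⟨h0, α, β, hd⟩, hf⟩ := hA
  refine ⟨⟨h0, _, _, HD.submatrix hd σ τ⟩, fun hf' => hf ?_⟩
  intro r α β l X Y hX hY h
  refine hf' r _ _ l (X.submatrix σ id) (Y.submatrix id τ) (HD.submatrix hX σ id)
    (HD.submatrix hY id τ) ?_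
  change A.submatrix σ τ = _
  rw [show A = X * Y from h, Matrix.submatrix_mul X Y σ id τ Function.bijective_id]

/-- From `A = Y Z` one gets `A ⊕ X = (Y ⊕ 1) (Z ⊕ X)`, where both the size and the inner size grow
by the size of `X`. -/
theorem diagSum_mem_nonFull {A X : SqMat R} (hA : A ∈ nonFull 𝒜) (hX : X ∈ homMat 𝒜) :
    diagSum A X ∈ nonFull 𝒜 := by
  refine ⟨diagSum_mem_homMat hA.1 hX, fun hf => hA.2 ?_⟩
  obtain ⟨-, α', β', hX⟩ := hX
  intro r α β l Y Z hY hZ h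
  have := hf (r + X.1) _ _ _
    ((Matrix.fromBlocks Y 0 0 1).submatrix finSumFinEquiv.symm finSumFinEquiv.symm)
    ((Matrix.fromBlocks Z 0 0 X.2).submatrix finSumFinEquiv.symm finSumFinEquiv.symm)
    ((HD.fromBlocks hY (HD.zero α α') (HD.zero α' l) (HD.one α')).submatrix _ _)
    ((HD.fromBlocks hZ (HD.zero l β') (HD.zero α' β) hX).submatrix _ _) (by
      refine Eq.trans ?_ (Matrix.submatrix_mul_equiv (Matrix.fromBlocks Y 0 0 1)
        (Matrix.fromBlocks Z 0 0 X.2) finSumFinEquiv.symm finSumFinEquiv.symm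
        finSumFinEquiv.symm).symm
      rw [Matrix.fromBlocks_multiply, ← h]
      simp only [Matrix.mul_zero, Matrix.zero_mul, add_zero, zero_add, Matrix.one_mul]
      rfl)
  simpa [diagSum] using this

theorem DetSums.submatrix {W : Set (SqMat R)} (hW : PermInv W) {A : SqMat R} (h : DetSums 𝒜 W A)
    (σ τ : Equiv.Perm (Fin A.1)) : DetSums 𝒜 W ⟨A.1, A.2.submatrix σ τ⟩ := by
  induction h with
  | of A hA => exact .of _ (permInv_iff.1 hW _ _ hA σ τ)
  | nabla n A B C _ _ h ihA ihB => exact .nabla n _ _ _ (ihA σ τ) (ihB σ τ) (h.submatrix σ τ)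

theorem DetSums.diagSum {W : Set (SqMat R)} {X : SqMat R} (hX : X ∈ homMat 𝒜)
    (hW : ∀ A ∈ W, diagSum A X ∈ W) {A : SqMat R} (h : DetSums 𝒜 W A) :
    DetSums 𝒜 W (diagSum A X) := by
  induction h with
  | of A hA => exact .of _ (hW A hA)
  | nabla n A B C _ _ h ihA ihB => exact .nabla (n + X.1) _ _ _ ihA ihB (h.diagSum hX)

theorem detSums_nonFull_permInv : PermInv {A | DetSums 𝒜 (nonFull 𝒜) A} :=
  permInv_iff.2 fun _ _ hA σ τ => hA.submatrix nonFull_permInv σ τ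

theorem DetSums.diagSum_nonFull {A X : SqMat R} (hX : X ∈ homMat 𝒜)
    (h : DetSums 𝒜 (nonFull 𝒜) A) : DetSums 𝒜 (nonFull 𝒜) (GradedDivision.diagSum A X) :=
  h.diagSum hX fun _ hA => diagSum_mem_nonFull hA hX

/-- Gr-matrix ideals. -/
structure IsGrMatrixIdeal (𝒜 : Γ → AddSubgroup R) (J : Set (SqMat R)) : Prop where
  subset_homMat : J ⊆ homMat 𝒜
  nonFull_subset : nonFull 𝒜 ⊆ J
  detSum_mem : ∀ (n : ℕ) (A B C : Matrix (Fin n) (Fin n) R),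
    (⟨n, A⟩ : SqMat R) ∈ J → (⟨n, B⟩ : SqMat R) ∈ J → IsDetSum 𝒜 A B C → (⟨n, C⟩ : SqMat R) ∈ J
  diagSum_mem : ∀ A ∈ J, ∀ B ∈ homMat 𝒜, diagSum A B ∈ J
  permInv : PermInv J
  cancel : ∀ A ∈ homMat 𝒜, diagSum A (idMat R 1) ∈ J → A ∈ J

theorem IsDetSum.mem_homMat {n : ℕ} {A B C : Matrix (Fin n) (Fin n) R} (h : IsDetSum 𝒜 A B C)
    (hn : 0 < n) : (⟨n, C⟩ : SqMat R) ∈ homMat 𝒜 := by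
  obtain ⟨⟨α, β, hA, hB⟩, h⟩ := h
  suffices hC : HD 𝒜 α β C from ⟨hn, α, β, hC⟩
  intro i k
  rcases h with ⟨j, -, rfl⟩ | ⟨j, -, rfl⟩
  · rw [Matrix.updateCol_apply]
    split_ifs with hk
    · rw [hk]
      exact add_mem (hA i j) (hB i j)
    · exact hA i k
  · rw [Matrix.updateRow_apply]
    split_ifs with hi
    · rw [hi]
      exact add_mem (hA j k) (hB j k)
    · exact hA i k

theorem homMat_permInv : PermInv (homMat 𝒜) := by
  refine permInv_iff.2 fun n A hA σ τ => ?_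
  obtain ⟨h0, α, β, hd⟩ := hA
  exact ⟨h0, _, _, HD.submatrix hd σ τ⟩

theorem submatrix_diagSum_mem {J : Set (SqMat R)} (hJ : PermInv J) {n : ℕ}
    {A : Matrix (Fin n) (Fin n) R} {X : SqMat R} (σ τ : Equiv.Perm (Fin n))
    (h : diagSum ⟨n, A⟩ X ∈ J) : diagSum ⟨n, A.submatrix σ τ⟩ X ∈ J := by
  refine (sing_diagSum hJ ⟨n, A.submatrix σ τ⟩ X).1
    ((sing_congr (σ.sumCongr (Equiv.refl _)) (τ.sumCongr (Equiv.refl _)) ?_).2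
      ((sing_diagSum hJ ⟨n, A⟩ X).2 h))
  rintro (i | i) (j | j) <;> rfl

theorem isGrMatrixIdeal_leastGrMatrixIdeal : IsGrMatrixIdeal 𝒜 (leastGrMatrixIdeal 𝒜) where
  subset_homMat _ h := h.1
  nonFull_subset A hA := ⟨hA.1, 1, le_rfl, .of _ (diagSum_mem_nonFull hA (idMat_mem_homMat le_rfl))⟩
  detSum_mem := by
    rintro n A B C ⟨hA, p, hp, hpA⟩ ⟨hB, q, hq, hqB⟩ h
    refine ⟨h.mem_homMat hA.1, p + q, by omega, ?_⟩
    -- The identity summands of `A` and `B` may differ in size; both are enlarged to `p + q` before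
    -- the determinantal sum is formed.
    have hA' := hpA.diagSum_nonFull (idMat_mem_homMat hq)
    have hB' := hqB.diagSum_nonFull (idMat_mem_homMat hp)
    have hB'' := (diagSum_right_comm_mem detSums_nonFull_permInv _ _ _).1 hB'
    replace hA' := (diagSum_assoc_mem detSums_nonFull_permInv _ _ _).1 hA'
    replace hB'' := (diagSum_assoc_mem detSums_nonFull_permInv _ _ _).1 hB''
    rw [diagSum_idMat] at hA' hB''
    exact .nabla _ _ _ _ hA' hB'' (h.diagSum (idMat_mem_homMat (by omega)))
  diagSum_mem := by
    rintro A ⟨hA, n, hn, h⟩ B hB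
    exact ⟨diagSum_mem_homMat hA hB, n, hn,
      (diagSum_right_comm_mem detSums_nonFull_permInv _ _ _).1 (h.diagSum_nonFull hB)⟩
  permInv := by
    refine permInv_iff.2 fun k A hA σ τ => ?_
    obtain ⟨hA, n, hn, h⟩ := hA
    exact ⟨permInv_iff.1 homMat_permInv k A hA σ τ, n, hn,
      submatrix_diagSum_mem detSums_nonFull_permInv σ τ h⟩
  cancel := by
    rintro A hA ⟨-, n, hn, h⟩
    refine ⟨hA, 1 + n, by omega, ?_⟩
    rw [← diagSum_idMat]
    exact (diagSum_assoc_mem detSums_nonFull_permInv _ _ _).1 h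

/-- The ideal of all `X` with `X ⊕ C ∈ J`. -/
def colon (𝒜 : Γ → AddSubgroup R) (J : Set (SqMat R)) (C : SqMat R) : Set (SqMat R) :=
  {X | X ∈ homMat 𝒜 ∧ diagSum X C ∈ J}

namespace IsGrMatrixIdeal

variable {J : Set (SqMat R)} (hJ : IsGrMatrixIdeal 𝒜 J)
include hJ

theorem colon {C : SqMat R} (hC : C ∈ homMat 𝒜) : IsGrMatrixIdeal 𝒜 (colon 𝒜 J C) where
  subset_homMat _ h := h.1
  nonFull_subset _ hA := ⟨hA.1, hJ.nonFull_subset (diagSum_mem_nonFull hA hC)⟩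
  detSum_mem _ _ _ _ hA hB h :=
    ⟨h.mem_homMat hA.1.1, hJ.detSum_mem _ _ _ _ hA.2 hB.2 (h.diagSum hC)⟩
  diagSum_mem _ hA B hB := ⟨diagSum_mem_homMat hA.1 hB,
    (diagSum_right_comm_mem hJ.permInv _ _ _).1 (hJ.diagSum_mem _ hA.2 B hB)⟩
  permInv := permInv_iff.2 fun k A hA σ τ =>
    ⟨permInv_iff.1 homMat_permInv k A hA.1 σ τ, submatrix_diagSum_mem hJ.permInv σ τ hA.2⟩
  cancel _ hA h := ⟨hA, hJ.cancel _ (diagSum_mem_homMat hA hC)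
    ((diagSum_right_comm_mem hJ.permInv _ _ _).1 h.2)⟩

theorem subset_colon {C : SqMat R} (hC : C ∈ homMat 𝒜) : J ⊆ GradedDivision.colon 𝒜 J C :=
  fun A hA => ⟨hJ.subset_homMat hA, hJ.diagSum_mem A hA C hC⟩

omit hJ in
-- `diagPow A k` has `k + 1` summands, hence the `+ 1`. The induction moves one summand at a time to
-- the end by passing from `J` to `colon 𝒜 J A`, and so must range over all `J`.
theorem diagPow_add_mem {A : SqMat R} (hA : A ∈ homMat 𝒜) (l k : ℕ) :
    ∀ {J : Set (SqMat R)}, IsGrMatrixIdeal 𝒜 J → diagSum (diagPow A l) (diagPow A k) ∈ J →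
      diagPow A (l + k + 1) ∈ J := by
  induction k with
  | zero => exact fun _ h => h
  | succ k ih =>
    intro J hJ h
    have h1 : diagSum (diagPow A l) (diagPow A k) ∈ GradedDivision.colon 𝒜 J A :=
      ⟨diagSum_mem_homMat (diagPow_mem_homMat hA l) (diagPow_mem_homMat hA k),
        (diagSum_assoc_mem hJ.permInv _ _ _).2 h⟩
    exact (ih (hJ.colon hA) h1).2

/-- Suppose `B ⊕ C` is in `J` but neither summand is. By maximality the colon ideal of `C` contains
a power of `A`; so `C` lies in the colon ideal of that power, which therefore contains a power of
`A` too. Then `J` itself contains a power of `A`. -/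
theorem isGrPrimeMatrixIdeal_of_maximal {A : SqMat R} (hA : A ∈ homMat 𝒜)
    (h : ∀ k, diagPow A k ∉ J)
    (hmax : ∀ J', IsGrMatrixIdeal 𝒜 J' → (∀ k, diagPow A k ∉ J') → J ⊆ J' → J' ⊆ J) :
    IsGrPrimeMatrixIdeal 𝒜 J where
  subset_homMat := hJ.subset_homMat
  nonFull_subset := hJ.nonFull_subset
  detSum_mem := hJ.detSum_mem
  diagSum_mem := hJ.diagSum_mem
  perm_mem := hJ.permInv
  one_notMem h1 := h 0 (hJ.cancel A hA ((diagSum_comm_mem hJ.permInv _ _).1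
    (hJ.diagSum_mem _ h1 A hA)))
  mem_or_mem B hB C hC hBC := by
    by_contra! hn
    have key : ∀ B C, B ∈ homMat 𝒜 → C ∈ homMat 𝒜 → diagSum B C ∈ J → B ∉ J →
        ∃ k, diagSum (diagPow A k) C ∈ J := by
      intro B C hB hC hBC hBJ
      by_contra! hk
      exact hBJ (hmax _ (hJ.colon hC) (fun k hk' => hk k hk'.2) (hJ.subset_colon hC) ⟨hB, hBC⟩)
    obtain ⟨k, hk⟩ := key B C hB hC hBC hn.1
    obtain ⟨l, hl⟩ := key C (diagPow A k) hC (diagPow_mem_homMat hA k)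
      ((diagSum_comm_mem hJ.permInv _ _).1 hk) hn.2
    exact h _ (diagPow_add_mem hA l k hJ hl)

omit hJ in
theorem sUnion {c : Set (Set (SqMat R))} (hc : IsChain (· ⊆ ·) c) (hne : c.Nonempty)
    (h : ∀ J ∈ c, IsGrMatrixIdeal 𝒜 J) : IsGrMatrixIdeal 𝒜 (⋃₀ c) where
  subset_homMat := Set.sUnion_subset fun J hJ => (h J hJ).subset_homMat
  nonFull_subset := by
    obtain ⟨J, hJ⟩ := hne
    exact (h J hJ).nonFull_subset.trans (Set.subset_sUnion_of_mem hJ)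
  detSum_mem := by
    rintro n A B C ⟨J, hJ, hA⟩ ⟨J', hJ', hB⟩ hs
    rcases hc.total hJ hJ' with hsub | hsub
    · exact ⟨J', hJ', (h J' hJ').detSum_mem n A B C (hsub hA) hB hs⟩
    · exact ⟨J, hJ, (h J hJ).detSum_mem n A B C hA (hsub hB) hs⟩
  diagSum_mem := by
    rintro A ⟨J, hJ, hA⟩ B hB
    exact ⟨J, hJ, (h J hJ).diagSum_mem A hA B hB⟩
  permInv := permInv_iff.2 fun n A ⟨J, hJ, hA⟩ σ τ =>
    ⟨J, hJ, permInv_iff.1 (h J hJ).permInv n A hA σ τ⟩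
  cancel := by
    rintro A hA ⟨J, hJ, hA'⟩
    exact ⟨J, hJ, (h J hJ).cancel A hA hA'⟩

end IsGrMatrixIdeal

/-- A homogeneous matrix outside the nilradical avoids some gr-prime matrix ideal. -/
theorem exists_isGrPrimeMatrixIdeal_notMem {A : SqMat R} (hA : A ∈ homMat 𝒜)
    (h : A ∉ grMatrixNilradical 𝒜) : ∃ P, IsGrPrimeMatrixIdeal 𝒜 P ∧ A ∉ P := by
  have h0 : ∀ k, diagPow A k ∉ leastGrMatrixIdeal 𝒜 := fun k hk => h ⟨hA, k, hk⟩
  obtain ⟨J, -, hJ⟩ := zorn_subset_nonempty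
    {J : Set (SqMat R) | IsGrMatrixIdeal 𝒜 J ∧ ∀ k, diagPow A k ∉ J} (by
      intro c hc hch hne
      refine ⟨⋃₀ c, ⟨.sUnion hch hne fun J hJ => (hc hJ).1, ?_⟩,
        fun J hJ => Set.subset_sUnion_of_mem hJ⟩
      rintro k ⟨J, hJ, hk⟩
      exact (hc hJ).2 k hk) _ ⟨isGrMatrixIdeal_leastGrMatrixIdeal, h0⟩
  exact ⟨J, hJ.prop.1.isGrPrimeMatrixIdeal_of_maximal hA hJ.prop.2
    fun J' h1 h2 h3 => hJ.le_of_ge ⟨h1, h2⟩ h3, hJ.prop.2 0⟩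

/-- The nilradical is contained in all gr-prime matrix ideals. -/
theorem grMatrixNilradical_subset {P : Set (SqMat R)} (hP : IsGrPrimeMatrixIdeal 𝒜 P) :
    grMatrixNilradical 𝒜 ⊆ P := by
  have h1 : ∀ A, DetSums 𝒜 (nonFull 𝒜) A → A ∈ P := by
    intro A h
    induction h with
    | of A hA => exact hP.nonFull_subset hA
    | nabla n A B C _ _ h ihA ihB => exact hP.detSum_mem n A B C ihA ihB h
  have h2 : leastGrMatrixIdeal 𝒜 ⊆ P := by
    rintro A ⟨hA, n, hn, h⟩
    refine (hP.mem_or_mem A hA _ (idMat_mem_homMat hn) (h1 _ h)).resolve_right fun h => ?_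
    exact hP.not_sing_one ((sing_fin hP.permInv _).2 h)
  rintro A ⟨hA, k, hk⟩
  replace hk := h2 hk
  induction k with
  | zero => exact hk
  | succ k ih =>
    exact (hP.mem_or_mem _ (diagPow_mem_homMat hA k) A hA hk).elim ih id

end MatrixIdeal

end GradedDivision

namespace GradedDivision

open Matrix

/-! ### Existence and uniqueness of gr-specializations -/

section Blocks

variable {K : Type*} [Ring K] {ι κ : Type*} [Fintype ι] [DecidableEq ι] [Fintype κ] [DecidableEq κ]

theorem isUnit_fromBlocks_one_upper (C : Matrix ι κ K) :
    IsUnit (Matrix.fromBlocks (1 : Matrix ι ι K) C 0 (1 : Matrix κ κ K)) := by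
  refine isUnit_iff_exists.2 ⟨Matrix.fromBlocks 1 (-C) 0 1, ?_, ?_⟩ <;>
    simp [Matrix.fromBlocks_multiply, Matrix.fromBlocks_one]

theorem isUnit_fromBlocks_one_lower (C : Matrix κ ι K) :
    IsUnit (Matrix.fromBlocks (1 : Matrix ι ι K) 0 C (1 : Matrix κ κ K)) := by
  refine isUnit_iff_exists.2 ⟨Matrix.fromBlocks 1 0 (-C) 1, ?_, ?_⟩ <;>
    simp [Matrix.fromBlocks_multiply, Matrix.fromBlocks_one]

theorem isUnit_fromBlocks_upper {A : Matrix ι ι K} {B : Matrix κ κ K} (hA : IsUnit A)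
    (hB : IsUnit B) (C : Matrix ι κ K) : IsUnit (Matrix.fromBlocks A C 0 B) := by
  have := ((isUnit_fromBlocks_diag_iff.2 ⟨isUnit_one, hB⟩).mul (isUnit_fromBlocks_one_upper C)).mul
    (isUnit_fromBlocks_diag_iff.2 ⟨hA, isUnit_one⟩)
  simpa [Matrix.fromBlocks_multiply] using this

theorem isUnit_fromBlocks_lower {A : Matrix ι ι K} {B : Matrix κ κ K} (hA : IsUnit A)
    (hB : IsUnit B) (C : Matrix κ ι K) : IsUnit (Matrix.fromBlocks A 0 C B) := by
  have := ((isUnit_fromBlocks_diag_iff.2 ⟨hA, isUnit_one⟩).mul (isUnit_fromBlocks_one_lower C)).mul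
    (isUnit_fromBlocks_diag_iff.2 ⟨isUnit_one, hB⟩)
  simpa [Matrix.fromBlocks_multiply] using this

end Blocks

section Specialization

variable {Γ : Type v} [AddGroup Γ] [DecidableEq Γ] {R : Type u} [Ring R] {𝒜 : Γ → AddSubgroup R}
  [GradedRing 𝒜] (K L : GrEpicDivisionRing 𝒜)

instance GrEpicDivisionRing.nontrivial : Nontrivial K.carrier := K.isGrDivisionRing.1

/-- On the image of `R` both maps are prescribed, and they send an inverse matrix to an inverse of
the same matrix over `L`, which is unique. -/
theorem GrSpecialization.subsingleton : Subsingleton (GrSpecialization K L) := by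
  refine ⟨fun f g => GrSpecialization.ext ?_⟩
  suffices h : K.core L ≤ (RingHom.eqLocus f.toRingHom g.toRingHom).map (K.core L).subtype by
    ext c
    obtain ⟨c', hc', h⟩ := h c.2
    rw [← Subtype.ext h]
    exact hc'
  refine Subring.closure_le.2 ?_
  rintro x (⟨r, rfl⟩ | ⟨A, hA, B, h, h', i, j, rfl⟩)
  · exact ⟨⟨K.map r, K.map_mem_core L r⟩, (f.comm r).trans (g.comm r).symm, rfl⟩
  · have hB : ∀ i j, B i j ∈ K.core L := fun i j =>
      Subring.subset_closure (Or.inr ⟨A, hA, B, h, h', i, j, rfl⟩)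
    let B' : Matrix (Fin A.1) (Fin A.1) (K.core L) := Matrix.of fun i j => ⟨B i j, hB i j⟩
    let A' : Matrix (Fin A.1) (Fin A.1) (K.core L) :=
      Matrix.of fun i j => ⟨K.map (A.2 i j), K.map_mem_core L _⟩
    have hinj : Function.Injective (fun X : Matrix (Fin A.1) (Fin A.1) (K.core L) =>
        X.map (K.core L).subtype) := Matrix.map_injective Subtype.val_injective
    have h1 : A' * B' = 1 := hinj (by
      change (A' * B').map (K.core L).subtype = (1 : Matrix _ _ _).map (K.core L).subtype
      rw [Matrix.map_mul, Matrix.map_one _ (map_zero _) (map_one _)]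
      exact h)
    have h2 : B' * A' = 1 := hinj (by
      change (B' * A').map (K.core L).subtype = (1 : Matrix _ _ _).map (K.core L).subtype
      rw [Matrix.map_mul, Matrix.map_one _ (map_zero _) (map_one _)]
      exact h')
    have hf : A'.map f.toRingHom = A.2.map L.map := by
      ext i j
      exact f.comm _
    have hg : A'.map g.toRingHom = A.2.map L.map := by
      ext i j
      exact g.comm _
    have h3 : B'.map f.toRingHom * A.2.map L.map = 1 := by
      rw [← hf, ← Matrix.map_mul, h2, Matrix.map_one _ (map_zero _) (map_one _)]
    have h4 : A.2.map L.map * B'.map g.toRingHom = 1 := by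
      rw [← hg, ← Matrix.map_mul, h1, Matrix.map_one _ (map_zero _) (map_one _)]
    have h5 : B'.map f.toRingHom = B'.map g.toRingHom := left_inv_eq_right_inv h3 h4
    exact ⟨⟨B i j, hB i j⟩, congrFun (congrFun h5 i) j, rfl⟩

variable {K L}

theorem isUnit_map_of_inverted_subset (h : L.inverted ⊆ K.inverted) {ι : Type} [Fintype ι]
    [DecidableEq ι] {A : Matrix ι ι R} {α β : ι → Γ} (hA : HD 𝒜 α β A)
    (hu : IsUnit (A.map L.map)) : IsUnit (A.map K.map) := by
  rcases isEmpty_or_nonempty ι with hι | hι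
  · have : A.map K.map = 1 := Subsingleton.elim _ _
    rw [this]
    exact isUnit_one
  · obtain ⟨n, e, -⟩ := exists_equiv_fin (Equiv.refl ι)
    have := (h (a := ⟨n, A.submatrix e e⟩) ⟨mem_homMat_of_sing hA e e,
      (isUnit_submatrix_iff e e).2 hu⟩).2
    exact (isUnit_submatrix_iff (A := A.map K.map) e e).1 this

variable (K L)

/-- The homogeneous pairs that are obtained from the solutions over `K` and `L` of a system of
linear equations over `R` whose matrix is invertible over `L`. -/
def IsRational (γ : Γ) (e : K.carrier × L.carrier) : Prop :=
  ∃ (ι : Type) (_ : Fintype ι) (_ : DecidableEq ι) (A : Matrix ι ι R) (α β : ι → Γ) (x f : ι → R)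
    (r : R) (u : ι → K.carrier × L.carrier), HD 𝒜 α β A ∧ IsUnit (A.map L.map) ∧
    (∀ i, x i ∈ 𝒜 (α i)) ∧ (∀ j, f j ∈ 𝒜 (γ - β j)) ∧ r ∈ 𝒜 γ ∧
    (∀ j, (u j).1 ∈ K.grading (β j) ∧ (u j).2 ∈ L.grading (β j)) ∧
    (∀ i, ∑ j, K.map.prod L.map (A i j) * u j = K.map.prod L.map (x i)) ∧
    e = ∑ j, K.map.prod L.map (f j) * u j + K.map.prod L.map r

variable {K L}

theorem IsRational.mem {γ : Γ} {e : K.carrier × L.carrier} (h : IsRational K L γ e) :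
    e.1 ∈ K.grading γ ∧ e.2 ∈ L.grading γ := by
  obtain ⟨ι, _, _, A, α, β, x, f, r, u, hA, hu, hx, hf, hr, hum, hs, rfl⟩ := h
  rw [Prod.fst_add, Prod.snd_add, Prod.fst_sum, Prod.snd_sum]
  refine ⟨add_mem (sum_mem fun j _ => ?_) (K.map_mem _ _ hr),
    add_mem (sum_mem fun j _ => ?_) (L.map_mem _ _ hr)⟩
  · simpa using SetLike.GradedMul.mul_mem (K.map_mem _ _ (hf j)) (hum j).1
  · simpa using SetLike.GradedMul.mul_mem (L.map_mem _ _ (hf j)) (hum j).2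

theorem isRational_map {γ : Γ} {r : R} (hr : r ∈ 𝒜 γ) :
    IsRational K L γ (K.map.prod L.map r) :=
  ⟨Empty, inferInstance, inferInstance, 0, fun _ => 0, fun _ => 0, 0, 0, r, 0, fun i => i.elim,
    isUnit_of_subsingleton _, fun i => i.elim, fun i => i.elim, hr, fun i => i.elim,
    fun i => i.elim, by simp⟩

theorem IsRational.add {γ : Γ} {e e' : K.carrier × L.carrier} (h : IsRational K L γ e)
    (h' : IsRational K L γ e') : IsRational K L γ (e + e') := by
  obtain ⟨ι, _, _, A, α, β, x, f, r, u, hA, hu, hx, hf, hr, hum, hs, rfl⟩ := h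
  obtain ⟨ι', _, _, A', α', β', x', f', r', u', hA', hu', hx', hf', hr', hum', hs', rfl⟩ := h'
  refine ⟨ι ⊕ ι', inferInstance, inferInstance, Matrix.fromBlocks A 0 0 A', Sum.elim α α',
    Sum.elim β β', Sum.elim x x', Sum.elim f f', r + r', Sum.elim u u',
    hA.fromBlocks (HD.zero _ _) (HD.zero _ _) hA', ?_, ?_, ?_, add_mem hr hr', ?_, ?_, ?_⟩
  · rw [Matrix.fromBlocks_map]
    simpa using isUnit_fromBlocks_diag_iff.2 ⟨hu, hu'⟩
  · rintro (i | i)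
    exacts [hx i, hx' i]
  · rintro (i | i)
    exacts [hf i, hf' i]
  · rintro (i | i)
    exacts [hum i, hum' i]
  · rintro (i | i)
    · rw [Fintype.sum_sum_type]
      simpa [-RingHom.prod_apply] using hs i
    · rw [Fintype.sum_sum_type]
      simpa [-RingHom.prod_apply] using hs' i
  · rw [Fintype.sum_sum_type, map_add]
    simp only [Sum.elim_inl, Sum.elim_inr]
    abel

theorem IsRational.neg {γ : Γ} {e : K.carrier × L.carrier} (h : IsRational K L γ e) :
    IsRational K L γ (-e) := by
  obtain ⟨ι, _, _, A, α, β, x, f, r, u, hA, hu, hx, hf, hr, hum, hs, rfl⟩ := h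
  refine ⟨ι, inferInstance, inferInstance, A, α, β, x, fun j => - f j, - r, u, hA, hu, hx,
    fun j => neg_mem (hf j), neg_mem hr, hum, hs, ?_⟩
  simp only [map_neg, neg_mul, Finset.sum_neg_distrib, neg_add]

/-- The product is read off from the system `[A -xf'; 0 A']` in the unknowns `(u e', u')`, with
right-hand side `(xr', x')`. -/
theorem IsRational.mul {γ δ : Γ} {e e' : K.carrier × L.carrier} (h : IsRational K L γ e)
    (h' : IsRational K L δ e') : IsRational K L (γ + δ) (e * e') := by
  have he' := h'.mem
  obtain ⟨ι, _, _, A, α, β, x, f, r, u, hA, hu, hx, hf, hr, hum, hs, rfl⟩ := h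
  obtain ⟨ι', _, _, A', α', β', x', f', r', u', hA', hu', hx', hf', hr', hum', hs', h'⟩ := h'
  have hC : HD 𝒜 (fun i => α i + δ) β' (Matrix.of fun i j => - (x i * f' j)) := by
    refine fun i j => neg_mem ?_
    rw [add_sub_assoc]
    exact SetLike.GradedMul.mul_mem (hx i) (hf' j)
  refine ⟨ι ⊕ ι', inferInstance, inferInstance,
    Matrix.fromBlocks A (Matrix.of fun i j => - (x i * f' j)) 0 A', Sum.elim (fun i => α i + δ) α',
    Sum.elim (fun j => β j + δ) β', Sum.elim (fun i => x i * r') x',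
    Sum.elim f (fun j => r * f' j), r * r', Sum.elim (fun j => u j * e') u',
    (hA.shift δ).fromBlocks hC (HD.zero _ _) hA', ?_, ?_, ?_,
    SetLike.GradedMul.mul_mem hr hr', ?_, ?_, ?_⟩
  · rw [Matrix.fromBlocks_map, Matrix.map_zero _ (map_zero _)]
    exact isUnit_fromBlocks_upper hu hu' _
  · rintro (i | i)
    exacts [SetLike.GradedMul.mul_mem (hx i) hr', hx' i]
  · rintro (i | i)
    · simpa using hf i
    · rw [add_sub_assoc]
      exact SetLike.GradedMul.mul_mem hr (hf' i)
  · rintro (i | i)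
    exacts [⟨SetLike.GradedMul.mul_mem (hum i).1 he'.1, SetLike.GradedMul.mul_mem (hum i).2 he'.2⟩,
      hum' i]
  · rintro (i | i)
    · rw [Fintype.sum_sum_type]
      simp only [Matrix.fromBlocks_apply₁₁, Matrix.fromBlocks_apply₁₂, Sum.elim_inl, Sum.elim_inr,
        Matrix.of_apply, map_neg, map_mul, neg_mul, mul_assoc, Finset.sum_neg_distrib,
        ← Finset.mul_sum]
      simp only [← mul_assoc, ← Finset.sum_mul, hs]
      rw [h', mul_add, add_neg_cancel_comm]
    · rw [Fintype.sum_sum_type]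
      simpa [-RingHom.prod_apply] using hs' i
  · rw [Fintype.sum_sum_type]
    simp only [Sum.elim_inl, Sum.elim_inr, map_mul, mul_assoc, ← Finset.mul_sum]
    simp only [← mul_assoc, ← Finset.sum_mul]
    rw [add_mul, add_assoc, ← mul_add, ← h']

theorem isRational_inverse {n : ℕ} {α β : Fin n → Γ} {A : Matrix (Fin n) (Fin n) R}
    (hA : HD 𝒜 α β A) {B : Matrix (Fin n) (Fin n) K.carrier} {B' : Matrix (Fin n) (Fin n) L.carrier}
    (h1 : A.map K.map * B = 1) (h2 : B * A.map K.map = 1) (h3 : A.map L.map * B' = 1)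
    (h4 : B' * A.map L.map = 1) (i j : Fin n) :
    IsRational K L (β i - α j) (B i j, B' i j) := by
  have hB := (inverse_entries_mem K.isGrDivisionRing ⊤ (fun _ _ _ _ _ _ => Subring.mem_top _)
    (K.hd_map hA) (fun _ _ => Subring.mem_top _) h1 h2).1
  have hB' := (inverse_entries_mem L.isGrDivisionRing ⊤ (fun _ _ _ _ _ _ => Subring.mem_top _)
    (L.hd_map hA) (fun _ _ => Subring.mem_top _) h3 h4).1
  refine ⟨Fin n, inferInstance, inferInstance, A, fun i => α i + -α j, fun k => β k + -α j,
    Pi.single j 1, Pi.single i 1, 0, fun k => (B k j, B' k j), hA.shift _,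
    isUnit_iff_exists.2 ⟨B', h3, h4⟩, fun k => ?_, fun k => ?_, zero_mem _, fun k => ?_,
    fun k => ?_, ?_⟩
  · rcases eq_or_ne k j with rfl | h
    · simpa using SetLike.GradedOne.one_mem (A := 𝒜)
    · simp [h]
  · rcases eq_or_ne k i with rfl | h
    · simpa [← sub_eq_add_neg] using SetLike.GradedOne.one_mem (A := 𝒜)
    · simp [h]
  · exact ⟨by simpa [sub_eq_add_neg] using hB k j, by simpa [sub_eq_add_neg] using hB' k j⟩
  · have h1 := congrFun (congrFun h1 k) j
    have h3 := congrFun (congrFun h3 k) j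
    rw [Matrix.mul_apply] at h1 h3
    refine Prod.ext ?_ ?_
    · rw [Prod.fst_sum]
      refine h1.trans ?_
      rcases eq_or_ne k j with rfl | h
      · simp
      · simp [h]
    · rw [Prod.snd_sum]
      refine h3.trans ?_
      rcases eq_or_ne k j with rfl | h
      · simp
      · simp [h]
  · rw [Finset.sum_eq_single i]
    · simp
    · intro k _ hk
      simp [hk]
    · simp

/-- Over `L` one has `[A -x; f r] = [A 0; f e.2] [1 -u; 0 1]`, so for `e.2 ≠ 0` the bordered matrix
is invertible over `L`, hence over `K`. There `(u, 1)` is in its kernel if `e.1 = 0`. -/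
theorem IsRational.snd_eq_zero (hinv : L.inverted ⊆ K.inverted) {γ : Γ} {e : K.carrier × L.carrier}
    (h : IsRational K L γ e) (h0 : e.1 = 0) : e.2 = 0 := by
  have he := h.mem.2
  obtain ⟨ι, _, _, A, α, β, x, f, r, u, hA, hu, hx, hf, hr, hum, hs, h⟩ := h
  by_contra hne
  have hM : HD 𝒜 (Sum.elim α fun _ : Unit => γ) (Sum.elim β fun _ : Unit => 0) (bord A x f r) :=
    hA.bord (fun i => by simpa using hx i) hf (by simpa using hr)
  have hML : IsUnit ((bord A x f r).map L.map) := by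
    have h1 : IsUnit (Matrix.of fun _ _ : Unit => e.2) := by
      obtain ⟨q, hq, hq'⟩ := isUnit_iff_exists.1 (L.isGrDivisionRing.2 _ ⟨γ, he⟩ hne)
      refine isUnit_iff_exists.2 ⟨Matrix.of fun _ _ => q, ?_, ?_⟩
      · ext
        simpa [Matrix.mul_apply] using hq
      · ext
        simpa [Matrix.mul_apply] using hq'
    have h2 := (isUnit_fromBlocks_lower hu h1 (Matrix.of fun _ j => L.map (f j))).mul
      (isUnit_fromBlocks_one_upper (Matrix.of fun j (_ : Unit) => - (u j).2))
    convert h2 using 1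
    rw [Matrix.fromBlocks_multiply]
    ext (i | i) (j | j)
    · simp [bord]
    · have := congrArg Prod.snd (hs i)
      rw [Prod.snd_sum] at this
      simpa [bord, Matrix.mul_apply] using this.symm
    · simp [bord]
    · have := congrArg Prod.snd h
      rw [Prod.snd_add, Prod.snd_sum] at this
      simp [bord, Matrix.mul_apply, this]
  have hMK := isUnit_map_of_inverted_subset hinv hM hML
  have := congrFun (mulVec_eq_zero_of_isUnit hMK (v := Sum.elim (fun j => (u j).1) fun _ => 1) ?_)
    (Sum.inr ())
  · exact one_ne_zero this
  · ext1 (i | i)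
    · have := congrArg Prod.fst (hs i)
      rw [Prod.fst_sum] at this
      simp only [Matrix.mulVec, dotProduct, Fintype.sum_sum_type]
      simpa [bord, add_neg_eq_zero] using this
    · have := congrArg Prod.fst h
      rw [Prod.fst_add, Prod.fst_sum, h0] at this
      simp only [Matrix.mulVec, dotProduct, Fintype.sum_sum_type]
      simpa [bord] using this.symm

variable (K L)

/-- The monoid of homogeneous rational pairs. -/
def rationalMonoid : Submonoid (K.carrier × L.carrier) where
  carrier := {e | ∃ γ, IsRational K L γ e}
  one_mem' := ⟨0, by
    have := isRational_map (K := K) (L := L) (SetLike.GradedOne.one_mem (A := 𝒜))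
    rwa [map_one] at this⟩
  mul_mem' := fun ⟨_, h⟩ ⟨_, h'⟩ => ⟨_, h.mul h'⟩

/-- The graph of the specialization. -/
def graph : Subring (K.carrier × L.carrier) :=
  Subring.closure (rationalMonoid K L : Set (K.carrier × L.carrier))

variable {K L}

theorem IsRational.mem_graph {γ : Γ} {e : K.carrier × L.carrier} (h : IsRational K L γ e) :
    e ∈ graph K L := Subring.subset_closure ⟨γ, h⟩

theorem map_mem_graph (r : R) : K.map.prod L.map r ∈ graph K L := by
  induction r using DirectSum.Decomposition.inductionOn 𝒜 with
  | zero => rw [map_zero]; exact zero_mem _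
  | homogeneous r => exact (isRational_map r.2).mem_graph
  | add a b ha hb => rw [map_add]; exact add_mem ha hb

/-- The graph is additively generated by homogeneous rational pairs, and those of a fixed degree are
closed under addition. Single-valuedness of the graph can therefore be tested on rational pairs. -/
theorem isRational_comp {e : K.carrier × L.carrier} (h : e ∈ graph K L) (γ : Γ) :
    IsRational K L γ (comp K.grading γ e.1, comp L.grading γ e.2) := by
  have h0 : ∀ γ, IsRational K L γ (0, 0) := fun γ => by
    have := isRational_map (K := K) (L := L) (zero_mem (𝒜 γ))
    rwa [map_zero] at this
  rw [graph, Subring.mem_closure_iff, Submonoid.closure_eq] at h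
  induction h using AddSubgroup.closure_induction with
  | mem e he =>
    obtain ⟨δ, he⟩ := he
    rcases eq_or_ne δ γ with rfl | hne
    · rw [comp_same _ he.mem.1, comp_same _ he.mem.2]
      exact he
    · rw [comp_ne _ he.mem.1 hne, comp_ne _ he.mem.2 hne]
      exact h0 γ
  | zero => simpa using h0 γ
  | add e e' _ _ ih ih' =>
    rw [Prod.fst_add, Prod.snd_add, map_add, map_add]
    exact ih.add ih'
  | neg e _ ih =>
    rw [Prod.fst_neg, Prod.snd_neg, map_neg, map_neg]
    exact ih.neg

theorem comp_snd_eq_zero (hinv : L.inverted ⊆ K.inverted) {e : K.carrier × L.carrier}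
    (h : e ∈ graph K L) {γ : Γ} (h0 : comp K.grading γ e.1 = 0) : comp L.grading γ e.2 = 0 :=
  (isRational_comp h γ).snd_eq_zero hinv h0

theorem graph_unique (hinv : L.inverted ⊆ K.inverted) {a : K.carrier} {y y' : L.carrier}
    (h : (a, y) ∈ graph K L) (h' : (a, y') ∈ graph K L) : y = y' := by
  have := sub_mem h h'
  refine sub_eq_zero.1 (eq_zero_of_comp L.grading fun γ => comp_snd_eq_zero hinv this ?_)
  simp

theorem exists_mem_graph {a : K.carrier} (ha : a ∈ K.core L) : ∃ y, (a, y) ∈ graph K L := by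
  suffices h : K.core L ≤ (graph K L).map (RingHom.fst _ _) by
    obtain ⟨⟨a', y⟩, he, rfl⟩ := h ha
    exact ⟨y, he⟩
  refine Subring.closure_le.2 ?_
  rintro x (⟨r, rfl⟩ | ⟨A, hA, B, h, h', i, j, rfl⟩)
  · exact ⟨_, map_mem_graph r, rfl⟩
  · obtain ⟨⟨-, α, β, hd⟩, hu⟩ := hA
    obtain ⟨B', h3, h4⟩ := isUnit_iff_exists.1 hu
    exact ⟨_, (isRational_inverse hd h h' h3 h4 i j).mem_graph, rfl⟩

/-- If the matrices that are invertible over `L` are invertible over `K`, then there is exactly one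
gr-specialization from `K` to `L`. -/
theorem nonempty_unique_grSpecialization (hinv : L.inverted ⊆ K.inverted) :
    Nonempty (Unique (GrSpecialization K L)) := by
  choose g hg using fun a : K.core L => exists_mem_graph a.2
  let f : K.core L →+* L.carrier :=
    { toFun := g
      map_one' := graph_unique hinv (hg 1) (one_mem (graph K L))
      map_zero' := graph_unique hinv (hg 0) (zero_mem (graph K L))
      map_add' := fun a b => graph_unique hinv (hg (a + b)) (add_mem (hg a) (hg b))
      map_mul' := fun a b => graph_unique hinv (hg (a * b)) (mul_mem (hg a) (hg b)) }
  have := GrSpecialization.subsingleton K L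
  refine ⟨@Unique.mk' _ ⟨⟨hinv, f, fun γ x hx => ?_, fun r => ?_⟩⟩ this⟩
  · exact mem_of_comp L.grading fun δ hδ =>
      comp_snd_eq_zero hinv (hg x) (comp_ne K.grading hx hδ.symm)
  · exact graph_unique hinv (hg _) (map_mem_graph r)

end Specialization

end GradedDivision

/-! ### Comparison of singular kernels and the theorem -/

namespace GradedDivision

theorem inverted_subset_iff {Γ : Type v} [AddGroup Γ] [DecidableEq Γ] {R : Type u} [Ring R]
    {𝒜 : Γ → AddSubgroup R} {K L : GrEpicDivisionRing 𝒜} :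
    L.inverted ⊆ K.inverted ↔ K.singularKernel ⊆ L.singularKernel :=
  ⟨fun h A hA => ⟨hA.1, fun hu => hA.2 (h (a := A) ⟨hA.1, hu⟩).2⟩,
    fun h A hA => ⟨hA.1, by
      by_contra hu
      exact (h (a := A) ⟨hA.1, hu⟩).2 hA.2⟩⟩

end GradedDivision

open GradedDivision in
theorem mainTheorem6 {Γ : Type v} [AddGroup Γ] [DecidableEq Γ] {R : Type u} [Ring R]
    (𝒜 : Γ → AddSubgroup R) [GradedRing 𝒜] :
    (∃ K : GradedDivision.GrEpicDivisionRing 𝒜, K.IsUniversal) ↔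
      GradedDivision.IsGrPrimeMatrixIdeal 𝒜 (GradedDivision.grMatrixNilradical 𝒜) := by
  constructor
  · rintro ⟨K, hK⟩
    have hP := K.isGrPrimeMatrixIdeal_singularKernel
    have : grMatrixNilradical 𝒜 = K.singularKernel := by
      refine (grMatrixNilradical_subset hP).antisymm fun A hA => ?_
      -- A matrix outside the nilradical avoids some gr-prime matrix ideal, which is the singular
      -- kernel of some `L`; the specialization from `K` to `L` then keeps it out of the singular
      -- kernel of `K`.
      by_contra hAN
      obtain ⟨P, hP, hAP⟩ := exists_isGrPrimeMatrixIdeal_notMem hA.1 hAN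
      obtain ⟨L, rfl⟩ := exists_singularKernel_eq hP
      obtain ⟨f⟩ := hK L
      exact hAP (inverted_subset_iff.1 f.default.inverted_subset hA)
    rwa [this]
  · intro hN
    obtain ⟨K, hK⟩ := exists_singularKernel_eq hN
    refine ⟨K, fun L => nonempty_unique_grSpecialization (inverted_subset_iff.2 ?_)⟩
    rw [hK]
    exact grMatrixNilradical_subset L.isGrPrimeMatrixIdeal_singularKernel
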